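/- **Setting.** Let $d,A,T\ge 1$, $\lambda,r,b_a,B_a,\eta>0$. A linear bandit instance consists of action sets $\mathbb A_t=\{\mathbf a_{t,1},\dots,\mathbf a_{t,A}\}\subset\mathbb R^d$, $t\in[T]$, and a parameter $\mathbf w^*$. The action sets are drawn from an arbitrary prior under which almost surely $b_a\le\|\mathbf a_{t,k}\|_2\le B_a$ for all $t,k$ and $\|\mathbf a_{t,j}-\mathbf a_{t,k}\|_2\ge\eta$ for all $t$ and $j\ne k$; independently, $\mathbf w^*\sim\mathcal N(0,\lambda I_d)$. In round $t$ an algorithm $\mathsf{Alg}$ selects $\mathbf a_t\in\mathbb A_t$ at random from $D_{t-1}=(\mathbb A_j,\mathbf a_j,r_j)_{j<t}$ and $s_t=\mathbb A_t$, and receives $r_t=\langle\mathbf a_t,\mathbf w^*\rangle+\varepsilon_t$ with i.i.d. $\varepsilon_t\sim\mathcal N(0,r)$. Put $\Sigma_t=\frac r\lambda I_d+\sum_{j<t}\mathbf a_j\mathbf a_j^\top$ and $\mu_t=\Sigma_t^{-1}\sum_{j<t}r_j\mathbf a_j$. Thompson sampling is the policy $$\mathsf{Alg}_{\rm TS}(\mathbf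 a_{t,k}\mid D_{t-1},s_t)=\mathbb P_{\mathbf w\sim\mathcal N(\mu_t,r\Sigma_t^{-1})}\big(\langle\mathbf a_{t,k},\mathbf w\rangle=\max_j\langle\mathbf a_{t,j},\mathbf w\rangle\big).$$ **Transformers.** Let $\sigma(x)=\max(x,0)$. On tokens $\mathbf h_1,\dots,\mathbf h_N\in\mathbb R^D$, a masked attention layer with $M$ heads is the map $\mathbf h_i\mapsto\mathbf h_i+\sum_{m=1}^M\frac1i\sum_{j\le i}\sigma(\langle Q_m\mathbf h_i,K_m\mathbf h_j\rangle)V_m\mathbf h_j$, and an MLP layer of width $D'$ is the map $\mathbf h_i\mapsto\mathbf h_i+W_2\sigma(W_1\mathbf h_i)$. The transformer $\mathrm{TF}^{\mathsf R}_\theta$ projects all tokens to the Euclidean ball of radius $\mathsf R$ and then $L$ times applies an attention layer, an MLP layer and this projection; $|||\theta|||$ is the maximum over the layers of $\max_m\max(\|Q_m\|_{\rm op},\|K_m\|_{\rm op})+\sum_m\|V_m\|_{\rm op}+\|W_1\|_{\rm op}+\|W_2\|_{\rm op}$. Its input for $(D_{t-1},s_t)$ is $\mathbf h_1,\dots,\mathbf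 h_{2t-1}$, where $\mathbf h_{2j-1}=[\mathbf 0_{d+1};\mathbf a_{j,1};\dots;\mathbf a_{j,A};\mathbf 0_A;\mathbf 0;\mathrm{pos}_{2j-1}]$, $\mathbf h_{2j}=[\mathbf a_j;r_j;\mathbf 0_{Ad};\mathbf 0_A;\mathbf 0;\mathrm{pos}_{2j}]$ and $\mathrm{pos}_i=(i,i^2,1)$; the number of padding zeros may be chosen. The policy $\mathsf{Alg}_\theta(\mathbf a_{t,k}\mid D_{t-1},s_t)$ is the $k$-th entry of the softmax of the third block (of length $A$) of the last output token. **Assumption on the truncated log-probabilities.** For $\mathbf x_j\in\mathbb R^d$, $y_j\in\mathbb R$ ($j\in[A]$) and $\eta_1>0$ let $$g_{k,\eta_1}(\mathbf x_1,\dots,\mathbf x_A,y_1,\dots,y_A)=\log\big[\mathbb P_{\mathbf z\sim\mathcal N(0,I_d)}\big(\langle\mathbf x_k-\mathbf x_j,\mathbf z\rangle+y_k-y_j\ge0\ \forall j\in[A]\big)\vee\eta_1\big].$$ Let $0<\delta_0<1/2$, $0<\varepsilon<\min(\eta,1)/4$, $R_{\delta_0}=2B_a\sqrt\lambda\,(1+2\sqrt{\log(2/\delta_0)}+\sqrt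 d)$, $\eta_1=\varepsilon/(4A)$, and let $\gamma=\eta\sqrt{r/(r/\lambda+TB_a^2)}$, a lower bound for $\|\sqrt r\,\Sigma_t^{-1/2}(\mathbf a_{t,j}-\mathbf a_{t,k})\|_2$, $j\neq k$. Suppose that $\mathsf M_0\in\mathbb N$ and $\mathsf C_0$ are positive and that for each $k\in[A]$ there is a sum of ReLUs $f_k(\mathbf v)=\sum_{m=1}^{\mathsf M_0}c_m\sigma(\langle\mathbf w_m,[\mathbf v;1]\rangle)$ with $\sum_m|c_m|\le\mathsf C_0$ and $\max_m\|\mathbf w_m\|_1\le1$ such that $|g_{k,\eta_1}-f_k|\le\varepsilon/4$ at all points of $[-R_{\delta_0},R_{\delta_0}]^{Ad+A}$ with $\|\mathbf x_i-\mathbf x_j\|_2\ge\gamma$ for all $i\ne j$. **Conclusion.** There are a transformer $\mathrm{TF}^{\mathsf R}_\theta$ and a radius $\mathsf R>0$ with $\log\mathsf R=\tilde{\mathcal O}(1)$, $$D=\tilde{\mathcal O}(AT^{1/4}d),\quad L=\tilde{\mathcal O}(\sqrt T),\quad M=\tilde{\mathcal O}(AT^{1/4}),\quad D'=\tilde{\mathcal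 O}\big(A(T^{1/4}d+\mathsf M_0)\big),\quad |||\theta|||=\tilde{\mathcal O}\big(T+AT^{1/4}+\sqrt{\mathsf M_0A}+\mathsf C_0\big),$$ such that for every prior of the action sets as above and every algorithm $\mathsf{Alg}$, with probability at least $1-\delta_0$ over the instance and the trajectory generated by $\mathsf{Alg}$, $$\log\mathsf{Alg}_{\rm TS}(\mathbf a_{t,k}\mid D_{t-1},s_t)-\log\mathsf{Alg}_\theta(\mathbf a_{t,k}\mid D_{t-1},s_t)\le\varepsilon\qquad\text{for all }t\in[T],\ k\in[A]$$ (where $\log 0=-\infty$). Here $\tilde{\mathcal O}(\cdot)$ hides a universal constant, polynomial factors in $\lambda^{\pm1},r^{\pm1},b_a^{-1},B_a$, and polylogarithmic factors in $\mathsf M_0,\mathsf C_0,T,A,d,1/\delta_0,1/\varepsilon$; if $\lambda=\lambda_0/d$, then $\lambda^{\pm1}$ may be replaced by $\lambda_0^{\pm1}$ in it. -/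

import Mathlib

open MeasureTheory ProbabilityTheory
open scoped Matrix.Norms.L2Operator

namespace TSTransformer

noncomputable section

/-! ### ReLU decoder transformers

A sequence of `N` tokens indexed by a finite coordinate type `ι` (so the token dimension is
`Fintype.card ι`) is a function `H : Fin N → ι → ℝ`. Matrix norms `‖·‖` are `ℓ²` operator norms. -/

/-- The ReLU activation. -/
def relu (x : ℝ) : ℝ := max x 0

/-- Parameters of a masked attention layer with `M` heads. -/
structure AttnParams (ι : Type) (M : ℕ) where
  V : Fin M → Matrix ι ι ℝ
  Q : Fin M → Matrix ι ι ℝ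
  K : Fin M → Matrix ι ι ℝ

/-- Parameters of a two-layer MLP with hidden dimension `D'`. -/
structure MLPParams (ι : Type) (D' : ℕ) where
  W₁ : Matrix (Fin D') ι ℝ
  W₂ : Matrix ι (Fin D') ℝ

/-- Parameters of an `L`-layer decoder transformer. -/
structure TFParams (ι : Type) (L M D' : ℕ) where
  attn : Fin L → AttnParams ι M
  mlp : Fin L → MLPParams ι D'

variable {ι : Type} [Fintype ι]

/-- Masked ReLU attention; token `i : Fin N` is the `(i+1)`-st token of the sequence. -/
def AttnParams.apply {M N : ℕ} (θ : AttnParams ι M) (H : Fin N → ι → ℝ) : Fin N → ι → ℝ :=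
  fun i => H i + ∑ m : Fin M, (1 / ((i : ℝ) + 1)) •
    ∑ j ∈ Finset.Iic i, relu ((θ.Q m).mulVec (H i) ⬝ᵥ (θ.K m).mulVec (H j)) • (θ.V m).mulVec (H j)

/-- The tokenwise residual MLP layer. -/
def MLPParams.apply {D' N : ℕ} (θ : MLPParams ι D') (H : Fin N → ι → ℝ) : Fin N → ι → ℝ :=
  fun i => H i + θ.W₂.mulVec (fun l => relu (θ.W₁.mulVec (H i) l))

/-- Projection of a vector onto the Euclidean ball of radius `R`. -/
def projBall (R : ℝ) (h : ι → ℝ) : ι → ℝ :=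
  if ‖WithLp.toLp 2 h‖ ≤ R then h else (R / ‖WithLp.toLp 2 h‖) • h

/-- Tokenwise clipping. -/
def clip {N : ℕ} (R : ℝ) (H : Fin N → ι → ℝ) : Fin N → ι → ℝ := fun i => projBall R (H i)

/-- The tokens after the first `l` layers. -/
def TFParams.hidden {L M D' N : ℕ} (θ : TFParams ι L M D') (R : ℝ) (H : Fin N → ι → ℝ) :
    ℕ → Fin N → ι → ℝ
  | 0 => clip R H
  | l + 1 =>
    if h : l < L then
      clip R ((θ.mlp ⟨l, h⟩).apply ((θ.attn ⟨l, h⟩).apply (TFParams.hidden θ R H l)))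
    else TFParams.hidden θ R H l

/-- The transformer with clipping radius `R`. -/
def TFParams.apply {L M D' N : ℕ} (θ : TFParams ι L M D') (R : ℝ) (H : Fin N → ι → ℝ) :
    Fin N → ι → ℝ := θ.hidden R H L

/-- The norm of the transformer parameters: the maximum over layers of
`max_m max(‖Q_m‖, ‖K_m‖) + ∑_m ‖V_m‖ + ‖W₁‖ + ‖W₂‖`. -/
def TFParams.nrm [DecidableEq ι] {L M D' : ℕ} (θ : TFParams ι L M D') : ℝ :=
  ⨆ l : Fin L, ((⨆ m : Fin M, max ‖(θ.attn l).Q m‖ ‖(θ.attn l).K m‖)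
    + ∑ m : Fin M, ‖(θ.attn l).V m‖ + ‖(θ.mlp l).W₁‖ + ‖(θ.mlp l).W₂‖)

/-- The softmax of a vector. -/
def softmax {κ : Type} [Fintype κ] (v : κ → ℝ) (k : κ) : ℝ :=
  Real.exp (v k) / ∑ j, Real.exp (v j)

/-! ### Linear bandits: observations, embedding, induced policy -/

/-- `ℝ^d` with the Euclidean norm. -/
abbrev Vec (d : ℕ) : Type := EuclideanSpace ℝ (Fin d)

/-- An action set with `A` actions. -/
abbrev ActionSet (d A : ℕ) : Type := Fin A → Vec d

/-- What is observed when the `(n+1)`-st action has to be selected: the action sets of the rounds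
`1, …, n+1`, and the (index of the) selected action and the reward of the rounds `1, …, n`. -/
abbrev Obs (d A n : ℕ) : Type := (Fin (n + 1) → ActionSet d A) × (Fin n → Fin A × ℝ)

variable {d A n : ℕ}

/-- The current action set. -/
def Obs.current (o : Obs d A n) : ActionSet d A := o.1 (Fin.last n)

/-- The action vector selected in a past round. -/
def Obs.action (o : Obs d A n) (j : Fin n) : Vec d := o.1 j.castSucc (o.2 j).1

/-- The reward of a past round. -/
def Obs.reward (o : Obs d A n) (j : Fin n) : ℝ := (o.2 j).2

/-- Coordinates of a token: block `a` (an action and a reward), block `b` (an action set),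
block `c` (the policy), block `d` (`p` free coordinates and the positional encoding). -/
abbrev Coord (d A p : ℕ) : Type :=
  (Fin d ⊕ Unit) ⊕ (Fin A × Fin d) ⊕ Fin A ⊕ Fin p ⊕ Fin 3

/-- The positional encoding `(i, i², 1)`. -/
def pos (i : ℕ) : Fin 3 → ℝ := ![(i : ℝ), (i : ℝ) ^ 2, 1]

/-- The token of an action set, at position `i`. -/
def stateToken (p : ℕ) (s : ActionSet d A) (i : ℕ) : Coord d A p → ℝ :=
  Sum.elim (fun _ => 0) <| Sum.elim (fun q => s q.1 q.2) <| Sum.elim (fun _ => 0) <|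
    Sum.elim (fun _ => 0) (pos i)

/-- The token of an action and its reward, at position `i`. -/
def actionToken (A p : ℕ) (a : Vec d) (y : ℝ) (i : ℕ) : Coord d A p → ℝ :=
  Sum.elim (Sum.elim (fun l => a l) (fun _ => y)) <| Sum.elim (fun _ => 0) <|
    Sum.elim (fun _ => 0) <| Sum.elim (fun _ => 0) (pos i)

/-- The input `[h(s₁), h(a₁,r₁), …, h(aₙ,rₙ), h(sₙ₊₁)]` of `2n+1` tokens; positions start at `1`. -/
def Obs.tokens (p : ℕ) (o : Obs d A n) : Fin (2 * n + 1) → Coord d A p → ℝ := fun i =>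
  if h : i.1 % 2 = 0 then stateToken p (o.1 ⟨i.1 / 2, by omega⟩) (i.1 + 1)
  else actionToken A p (o.action ⟨i.1 / 2, by omega⟩) (o.reward ⟨i.1 / 2, by omega⟩) (i.1 + 1)

/-- The policy induced by a transformer: softmax of block `c` of the last output token. -/
def tfPolicy {p L M D' : ℕ} (θ : TFParams (Coord d A p) L M D') (R : ℝ) (o : Obs d A n)
    (k : Fin A) : ℝ :=
  softmax (fun j : Fin A =>
    θ.apply R (o.tokens p) (Fin.last (2 * n)) (Sum.inr (Sum.inr (Sum.inl j)))) k

/-! ### Thompson sampling -/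

/-- `Σ = (r/λ) I + ∑_j a_j a_jᵀ`. -/
def tsSigma (lam r : ℝ) (o : Obs d A n) : Matrix (Fin d) (Fin d) ℝ :=
  (r / lam) • (1 : Matrix (Fin d) (Fin d) ℝ) +
    ∑ j : Fin n, Matrix.vecMulVec (fun l => o.action j l) (fun l => o.action j l)

/-- `μ = Σ⁻¹ ∑_j r_j a_j`. -/
def tsMean (lam r : ℝ) (o : Obs d A n) : Vec d :=
  WithLp.toLp 2 ((tsSigma lam r o)⁻¹.mulVec (∑ j : Fin n, o.reward j • fun l => o.action j l))

/-- Thompson sampling: the probability that action `k` maximizes `⟨a, w⟩` over the current action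
set when `w ∼ N(μ, r Σ⁻¹)`. -/
def tsPolicy (lam r : ℝ) (o : Obs d A n) (k : Fin A) : ℝ :=
  (multivariateGaussian (tsMean lam r o) (r • (tsSigma lam r o)⁻¹)).real
    {w | ∀ j : Fin A, inner ℝ (o.current j) w ≤ inner ℝ (o.current k) w}

/-! ### The interaction of an algorithm with a random bandit instance -/

/-- A (measurable, randomized) bandit algorithm for `T` rounds. -/
structure Algorithm (d A T : ℕ) where
  prob : (t : Fin T) → Obs d A t → Fin A → ℝ
  nonneg : ∀ t o k, 0 ≤ prob t o k
  sum_eq_one : ∀ t o, ∑ k, prob t o k = 1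
  measurable : ∀ t k, Measurable fun o => prob t o k

/-- The random environment: the action sets, the parameter `w*`, and the noises. -/
abbrev Env (d A T : ℕ) : Type := (Fin T → ActionSet d A) × Vec d × (Fin T → ℝ)

variable {T : ℕ}

/-- What is observed at round `t` in the environment `e` when the actions with indices `k` are
selected: the reward of round `j` is `⟨a_j, w*⟩ + ε_j`. -/
def obsAt (e : Env d A T) (k : Fin T → Fin A) (t : Fin T) : Obs d A t :=
  (fun s => e.1 ⟨s.1, by omega⟩,
   fun j => (k ⟨j.1, by omega⟩,
     inner ℝ (e.1 ⟨j.1, by omega⟩ (k ⟨j.1, by omega⟩)) e.2.1 + e.2.2 ⟨j.1, by omega⟩))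

/-- The law of the environment: action sets from `ν`, and independently `w* ∼ N(0, λ I)` and
i.i.d. noises `ε_t ∼ N(0, r)`. -/
def envLaw (ν : Measure (Fin T → ActionSet d A)) (lam r : ℝ) : Measure (Env d A T) :=
  ν.prod ((multivariateGaussian (0 : Vec d) (lam • 1)).prod
    (Measure.pi fun _ : Fin T => gaussianReal 0 r.toNNReal))

/-- The joint law of the environment and the selected actions: given the environment, the action
sequence `k` has probability `∏_t alg(k_t | D_{t-1}, s_t)`. -/
def trajLaw (ν : Measure (Fin T → ActionSet d A)) (lam r : ℝ) (alg : Algorithm d A T) :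
    Measure (Env d A T × (Fin T → Fin A)) :=
  ∑ k : Fin T → Fin A,
    ((envLaw ν lam r).withDensity
      (fun e => ENNReal.ofReal (∏ t : Fin T, alg.prob t (obsAt e k t) (k t)))).map
      (fun e => (e, k))

/-- All actions have norm in `[ba, Ba]`, and distinct actions of the same round have distance at
least `η`. -/
def AdmissibleActions (ba Ba η : ℝ) (α : Fin T → ActionSet d A) : Prop :=
  ∀ t, (∀ k, ba ≤ ‖α t k‖ ∧ ‖α t k‖ ≤ Ba) ∧ ∀ j k, j ≠ k → η ≤ ‖α t j - α t k‖

/-! ### Approximability by sums of ReLUs -/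

/-- On `S ∩ [-R, R]^κ`, the function `g` is within `ε` of a sum of `M₀` ReLUs
`∑_m c_m σ(⟨w_m, z⟩ + b_m)` with `∑_m |c_m| ≤ C₀` and `‖(w_m, b_m)‖₁ ≤ 1`. -/
def ReluApproximable {κ : Type} [Fintype κ] (g : (κ → ℝ) → ℝ) (S : Set (κ → ℝ))
    (ε R : ℝ) (M₀ : ℕ) (C₀ : ℝ) : Prop :=
  ∃ (c : Fin M₀ → ℝ) (w : Fin M₀ → κ → ℝ) (b : Fin M₀ → ℝ),
    ∑ m, |c m| ≤ C₀ ∧ (∀ m, ∑ i, |w m i| + |b m| ≤ 1) ∧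
    ∀ z ∈ S, (∀ i, z i ∈ Set.Icc (-R) R) →
      |g z - ∑ m, c m * relu (∑ i, w m i * z i + b m)| ≤ ε

/-- Coordinates of `(x₁, …, x_A, y₁, …, y_A)` with `x_j ∈ ℝ^d` and `y_j ∈ ℝ`. -/
abbrev Feat (d A : ℕ) : Type := (Fin A × Fin d) ⊕ Fin A

/-- The component `x_j`. -/
def featX (z : Feat d A → ℝ) (j : Fin A) : Vec d := WithLp.toLp 2 fun l => z (Sum.inl (j, l))

/-- The component `y_j`. -/
def featY (z : Feat d A → ℝ) (j : Fin A) : ℝ := z (Sum.inr j)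

/-- The truncated log-probability
`log (P_{u ∼ N(0, I)}(⟨x_k - x_j, u⟩ + y_k - y_j ≥ 0 for all j) ∨ η₁)`. -/
def truncLogProb (η₁ : ℝ) (k : Fin A) (z : Feat d A → ℝ) : ℝ :=
  Real.log (max ((stdGaussian (Vec d)).real
    {u | ∀ j, 0 ≤ inner ℝ (featX z k - featX z j) u + featY z k - featY z j}) η₁)

/-- The region where `‖x_i - x_j‖ ≥ γ` for all `i ≠ j`. -/
def separated (d A : ℕ) (γ : ℝ) : Set (Feat d A → ℝ) :=
  {z | ∀ i j, i ≠ j → γ ≤ ‖featX z i - featX z j‖}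

/-- `R_δ = 2 B_a √λ (1 + 2 √(log (2/δ)) + √d)`. -/
def featRadius (d : ℕ) (Ba lam δ : ℝ) : ℝ :=
  2 * Ba * √lam * (1 + 2 * √(Real.log (2 / δ)) + √(d : ℝ))

/-- The factor hidden in `Õ(·)`: `C` times a power of `1 + λ₀ + 1/λ₀ + r + 1/r + 1/b_a + B_a` times
a power of the logarithm of `M₀ + C₀ + T + A + d + 1/δ₀ + 1/ε`. -/
def hiddenFactor (C : ℝ) (q : ℕ) (lam₀ r ba Ba : ℝ) (M₀ : ℕ) (C₀ : ℝ) (T A d : ℕ) (δ₀ ε : ℝ) : ℝ :=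
  C * (1 + lam₀ + 1 / lam₀ + r + 1 / r + 1 / ba + Ba) ^ q *
    Real.log (M₀ + C₀ + T + A + d + 1 / δ₀ + 1 / ε) ^ q

end

end TSTransformer

/-!
# Approximating Thompson sampling for linear bandits by transformers

The logarithm of the Thompson sampling probability of the `k`-th action is the function
`g_k = log ℙ(⟨x_k - x_j, z⟩ + y_k - y_j ≥ 0 ∀ j)` of the features `x_k = √r Σ^(-1/2) a_k` and
`y_k = ⟨μ, a_k⟩ = ⟨Σ⁻¹ a_k, ∑ r_j a_j⟩` (`tsPolicy_eq`). The transformer computes the features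
approximately and applies the given sums of ReLUs to them in its last MLP layer; these are Lipschitz
with constant `C₀`, so that it suffices to know the features up to an error of order `ε / C₀`.

**Features.** Both `Σ⁻¹` and `Σ^(-1/2)` are approximated by Chebyshev expansions in `Σ`. If
`Σ / Mx = 1 - 2 s cos θ + s² = |1 - s e^{iθ}|²`, then `Mx Σ⁻¹` and `(Σ / Mx)^(-1/2)` are the squared
moduli of the power series of `(1 - w)⁻¹` and `(1 - w)^(-1/2)` at `w = s e^{iθ}`. The squared
modulus of a truncated series is a combination of the `cos (m θ)`, that is, a Chebyshev expansion,
and it converges at the geometric rate `s` (`abs_sum_chebCoeff_sub_le`, `norm_inv_approx`,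
`norm_sqrt_approx`). Here `1 - s` is of order `κ^(-1/2)`, where `κ = O(T)` bounds the condition
number of `Σ`, so that `O(√T log (1/e))` terms give the accuracy `e`.

**Layers.** The vectors `T_m(Z) a_k`, with `Z` affine in `Σ`, obey a three-term recursion, and one
step of it needs one application of `Σ` to the current vector. Attention computes
`(1 / i) ∑_{j ≤ i} a_j a_jᵀ`; the factor `1 / i` is undone by a preceding attention layer that
multiplies by the position `i`, with ReLU weights that vanish except on the token itself
(`relu_position`). A linear weight is a difference of two ReLUs, hence `2 A` heads. MLP layers form
the linear combinations and `params_apply` evaluates the whole forward pass, for inputs for which the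
clipping is inactive. Only `O(A d)` coordinates and `O(A)` heads are used.

**Softmax.** As the features `x_k` are separated, ties have probability zero and the Thompson
sampling probabilities sum to at most one (`sum_optEvent_le_one`). Truncation at `ε / (4 A)` thus
increases their sum to at most `1 + ε / 4`, and the softmax of approximate truncated logarithms loses
at most `ε` against the true logarithms (`log_sub_log_softmax_le`).

**Typical observations.** It remains to bound the features and the rewards with probability
`1 - δ₀`, uniformly over the algorithms (`trajLaw_bad_le`). For the posterior means the argument is a
reflection principle: replacing the parameter `w` by `2 μ_t - w` while keeping the rewards observed
so far preserves the law of the environment (`measurePreserving_reflect`) and the probabilities of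
the actions selected so far. If `‖μ_t‖ > ρ`, then `w` or `2 μ_t - w` has norm above `ρ`. So, given
that `t` is the first round with `‖μ_t‖ > ρ`, the parameter has norm above `ρ` with probability at
least one half (`trajLaw_firstExit_le`), and the probability that some posterior mean leaves the
ball is at most twice the Gaussian tail of the parameter (`envLaw_norm_ge_le`).

The sizes are collected in `exists_parameters` and `nrm_params_le`. If `ba > Ba`, no action set is
admissible, and any transformer will do.
-/

namespace TSTransformer

noncomputable section

/-! ### Chebyshev expansions of `x⁻¹` and `x^(-1/2)` -/

/-- The coefficient of the `m`-th Chebyshev polynomial in `|∑_{j ≤ N} β_j w^j|²`, where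
`w = s e^{iθ}`, as a function of `cos θ`. -/
def chebCoeff (β : ℕ → ℝ) (s : ℝ) (N m : ℕ) : ℝ :=
  ∑ j ∈ Finset.range (N + 1), ∑ k ∈ Finset.range (N + 1),
    if ((j : ℤ) - k).natAbs = m then β j * β k * s ^ (j + k) else 0

theorem abs_chebCoeff_le {β : ℕ → ℝ} (hβ0 : ∀ j, 0 ≤ β j) (hβ1 : ∀ j, β j ≤ 1) {s : ℝ}
    (hs0 : 0 ≤ s) (hs1 : s ≤ 1) (N m : ℕ) : |chebCoeff β s N m| ≤ ((N : ℝ) + 1) ^ 2 := by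
  have hterm : ∀ j k : ℕ,
      |if ((j : ℤ) - k).natAbs = m then β j * β k * s ^ (j + k) else 0| ≤ 1 := by
    intro j k
    split_ifs
    · rw [abs_of_nonneg (by have := hβ0 j; have := hβ0 k; positivity)]
      exact mul_le_one₀ (mul_le_one₀ (hβ1 j) (hβ0 k) (hβ1 k)) (by positivity)
        (pow_le_one₀ hs0 hs1)
    · simp
  refine (Finset.abs_sum_le_sum_abs _ _).trans ?_
  have : ∀ j ∈ Finset.range (N + 1), |∑ k ∈ Finset.range (N + 1),
      if ((j : ℤ) - k).natAbs = m then β j * β k * s ^ (j + k) else 0| ≤ (N : ℝ) + 1 := by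
    intro j _
    refine (Finset.abs_sum_le_sum_abs _ _).trans ((Finset.sum_le_sum fun k _ => hterm j k).trans ?_)
    simp
  refine (Finset.sum_le_sum this).trans ?_
  simp [sq, mul_add]

theorem cos_natAbs_mul (x : ℤ) (θ : ℝ) : Real.cos ((x.natAbs : ℝ) * θ) = Real.cos (x * θ) := by
  rw [Nat.cast_natAbs, Int.cast_abs]
  rcases abs_choice (x : ℝ) with h | h <;> rw [h]
  rw [neg_mul, Real.cos_neg]

/-- The squared modulus of a polynomial with real coefficients at `s e^{iθ}` is a combination of the
`cos (m θ)`. -/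
theorem sum_chebCoeff_mul_cos (β : ℕ → ℝ) (s θ : ℝ) (N : ℕ) :
    ∑ m ∈ Finset.range (N + 1), chebCoeff β s N m * Real.cos (m * θ) =
      ‖∑ j ∈ Finset.range (N + 1), (β j : ℂ) * ((s : ℂ) * Complex.exp (θ * Complex.I)) ^ j‖ ^ 2 := by
  have hpow : ∀ j : ℕ, (β j : ℂ) * ((s : ℂ) * Complex.exp (θ * Complex.I)) ^ j =
      ((β j * s ^ j * Real.cos (j * θ) : ℝ) : ℂ) +
        ((β j * s ^ j * Real.sin (j * θ) : ℝ) : ℂ) * Complex.I := by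
    intro j
    rw [mul_pow, ← Complex.exp_nat_mul]
    have : (j : ℂ) * (θ * Complex.I) = ((j * θ : ℝ) : ℂ) * Complex.I := by push_cast; ring
    rw [this, Complex.exp_mul_I]
    push_cast
    ring
  rw [Finset.sum_congr rfl fun j _ => hpow j, Finset.sum_add_distrib, ← Finset.sum_mul,
    ← Complex.ofReal_sum, ← Complex.ofReal_sum, ← Complex.normSq_eq_norm_sq,
    Complex.normSq_add_mul_I]
  simp only [chebCoeff, Finset.sum_mul]
  rw [Finset.sum_comm, sq, sq, Finset.sum_mul_sum, Finset.sum_mul_sum, ← Finset.sum_add_distrib]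
  refine Finset.sum_congr rfl fun j hj => ?_
  rw [Finset.sum_comm, ← Finset.sum_add_distrib]
  refine Finset.sum_congr rfl fun k hk => ?_
  rw [Finset.mem_range] at hj hk
  simp only [ite_mul, zero_mul]
  rw [Finset.sum_ite_eq, if_pos (by rw [Finset.mem_range]; omega), cos_natAbs_mul]
  push_cast
  rw [sub_mul, Real.cos_sub, pow_add]
  ring

/-- Truncating the power series `∑ β_j w^j` with coefficients in `[0, 1]` after degree `N` changes
the square of its modulus at `|w| = s` by an amount that is geometrically small in `N`. -/
theorem abs_sum_chebCoeff_sub_le {β : ℕ → ℝ} (hβ0 : ∀ j, 0 ≤ β j) (hβ1 : ∀ j, β j ≤ 1) {s : ℝ}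
    (hs0 : 0 ≤ s) (hs1 : s < 1) (θ : ℝ) (N : ℕ) :
    |∑ m ∈ Finset.range (N + 1), chebCoeff β s N m * Real.cos (m * θ) -
      ‖∑' j, (β j : ℂ) * ((s : ℂ) * Complex.exp (θ * Complex.I)) ^ j‖ ^ 2| ≤
      2 * s ^ (N + 1) / (1 - s) ^ 2 := by
  rw [sum_chebCoeff_mul_cos]
  set w : ℂ := (s : ℂ) * Complex.exp (θ * Complex.I) with hw
  have hwn : ‖w‖ = s := by
    rw [hw, norm_mul, Complex.norm_exp_ofReal_mul_I, mul_one, Complex.norm_real,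
      Real.norm_of_nonneg hs0]
  have hterm : ∀ j, ‖(β j : ℂ) * w ^ j‖ ≤ s ^ j := by
    intro j
    rw [norm_mul, norm_pow, hwn, Complex.norm_real, Real.norm_of_nonneg (hβ0 j)]
    exact mul_le_of_le_one_left (pow_nonneg hs0 _) (hβ1 j)
  have hgeo : Summable fun j : ℕ => s ^ j := summable_geometric_of_lt_one hs0 hs1
  have hsum : Summable fun j => (β j : ℂ) * w ^ j := Summable.of_norm_bounded hgeo hterm
  set F := ∑' j, (β j : ℂ) * w ^ j
  set P := ∑ j ∈ Finset.range (N + 1), (β j : ℂ) * w ^ j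
  have h1s : 0 < 1 - s := by linarith
  have htail : ‖F - P‖ ≤ s ^ (N + 1) / (1 - s) := by
    have h1 : F - P = ∑' j, (β (j + (N + 1)) : ℂ) * w ^ (j + (N + 1)) := by
      rw [sub_eq_iff_eq_add', hsum.sum_add_tsum_nat_add]
    rw [h1, div_eq_mul_inv]
    refine tsum_of_norm_bounded ((hasSum_geometric_of_lt_one hs0 hs1).mul_left _) fun j => ?_
    refine (hterm _).trans (le_of_eq ?_)
    ring
  have hF : ‖F‖ ≤ 1 / (1 - s) := by
    rw [one_div]
    exact tsum_of_norm_bounded (hasSum_geometric_of_lt_one hs0 hs1) hterm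
  have hP : ‖P‖ ≤ 1 / (1 - s) := by
    rw [one_div, ← tsum_geometric_of_lt_one hs0 hs1]
    exact (norm_sum_le _ _).trans ((Finset.sum_le_sum fun j _ => hterm j).trans
      (hgeo.sum_le_tsum _ fun j _ => pow_nonneg hs0 _))
  have h2 : |‖P‖ ^ 2 - ‖F‖ ^ 2| = |‖P‖ - ‖F‖| * (‖P‖ + ‖F‖) := by
    rw [sq_sub_sq, abs_mul, abs_of_nonneg (by positivity : 0 ≤ ‖P‖ + ‖F‖), mul_comm]
  rw [h2]
  have h3 : |‖P‖ - ‖F‖| ≤ s ^ (N + 1) / (1 - s) := by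
    rw [abs_sub_comm]; exact (abs_norm_sub_norm_le F P).trans htail
  calc |‖P‖ - ‖F‖| * (‖P‖ + ‖F‖)
      ≤ (s ^ (N + 1) / (1 - s)) * (1 / (1 - s) + 1 / (1 - s)) := by gcongr
    _ = 2 * s ^ (N + 1) / (1 - s) ^ 2 := by field_simp; ring

/-- The Taylor coefficients of `(1 - w)^(-1/2)`. -/
def invSqrtCoeff (j : ℕ) : ℝ := (j.centralBinom : ℝ) / 4 ^ j

theorem invSqrtCoeff_nonneg (j : ℕ) : 0 ≤ invSqrtCoeff j := by unfold invSqrtCoeff; positivity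

theorem invSqrtCoeff_le_one (j : ℕ) : invSqrtCoeff j ≤ 1 := by
  unfold invSqrtCoeff
  rw [div_le_one (by positivity)]
  exact_mod_cast j.centralBinom_le_four_pow

theorem succ_mul_invSqrtCoeff_succ (n : ℕ) :
    ((n : ℝ) + 1) * invSqrtCoeff (n + 1) = (n + 1 / 2) * invSqrtCoeff n := by
  have h := n.succ_mul_centralBinom_succ
  have h' : ((n : ℝ) + 1) * ((n + 1).centralBinom : ℝ) =
      2 * (2 * n + 1) * (n.centralBinom : ℝ) := by exact_mod_cast h
  unfold invSqrtCoeff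
  rw [← mul_div_assoc, h', pow_succ]
  field_simp
  ring

/-- The square of the power series of `(1 - w)^(-1/2)` is the geometric series: by the recursion
of its coefficients, `b' (1 - w) = b / 2`, so that `(b²)' (1 - w) = b²`. -/
theorem sum_antidiagonal_invSqrtCoeff (n : ℕ) :
    ∑ q ∈ Finset.HasAntidiagonal.antidiagonal n, invSqrtCoeff q.1 * invSqrtCoeff q.2 = 1 := by
  let b : PowerSeries ℝ := PowerSeries.mk invSqrtCoeff
  have hb : PowerSeries.derivative ℝ b * (1 - PowerSeries.X) = PowerSeries.C (1 / 2 : ℝ) * b := by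
    ext n
    rw [mul_sub, mul_one, map_sub, PowerSeries.coeff_C_mul, PowerSeries.coeff_derivative]
    cases n with
    | zero =>
      have := succ_mul_invSqrtCoeff_succ 0
      simp [b] at this ⊢
      linarith
    | succ n =>
      have := succ_mul_invSqrtCoeff_succ (n + 1)
      simp [b, PowerSeries.coeff_derivative, PowerSeries.coeff_succ_mul_X] at this ⊢
      linarith
  have hb2 : PowerSeries.derivative ℝ (b * b) * (1 - PowerSeries.X) = b * b := by
    rw [Derivation.leibniz, smul_eq_mul]
    have : (b * PowerSeries.derivative ℝ b + b * PowerSeries.derivative ℝ b) *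
        (1 - PowerSeries.X) = 2 * b * (PowerSeries.derivative ℝ b * (1 - PowerSeries.X)) := by ring
    rw [this, hb]
    have h2 : (2 : PowerSeries ℝ) * PowerSeries.C (1 / 2 : ℝ) = 1 := by
      rw [show (2 : PowerSeries ℝ) = PowerSeries.C (2 : ℝ) from (map_ofNat _ 2).symm, ← map_mul]
      norm_num
    linear_combination b * b * h2
  have hc : ∀ n, PowerSeries.coeff (R := ℝ) n (b * b) =
      ∑ q ∈ Finset.HasAntidiagonal.antidiagonal n, invSqrtCoeff q.1 * invSqrtCoeff q.2 := by
    intro n; simp [PowerSeries.coeff_mul, b]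
  rw [← hc]
  induction n with
  | zero => simp [hc, invSqrtCoeff]
  | succ n ih =>
    have h := congrArg (PowerSeries.coeff (R := ℝ) n) hb2
    rw [mul_sub, mul_one, map_sub, PowerSeries.coeff_derivative] at h
    cases n with
    | zero =>
      simp only [PowerSeries.coeff_zero_mul_X] at h
      rw [ih] at h
      simpa using h
    | succ n =>
      simp only [PowerSeries.coeff_derivative, PowerSeries.coeff_succ_mul_X] at h
      rw [ih] at h
      push_cast at h ⊢
      have h3 : ((n : ℝ) + 1 + 1) ≠ 0 := by positivity
      refine mul_right_cancel₀ h3 ?_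
      linarith

theorem norm_one_sub_sq (s θ : ℝ) :
    ‖1 - (s : ℂ) * Complex.exp (θ * Complex.I)‖ ^ 2 = 1 - 2 * s * Real.cos θ + s ^ 2 := by
  rw [Complex.exp_mul_I, ← Complex.ofReal_cos, ← Complex.ofReal_sin]
  have : 1 - (s : ℂ) * ((Real.cos θ : ℂ) + (Real.sin θ : ℂ) * Complex.I) =
      ((1 - s * Real.cos θ : ℝ) : ℂ) + ((- (s * Real.sin θ) : ℝ) : ℂ) * Complex.I := by
    push_cast; ring
  rw [this, ← Complex.normSq_eq_norm_sq, Complex.normSq_add_mul_I]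
  nlinarith [Real.sin_sq_add_cos_sq θ]

theorem norm_mul_exp_lt_one {s : ℝ} (hs0 : 0 ≤ s) (hs1 : s < 1) (θ : ℝ) :
    ‖(s : ℂ) * Complex.exp (θ * Complex.I)‖ < 1 := by
  rw [norm_mul, Complex.norm_exp_ofReal_mul_I, mul_one, Complex.norm_real, Real.norm_of_nonneg hs0]
  exact hs1

theorem norm_geom_tsum_sq {s : ℝ} (hs0 : 0 ≤ s) (hs1 : s < 1) (θ : ℝ) :
    ‖∑' j : ℕ, ((1 : ℝ) : ℂ) * ((s : ℂ) * Complex.exp (θ * Complex.I)) ^ j‖ ^ 2 =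
      (1 - 2 * s * Real.cos θ + s ^ 2)⁻¹ := by
  simp only [Complex.ofReal_one, one_mul]
  rw [tsum_geometric_of_norm_lt_one (norm_mul_exp_lt_one hs0 hs1 θ), norm_inv, inv_pow,
    norm_one_sub_sq]

/-- `|(1 - w)^(-1/2)|² = |1 - w|⁻¹` for `w = s e^{iθ}`, without reference to a branch of the root: the
power series squares to the geometric series. -/
theorem norm_invSqrt_tsum_sq {s : ℝ} (hs0 : 0 ≤ s) (hs1 : s < 1) (θ : ℝ) :
    ‖∑' j : ℕ, (invSqrtCoeff j : ℂ) * ((s : ℂ) * Complex.exp (θ * Complex.I)) ^ j‖ ^ 2 =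
      (√(1 - 2 * s * Real.cos θ + s ^ 2))⁻¹ := by
  set w : ℂ := (s : ℂ) * Complex.exp (θ * Complex.I) with hw
  have hwn : ‖w‖ < 1 := norm_mul_exp_lt_one hs0 hs1 θ
  have hsumm : Summable fun j => ‖(invSqrtCoeff j : ℂ) * w ^ j‖ := by
    refine Summable.of_nonneg_of_le (fun j => norm_nonneg _) (fun j => ?_)
      (summable_geometric_of_lt_one (norm_nonneg w) hwn)
    rw [norm_mul, norm_pow, Complex.norm_real, Real.norm_of_nonneg (invSqrtCoeff_nonneg j)]
    exact mul_le_of_le_one_left (by positivity) (invSqrtCoeff_le_one j)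
  have hsq : (∑' j, (invSqrtCoeff j : ℂ) * w ^ j) * (∑' j, (invSqrtCoeff j : ℂ) * w ^ j) =
      (1 - w)⁻¹ := by
    rw [tsum_mul_tsum_eq_tsum_sum_antidiagonal_of_summable_norm hsumm hsumm,
      ← tsum_geometric_of_norm_lt_one hwn]
    refine tsum_congr fun n => ?_
    have h1 : ∀ q ∈ Finset.HasAntidiagonal.antidiagonal n, (invSqrtCoeff q.1 : ℂ) * w ^ q.1 *
        ((invSqrtCoeff q.2 : ℂ) * w ^ q.2) =
        ((invSqrtCoeff q.1 * invSqrtCoeff q.2 : ℝ) : ℂ) * w ^ n := by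
      intro q hq
      rw [Finset.HasAntidiagonal.mem_antidiagonal] at hq
      rw [← hq, pow_add]; push_cast; ring
    rw [Finset.sum_congr rfl h1, ← Finset.sum_mul, ← Complex.ofReal_sum,
      sum_antidiagonal_invSqrtCoeff]
    simp
  set F := ∑' j, (invSqrtCoeff j : ℂ) * w ^ j
  have h : (‖F‖ ^ 2) ^ 2 = (1 - 2 * s * Real.cos θ + s ^ 2)⁻¹ := by
    rw [← norm_one_sub_sq, ← inv_pow, ← norm_inv, ← hsq, norm_mul, sq ‖F‖]
  rw [← Real.sqrt_inv, ← h, Real.sqrt_sq (by positivity)]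

theorem abs_sum_chebCoeff_one_sub_le {s : ℝ} (hs0 : 0 ≤ s) (hs1 : s < 1) (θ : ℝ) (N : ℕ) :
    |∑ m ∈ Finset.range (N + 1), chebCoeff (fun _ => 1) s N m * Real.cos (m * θ) -
      (1 - 2 * s * Real.cos θ + s ^ 2)⁻¹| ≤ 2 * s ^ (N + 1) / (1 - s) ^ 2 := by
  rw [← norm_geom_tsum_sq hs0 hs1]
  exact abs_sum_chebCoeff_sub_le (β := fun _ => 1) (by simp) (by simp) hs0 hs1 θ N

theorem abs_sum_chebCoeff_invSqrt_sub_le {s : ℝ} (hs0 : 0 ≤ s) (hs1 : s < 1) (θ : ℝ) (N : ℕ) :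
    |∑ m ∈ Finset.range (N + 1), chebCoeff invSqrtCoeff s N m * Real.cos (m * θ) -
      (√(1 - 2 * s * Real.cos θ + s ^ 2))⁻¹| ≤ 2 * s ^ (N + 1) / (1 - s) ^ 2 := by
  rw [← norm_invSqrt_tsum_sq hs0 hs1]
  exact abs_sum_chebCoeff_sub_le invSqrtCoeff_nonneg invSqrtCoeff_le_one hs0 hs1 θ N

end

end TSTransformer

namespace TSTransformer

noncomputable section

/-! ### Functions of a symmetric matrix via its eigenbasis -/

section Spectral

variable {κ : Type} [Fintype κ]

theorem dotProduct_mulVec_of_eigen {S : Matrix κ κ ℝ} (hS : S.IsHermitian) {e : κ → ℝ} {σ : ℝ}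
    (he : S.mulVec e = σ • e) (v : κ → ℝ) : e ⬝ᵥ S.mulVec v = σ * (e ⬝ᵥ v) := by
  have hT : Matrix.transpose S = S := by simpa [Matrix.IsHermitian] using hS
  rw [Matrix.dotProduct_mulVec, ← Matrix.mulVec_transpose, hT, he, smul_dotProduct, smul_eq_mul]

theorem norm_toLp_sq (v : κ → ℝ) : ‖WithLp.toLp 2 v‖ ^ 2 = v ⬝ᵥ v := by
  rw [EuclideanSpace.real_norm_sq_eq]
  simp [dotProduct, sq]

theorem abs_dotProduct_le (u v : κ → ℝ) :
    |u ⬝ᵥ v| ≤ ‖WithLp.toLp 2 u‖ * ‖WithLp.toLp 2 v‖ := by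
  have := abs_real_inner_le_norm (WithLp.toLp 2 v) (WithLp.toLp 2 u)
  rw [EuclideanSpace.inner_toLp_toLp, star_trivial] at this
  linarith [mul_comm ‖WithLp.toLp 2 u‖ ‖WithLp.toLp 2 v‖]

theorem abs_apply_le_norm (v : κ → ℝ) (i : κ) : |v i| ≤ ‖WithLp.toLp 2 v‖ := by
  simpa using PiLp.norm_apply_le (WithLp.toLp 2 v) i

/-- The vectors `T_m(Z) b`, where `T_m` is the `m`-th Chebyshev polynomial. -/
def chebVec (Z : Matrix κ κ ℝ) (b : κ → ℝ) : ℕ → κ → ℝ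
  | 0 => b
  | 1 => Z.mulVec b
  | m + 2 => (2 : ℝ) • Z.mulVec (chebVec Z b (m + 1)) - chebVec Z b m

theorem dot_chebVec {Z : Matrix κ κ ℝ} {e : κ → ℝ} {θ : ℝ}
    (he : ∀ v, e ⬝ᵥ Z.mulVec v = Real.cos θ * (e ⬝ᵥ v)) (b : κ → ℝ) (m : ℕ) :
    e ⬝ᵥ chebVec Z b m = Real.cos (m * θ) * (e ⬝ᵥ b) := by
  induction m using Nat.twoStepInduction with
  | zero => simp [chebVec]
  | one => simp [chebVec, he]
  | more m ih1 ih2 =>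
    rw [chebVec, dotProduct_sub, dotProduct_smul, he, ih1, ih2]
    have h1 : Real.cos ((m + 2 : ℕ) * θ) =
        2 * Real.cos θ * Real.cos ((m + 1 : ℕ) * θ) - Real.cos (m * θ) := by
      have e1 : ((m + 2 : ℕ) : ℝ) * θ = ((m + 1 : ℕ) : ℝ) * θ + θ := by push_cast; ring
      have e2 : (m : ℝ) * θ = ((m + 1 : ℕ) : ℝ) * θ - θ := by push_cast; ring
      rw [e1, e2, Real.cos_add, Real.cos_sub]
      ring
    rw [h1, smul_eq_mul]
    ring

theorem dot_sum_chebVec {e : κ → ℝ} {Z : Matrix κ κ ℝ} {θ : ℝ}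
    (he : ∀ v, e ⬝ᵥ Z.mulVec v = Real.cos θ * (e ⬝ᵥ v)) (b : κ → ℝ) (N : ℕ) (cf : ℕ → ℝ) :
    e ⬝ᵥ ∑ j ∈ Finset.range (N + 1), cf j • chebVec Z b j =
      (∑ j ∈ Finset.range (N + 1), cf j * Real.cos (j * θ)) * (e ⬝ᵥ b) := by
  rw [dotProduct_sum, Finset.sum_mul]
  refine Finset.sum_congr rfl fun j _ => ?_
  rw [dotProduct_smul, dot_chebVec he, smul_eq_mul, mul_assoc]

variable [DecidableEq κ]

theorem sum_dotProduct_eigenvectorBasis_sq {S : Matrix κ κ ℝ} (hS : S.IsHermitian) (v : κ → ℝ) :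
    ∑ l, ((hS.eigenvectorBasis l : κ → ℝ) ⬝ᵥ v) ^ 2 = ‖WithLp.toLp 2 v‖ ^ 2 := by
  rw [← hS.eigenvectorBasis.sum_sq_norm_inner_right (WithLp.toLp 2 v)]
  refine Finset.sum_congr rfl fun l _ => ?_
  rw [Real.norm_eq_abs, sq_abs]
  congr 1
  rw [EuclideanSpace.inner_eq_star_dotProduct, star_trivial, dotProduct_comm]

/-- Norms are compared coordinatewise in an eigenbasis. -/
theorem norm_le_of_eigen {S : Matrix κ κ ℝ} (hS : S.IsHermitian) {u v : κ → ℝ} {C : ℝ} (hC : 0 ≤ C)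
    (h : ∀ l, |(hS.eigenvectorBasis l : κ → ℝ) ⬝ᵥ u| ≤
      C * |(hS.eigenvectorBasis l : κ → ℝ) ⬝ᵥ v|) :
    ‖WithLp.toLp 2 u‖ ≤ C * ‖WithLp.toLp 2 v‖ := by
  refine le_of_sq_le_sq ?_ (by positivity)
  rw [mul_pow, ← sum_dotProduct_eigenvectorBasis_sq hS, ← sum_dotProduct_eigenvectorBasis_sq hS,
    Finset.mul_sum]
  refine Finset.sum_le_sum fun l _ => ?_
  rw [← sq_abs, ← sq_abs (_ ⬝ᵥ v), ← mul_pow]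
  exact pow_le_pow_left₀ (abs_nonneg _) (h l) 2

theorem le_norm_of_eigen {S : Matrix κ κ ℝ} (hS : S.IsHermitian) {u v : κ → ℝ} {C : ℝ} (hC : 0 ≤ C)
    (h : ∀ l, C * |(hS.eigenvectorBasis l : κ → ℝ) ⬝ᵥ v| ≤
      |(hS.eigenvectorBasis l : κ → ℝ) ⬝ᵥ u|) :
    C * ‖WithLp.toLp 2 v‖ ≤ ‖WithLp.toLp 2 u‖ := by
  refine le_of_sq_le_sq ?_ (by positivity)
  rw [mul_pow, ← sum_dotProduct_eigenvectorBasis_sq hS, ← sum_dotProduct_eigenvectorBasis_sq hS,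
    Finset.mul_sum]
  refine Finset.sum_le_sum fun l _ => ?_
  rw [← sq_abs (_ ⬝ᵥ v), ← sq_abs (_ ⬝ᵥ u), ← mul_pow]
  exact pow_le_pow_left₀ (by positivity) (h l) 2

theorem eigenvalues_mem_Icc {S : Matrix κ κ ℝ} (hS : S.IsHermitian) {m Mx : ℝ}
    (hm : ∀ v : κ → ℝ, m * (v ⬝ᵥ v) ≤ v ⬝ᵥ S.mulVec v)
    (hM : ∀ v : κ → ℝ, v ⬝ᵥ S.mulVec v ≤ Mx * (v ⬝ᵥ v)) (l : κ) :
    hS.eigenvalues l ∈ Set.Icc m Mx := by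
  have h1 : (hS.eigenvectorBasis l : κ → ℝ) ⬝ᵥ (hS.eigenvectorBasis l : κ → ℝ) = 1 := by
    rw [← norm_toLp_sq]
    have := hS.eigenvectorBasis.norm_eq_one l
    rw [WithLp.toLp_ofLp, this, one_pow]
  have h2 := hm (hS.eigenvectorBasis l)
  have h3 := hM (hS.eigenvectorBasis l)
  rw [hS.mulVec_eigenvectorBasis, dotProduct_smul, h1, smul_eq_mul] at h2 h3
  constructor <;> linarith

open scoped MatrixOrder in
/-- Eigenvectors of a positive semidefinite matrix are eigenvectors of its square root `R`: with
`u = R e - c e` one has `R u = -c u`, which forces `u = 0` by positivity of `R`. -/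
theorem sqrt_mulVec_of_eigen {B : Matrix κ κ ℝ} (hB : B.PosSemidef) {e : κ → ℝ} {c : ℝ} (hc : 0 < c)
    (he : B.mulVec e = c ^ 2 • e) : (CFC.sqrt B).mulVec e = c • e := by
  have hR : (CFC.sqrt B).PosSemidef := Matrix.nonneg_iff_posSemidef.1 (CFC.sqrt_nonneg B)
  have hRR : CFC.sqrt B * CFC.sqrt B = B := CFC.sqrt_mul_sqrt_self _ hB.nonneg
  set R := CFC.sqrt B
  set u := R.mulVec e - c • e with hu
  have h1 : R.mulVec u + c • u = 0 := by
    rw [hu, Matrix.mulVec_sub, Matrix.mulVec_mulVec, hRR, he, Matrix.mulVec_smul, smul_sub,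
      smul_smul, sq]
    abel
  have h2 : u ⬝ᵥ R.mulVec u + c * (u ⬝ᵥ u) = 0 := by
    have := congrArg (fun x => u ⬝ᵥ x) h1
    simpa [dotProduct_add, dotProduct_smul] using this
  have h3 : 0 ≤ u ⬝ᵥ R.mulVec u := by simpa using hR.dotProduct_mulVec_nonneg u
  have h4 : 0 ≤ u ⬝ᵥ u := by rw [← norm_toLp_sq]; positivity
  have h5 : u ⬝ᵥ u = 0 := by nlinarith
  have h6 : u = 0 := dotProduct_self_eq_zero.1 h5
  exact sub_eq_zero.1 h6

/-- A symmetric matrix whose quadratic form lies between `m ‖v‖²` and `Mx ‖v‖²`. -/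
structure SpectrumIn (S : Matrix κ κ ℝ) (m Mx : ℝ) : Prop where
  isHermitian : S.IsHermitian
  pos : 0 < m
  lower : ∀ v : κ → ℝ, m * (v ⬝ᵥ v) ≤ v ⬝ᵥ S.mulVec v
  upper : ∀ v : κ → ℝ, v ⬝ᵥ S.mulVec v ≤ Mx * (v ⬝ᵥ v)

namespace SpectrumIn

variable {S : Matrix κ κ ℝ} {m Mx : ℝ}

theorem posDef (h : SpectrumIn S m Mx) : S.PosDef := by
  refine Matrix.PosDef.of_dotProduct_mulVec_pos h.isHermitian fun v hv => ?_
  have h1 : 0 < v ⬝ᵥ v := by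
    rw [← norm_toLp_sq]
    have : WithLp.toLp 2 v ≠ 0 := by simpa using hv
    positivity
  rw [star_trivial]
  exact lt_of_lt_of_le (mul_pos h.pos h1) (h.lower v)

theorem isUnit_det (h : SpectrumIn S m Mx) : IsUnit S.det := h.posDef.det_pos.ne'.isUnit

theorem inv_mulVec_eigen (h : SpectrumIn S m Mx) {e : κ → ℝ} {σ : ℝ} (hσ : σ ≠ 0)
    (he : S.mulVec e = σ • e) : S⁻¹.mulVec e = σ⁻¹ • e := by
  have h1 : S⁻¹.mulVec (S.mulVec e) = e := by
    rw [Matrix.mulVec_mulVec, Matrix.nonsing_inv_mul _ h.isUnit_det, Matrix.one_mulVec]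
  rw [he, Matrix.mulVec_smul] at h1
  rw [← h1, smul_smul, h1, inv_mul_cancel₀ hσ, one_smul]

theorem dot_inv (h : SpectrumIn S m Mx) (l : κ) (v : κ → ℝ) :
    (h.isHermitian.eigenvectorBasis l : κ → ℝ) ⬝ᵥ S⁻¹.mulVec v =
      (h.isHermitian.eigenvalues l)⁻¹ * ((h.isHermitian.eigenvectorBasis l : κ → ℝ) ⬝ᵥ v) := by
  have hl := eigenvalues_mem_Icc h.isHermitian h.lower h.upper l
  exact dotProduct_mulVec_of_eigen h.isHermitian.inv
    (h.inv_mulVec_eigen (by linarith [hl.1, h.pos]) (h.isHermitian.mulVec_eigenvectorBasis l)) v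

theorem posSemidef_smul_inv (h : SpectrumIn S m Mx) {r : ℝ} (hr : 0 < r) :
    (r • S⁻¹).PosSemidef := h.posDef.inv.posSemidef.smul hr.le

open scoped MatrixOrder in
theorem dot_sqrt (h : SpectrumIn S m Mx) {r : ℝ} (hr : 0 < r) (l : κ) (v : κ → ℝ) :
    (h.isHermitian.eigenvectorBasis l : κ → ℝ) ⬝ᵥ (CFC.sqrt (r • S⁻¹)).mulVec v =
      √(r / h.isHermitian.eigenvalues l) *
        ((h.isHermitian.eigenvectorBasis l : κ → ℝ) ⬝ᵥ v) := by
  have hl := eigenvalues_mem_Icc h.isHermitian h.lower h.upper l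
  have hpos : 0 < h.isHermitian.eigenvalues l := lt_of_lt_of_le h.pos hl.1
  have hR : (CFC.sqrt (r • S⁻¹)).PosSemidef :=
    Matrix.nonneg_iff_posSemidef.1 (CFC.sqrt_nonneg _)
  refine dotProduct_mulVec_of_eigen hR.isHermitian
    (sqrt_mulVec_of_eigen (h.posSemidef_smul_inv hr) (by positivity) ?_) v
  rw [Matrix.smul_mulVec, h.inv_mulVec_eigen hpos.ne' (h.isHermitian.mulVec_eigenvectorBasis l),
    smul_smul, Real.sq_sqrt (by positivity), div_eq_mul_inv]

open scoped MatrixOrder in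
theorem norm_sqrt_le (h : SpectrumIn S m Mx) {r : ℝ} (hr : 0 < r) (v : κ → ℝ) :
    ‖WithLp.toLp 2 ((CFC.sqrt (r • S⁻¹)).mulVec v)‖ ≤ √(r / m) * ‖WithLp.toLp 2 v‖ := by
  refine norm_le_of_eigen h.isHermitian (by positivity) fun l => ?_
  rw [h.dot_sqrt hr, abs_mul, abs_of_nonneg (Real.sqrt_nonneg _)]
  have hl := eigenvalues_mem_Icc h.isHermitian h.lower h.upper l
  have := h.pos
  gcongr
  exact hl.1

open scoped MatrixOrder in
theorem le_norm_sqrt (h : SpectrumIn S m Mx) {r : ℝ} (hr : 0 < r) (v : κ → ℝ) :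
    √(r / Mx) * ‖WithLp.toLp 2 v‖ ≤ ‖WithLp.toLp 2 ((CFC.sqrt (r • S⁻¹)).mulVec v)‖ := by
  refine le_norm_of_eigen h.isHermitian (by positivity) fun l => ?_
  rw [h.dot_sqrt hr, abs_mul, abs_of_nonneg (Real.sqrt_nonneg _)]
  have hl := eigenvalues_mem_Icc h.isHermitian h.lower h.upper l
  have : 0 < h.isHermitian.eigenvalues l := lt_of_lt_of_le h.pos hl.1
  gcongr
  exact hl.2

end SpectrumIn

/-! ### Chebyshev iteration -/

/-- The contraction parameter `s = 1 - 1 / (2 √κ)` for the condition number `κ = Mx / m`. -/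
def rate (m Mx : ℝ) : ℝ := 1 - 1 / (2 * √(Mx / m))

/-- The affine image `Z` of `S` with `Mx⁻¹ S = 1 - 2 s Z + s²`, whose spectrum lies in
`[-1, 1]`. -/
def chebMatrix (S : Matrix κ κ ℝ) (m Mx : ℝ) : Matrix κ κ ℝ :=
  ((1 + rate m Mx ^ 2) / (2 * rate m Mx)) • (1 : Matrix κ κ ℝ) -
    (Mx⁻¹ / (2 * rate m Mx)) • S

theorem rate_bounds {m Mx : ℝ} (hm : 0 < m) (hM : m ≤ Mx) :
    1 / 2 ≤ rate m Mx ∧ rate m Mx < 1 ∧ (1 - rate m Mx) ^ 2 = m / (4 * Mx) := by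
  have hM0 : 0 < Mx := lt_of_lt_of_le hm hM
  have h1 : 1 ≤ √(Mx / m) := Real.one_le_sqrt.2 ((one_le_div hm).2 hM)
  have h0 : 0 < √(Mx / m) := by linarith
  refine ⟨?_, ?_, ?_⟩
  · have : 1 / (2 * √(Mx / m)) ≤ 1 / 2 := by
      apply one_div_le_one_div_of_le <;> linarith
    unfold rate; linarith
  · have : 0 < 1 / (2 * √(Mx / m)) := by positivity
    unfold rate; linarith
  · unfold rate
    rw [sub_sub_cancel, div_pow, mul_pow, Real.sq_sqrt (by positivity)]
    field_simp
    norm_num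

theorem rate_pow_le {m Mx : ℝ} (hm : 0 < m) (hM : m ≤ Mx) (N : ℕ) :
    rate m Mx ^ N ≤ Real.exp (-(N / (2 * √(Mx / m)))) := by
  have h := rate_bounds hm hM
  have h1 : rate m Mx ≤ Real.exp (-(1 / (2 * √(Mx / m)))) := by
    have := Real.add_one_le_exp (-(1 / (2 * √(Mx / m))))
    unfold rate; linarith
  refine (pow_le_pow_left₀ (by linarith) h1 N).trans (le_of_eq ?_)
  rw [← Real.exp_nat_mul]
  congr 1
  ring

/-- The common error of the truncated Chebyshev expansions. -/
def chebErr (m Mx : ℝ) (N : ℕ) : ℝ := 2 * rate m Mx ^ (N + 1) / (1 - rate m Mx) ^ 2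

theorem chebErr_nonneg {m Mx : ℝ} (hm : 0 < m) (hM : m ≤ Mx) (N : ℕ) : 0 ≤ chebErr m Mx N := by
  have := (rate_bounds hm hM).1
  have : 0 ≤ rate m Mx := by linarith
  unfold chebErr; positivity

theorem chebErr_le {m Mx : ℝ} (hm : 0 < m) (hM : m ≤ Mx) (N : ℕ) :
    chebErr m Mx N ≤ 8 * (Mx / m) * Real.exp (-((N + 1 : ℕ) / (2 * √(Mx / m)))) := by
  have hM0 : 0 < Mx := lt_of_lt_of_le hm hM
  unfold chebErr
  rw [(rate_bounds hm hM).2.2]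
  calc 2 * rate m Mx ^ (N + 1) / (m / (4 * Mx))
      = 8 * (Mx / m) * rate m Mx ^ (N + 1) := by field_simp; ring
    _ ≤ _ := by gcongr; exact rate_pow_le hm hM (N + 1)

namespace SpectrumIn

variable {S : Matrix κ κ ℝ} {m Mx : ℝ}

theorem le_of_index (h : SpectrumIn S m Mx) (l : κ) : m ≤ Mx := by
  have hl := eigenvalues_mem_Icc h.isHermitian h.lower h.upper l
  exact hl.1.trans hl.2

/-- On an eigenvector, `Z` acts as multiplication by `cos θ`, where
`1 - 2 s cos θ + s² = σ / Mx`. -/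
theorem exists_angle (h : SpectrumIn S m Mx) (l : κ) :
    ∃ θ : ℝ, (∀ v, (h.isHermitian.eigenvectorBasis l : κ → ℝ) ⬝ᵥ (chebMatrix S m Mx).mulVec v =
        Real.cos θ * ((h.isHermitian.eigenvectorBasis l : κ → ℝ) ⬝ᵥ v)) ∧
      1 - 2 * rate m Mx * Real.cos θ + rate m Mx ^ 2 = Mx⁻¹ * h.isHermitian.eigenvalues l := by
  obtain ⟨h1, h2⟩ := eigenvalues_mem_Icc h.isHermitian h.lower h.upper l
  have hm := h.pos
  have hM := h.le_of_index l
  have hM0 : 0 < Mx := lt_of_lt_of_le hm hM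
  obtain ⟨r1, r2, r3⟩ := rate_bounds hm hM
  set σ := h.isHermitian.eigenvalues l
  set s := rate m Mx
  set z := (1 + s ^ 2 - Mx⁻¹ * σ) / (2 * s) with hz
  have hs : 0 < s := by linarith
  have hσ1 : Mx⁻¹ * σ ≤ 1 := by rw [inv_mul_le_one₀ hM0]; exact h2
  have hσ2 : (1 - s) ^ 2 ≤ Mx⁻¹ * σ := by
    rw [r3]
    calc m / (4 * Mx) ≤ Mx⁻¹ * m := by
          rw [div_le_iff₀ (by positivity)]; field_simp; linarith
      _ ≤ Mx⁻¹ * σ := by gcongr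
  have hz1 : -1 ≤ z := by rw [hz, le_div_iff₀ (by positivity)]; nlinarith
  have hz2 : z ≤ 1 := by rw [hz, div_le_iff₀ (by positivity)]; nlinarith
  refine ⟨Real.arccos z, fun v => ?_, ?_⟩
  · rw [Real.cos_arccos hz1 hz2, chebMatrix, Matrix.sub_mulVec, Matrix.smul_mulVec,
      Matrix.smul_mulVec, Matrix.one_mulVec, dotProduct_sub, dotProduct_smul, dotProduct_smul,
      dotProduct_mulVec_of_eigen h.isHermitian (h.isHermitian.mulVec_eigenvectorBasis l),
      smul_eq_mul, smul_eq_mul, hz]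
    ring
  · rw [Real.cos_arccos hz1 hz2, hz]
    field_simp
    ring

theorem norm_chebVec_le (h : SpectrumIn S m Mx) (b : κ → ℝ) (j : ℕ) :
    ‖WithLp.toLp 2 (chebVec (chebMatrix S m Mx) b j)‖ ≤ ‖WithLp.toLp 2 b‖ := by
  rw [← one_mul ‖WithLp.toLp 2 b‖]
  refine norm_le_of_eigen h.isHermitian zero_le_one fun l => ?_
  obtain ⟨θ, h1, -⟩ := h.exists_angle l
  rw [dot_chebVec h1, abs_mul]
  exact mul_le_mul_of_nonneg_right (Real.abs_cos_le_one _) (abs_nonneg _)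

/-- The truncated Chebyshev expansion of `S⁻¹`, with geometrically small error. -/
theorem norm_inv_approx (h : SpectrumIn S m Mx) (b : κ → ℝ) (N : ℕ) :
    ‖WithLp.toLp 2 ((∑ j ∈ Finset.range (N + 1), (Mx⁻¹ * chebCoeff (fun _ => 1) (rate m Mx) N j) •
      chebVec (chebMatrix S m Mx) b j) - S⁻¹.mulVec b)‖ ≤
      (|Mx⁻¹| * chebErr m Mx N) * ‖WithLp.toLp 2 b‖ := by
  rcases isEmpty_or_nonempty κ with hκ | ⟨⟨l0⟩⟩
  · have : ∀ v : κ → ℝ, WithLp.toLp 2 v = 0 := fun v => Subsingleton.elim _ _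
    simp [this]
  have hm := h.pos
  have hM := h.le_of_index l0
  have hM0 : 0 < Mx := lt_of_lt_of_le hm hM
  obtain ⟨r1, r2, r3⟩ := rate_bounds hm hM
  have hτ := chebErr_nonneg hm hM N
  refine norm_le_of_eigen h.isHermitian (by positivity) fun l => ?_
  obtain ⟨θ, h1, h2⟩ := h.exists_angle l
  have hl := eigenvalues_mem_Icc h.isHermitian h.lower h.upper l
  have hσ : 0 < h.isHermitian.eigenvalues l := lt_of_lt_of_le hm hl.1
  have h3 := abs_sum_chebCoeff_one_sub_le (s := rate m Mx) (by linarith) r2 θ N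
  rw [h2, mul_inv, inv_inv] at h3
  rw [dotProduct_sub, dot_sum_chebVec h1, h.dot_inv, ← sub_mul, abs_mul]
  refine mul_le_mul_of_nonneg_right ?_ (abs_nonneg _)
  have h4 : (∑ j ∈ Finset.range (N + 1), Mx⁻¹ * chebCoeff (fun _ => 1) (rate m Mx) N j *
      Real.cos (j * θ)) - (h.isHermitian.eigenvalues l)⁻¹ =
      Mx⁻¹ * ((∑ j ∈ Finset.range (N + 1), chebCoeff (fun _ => 1) (rate m Mx) N j *
        Real.cos (j * θ)) - Mx * (h.isHermitian.eigenvalues l)⁻¹) := by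
    rw [mul_sub, Finset.mul_sum, ← mul_assoc Mx⁻¹ Mx, inv_mul_cancel₀ hM0.ne', one_mul]
    simp only [mul_assoc]
  rw [h4, abs_mul]
  exact mul_le_mul_of_nonneg_left h3 (abs_nonneg _)

open scoped MatrixOrder in
/-- The truncated Chebyshev expansion of the square root of `r S⁻¹`, with geometrically small error. -/
theorem norm_sqrt_approx (h : SpectrumIn S m Mx) {r : ℝ} (hr : 0 < r) (b : κ → ℝ) (N : ℕ) :
    ‖WithLp.toLp 2 ((∑ j ∈ Finset.range (N + 1),
      (√(r * Mx⁻¹) * chebCoeff invSqrtCoeff (rate m Mx) N j) •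
      chebVec (chebMatrix S m Mx) b j) - (CFC.sqrt (r • S⁻¹)).mulVec b)‖ ≤
      (√(r * Mx⁻¹) * chebErr m Mx N) * ‖WithLp.toLp 2 b‖ := by
  rcases isEmpty_or_nonempty κ with hκ | ⟨⟨l0⟩⟩
  · have : ∀ v : κ → ℝ, WithLp.toLp 2 v = 0 := fun v => Subsingleton.elim _ _
    simp [this]
  have hm := h.pos
  have hM := h.le_of_index l0
  have hM0 : 0 < Mx := lt_of_lt_of_le hm hM
  obtain ⟨r1, r2, r3⟩ := rate_bounds hm hM
  have hτ := chebErr_nonneg hm hM N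
  refine norm_le_of_eigen h.isHermitian (by positivity) fun l => ?_
  obtain ⟨θ, h1, h2⟩ := h.exists_angle l
  have hl := eigenvalues_mem_Icc h.isHermitian h.lower h.upper l
  have hσ : 0 < h.isHermitian.eigenvalues l := lt_of_lt_of_le hm hl.1
  have h3 := abs_sum_chebCoeff_invSqrt_sub_le (s := rate m Mx) (by linarith) r2 θ N
  rw [h2] at h3
  rw [dotProduct_sub, dot_sum_chebVec h1, h.dot_sqrt hr, ← sub_mul, abs_mul]
  refine mul_le_mul_of_nonneg_right ?_ (abs_nonneg _)
  have h5 : √(r / h.isHermitian.eigenvalues l) =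
      √(r * Mx⁻¹) * (√(Mx⁻¹ * h.isHermitian.eigenvalues l))⁻¹ := by
    rw [← Real.sqrt_inv, ← Real.sqrt_mul (by positivity)]
    congr 1
    field_simp
  have h4 : (∑ j ∈ Finset.range (N + 1), √(r * Mx⁻¹) * chebCoeff invSqrtCoeff (rate m Mx) N j *
      Real.cos (j * θ)) - √(r / h.isHermitian.eigenvalues l) =
      √(r * Mx⁻¹) * ((∑ j ∈ Finset.range (N + 1), chebCoeff invSqrtCoeff (rate m Mx) N j *
        Real.cos (j * θ)) - (√(Mx⁻¹ * h.isHermitian.eigenvalues l))⁻¹) := by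
    rw [mul_sub, Finset.mul_sum, h5]
    simp only [mul_assoc]
  rw [h4, abs_mul, abs_of_nonneg (Real.sqrt_nonneg _)]
  exact mul_le_mul_of_nonneg_left h3 (Real.sqrt_nonneg _)

end SpectrumIn

end Spectral

end

end TSTransformer

namespace TSTransformer

noncomputable section

/-! ### Layout of a token -/

/-- The free coordinates: six working slots, each holding one vector of `ℝ^d` per action, and one
scalar per action for the posterior mean reward. -/
abbrev FreeIdx (d A : ℕ) : Type := (Fin 6 × Fin A × Fin d) ⊕ Fin A

/-- The number of free coordinates. -/
def numFree (d A : ℕ) : ℕ := Fintype.card (FreeIdx d A)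

/-- An enumeration of the free coordinates. -/
def freeEquiv (d A : ℕ) : FreeIdx d A ≃ Fin (numFree d A) := Fintype.equivFin _

/-- Token coordinates with the free coordinates of `FreeIdx`. -/
abbrev TokIdx (d A : ℕ) : Type := Coord d A (numFree d A)

/-- The slot of the current Chebyshev vector; the previous one is kept in slot `1`. -/
abbrev slotCur : Fin 6 := 0
/-- The slot accumulating `√r Σ^(-1/2) a_k`. -/
abbrev slotSqrt : Fin 6 := 2
/-- The slot accumulating a multiple of `Σ⁻¹ a_k`. -/
abbrev slotInv : Fin 6 := 3
/-- The scratch slot for a vector multiplied by the position. -/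
abbrev slotScaled : Fin 6 := 4
/-- The scratch slot for a Gram matrix applied to a vector. -/
abbrev slotGram : Fin 6 := 5

variable {d A : ℕ}

/-- The token with given blocks: action `a`, reward `ρ`, action set `b`, policy block `c`, working
slots `W`, scalars `y` and positional encoding `P`. -/
def tok (a : Fin d → ℝ) (ρ : ℝ) (b : Fin A → Fin d → ℝ) (c : Fin A → ℝ)
    (W : Fin 6 → Fin A → Fin d → ℝ) (y : Fin A → ℝ) (P : Fin 3 → ℝ) : TokIdx d A → ℝ :=
  Sum.elim (Sum.elim a fun _ => ρ) <| Sum.elim (fun q => b q.1 q.2) <| Sum.elim c <|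
    Sum.elim (fun l => Sum.elim (fun q => W q.1 q.2.1 q.2.2) y ((freeEquiv d A).symm l)) P

/-- The action block of a token. -/
def getA (h : TokIdx d A → ℝ) (l : Fin d) : ℝ := h (Sum.inl (Sum.inl l))
/-- The reward of a token. -/
def getR (h : TokIdx d A → ℝ) : ℝ := h (Sum.inl (Sum.inr ()))
/-- The action set block of a token. -/
def getB (h : TokIdx d A → ℝ) (k : Fin A) (l : Fin d) : ℝ := h (Sum.inr (Sum.inl (k, l)))
/-- The policy block of a token. -/
def getC (h : TokIdx d A → ℝ) (k : Fin A) : ℝ := h (Sum.inr (Sum.inr (Sum.inl k)))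
/-- The working slots of a token. -/
def getW (h : TokIdx d A → ℝ) (q : Fin 6) (k : Fin A) (l : Fin d) : ℝ :=
  h (Sum.inr (Sum.inr (Sum.inr (Sum.inl (freeEquiv d A (Sum.inl (q, k, l)))))))
/-- The scalars of a token. -/
def getY (h : TokIdx d A → ℝ) (k : Fin A) : ℝ :=
  h (Sum.inr (Sum.inr (Sum.inr (Sum.inl (freeEquiv d A (Sum.inr k))))))
/-- The positional encoding of a token. -/
def getP (h : TokIdx d A → ℝ) (l : Fin 3) : ℝ := h (Sum.inr (Sum.inr (Sum.inr (Sum.inr l))))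

section Layout

variable (a : Fin d → ℝ) (ρ : ℝ) (b : Fin A → Fin d → ℝ) (c : Fin A → ℝ)
  (W : Fin 6 → Fin A → Fin d → ℝ) (y : Fin A → ℝ) (P : Fin 3 → ℝ) (h h' : TokIdx d A → ℝ) (t : ℝ)

@[simp] theorem getA_tok : getA (tok a ρ b c W y P) = a := rfl
@[simp] theorem getR_tok : getR (tok a ρ b c W y P) = ρ := rfl
@[simp] theorem getB_tok : getB (tok a ρ b c W y P) = b := rfl
@[simp] theorem getC_tok : getC (tok a ρ b c W y P) = c := rfl
@[simp] theorem getW_tok : getW (tok a ρ b c W y P) = W := by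
  funext q k l; simp [getW, tok]
@[simp] theorem getY_tok : getY (tok a ρ b c W y P) = y := by
  funext k; simp [getY, tok]
@[simp] theorem getP_tok : getP (tok a ρ b c W y P) = P := rfl

@[simp] theorem getA_add : getA (h + h') = getA h + getA h' := rfl
@[simp] theorem getR_add : getR (h + h') = getR h + getR h' := rfl
@[simp] theorem getB_add : getB (h + h') = getB h + getB h' := rfl
@[simp] theorem getC_add : getC (h + h') = getC h + getC h' := rfl
@[simp] theorem getW_add : getW (h + h') = getW h + getW h' := rfl
@[simp] theorem getY_add : getY (h + h') = getY h + getY h' := rfl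
@[simp] theorem getP_add : getP (h + h') = getP h + getP h' := rfl

@[simp] theorem getA_smul : getA (t • h) = t • getA h := rfl
@[simp] theorem getR_smul : getR (t • h) = t * getR h := rfl
@[simp] theorem getB_smul : getB (t • h) = t • getB h := rfl
@[simp] theorem getC_smul : getC (t • h) = t • getC h := rfl
@[simp] theorem getW_smul : getW (t • h) = t • getW h := rfl
@[simp] theorem getY_smul : getY (t • h) = t • getY h := rfl
@[simp] theorem getP_smul : getP (t • h) = t • getP h := rfl

theorem tok_get : tok (getA h) (getR h) (getB h) (getC h) (getW h) (getY h) (getP h) = h := by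
  funext i
  rcases i with (i | i) | i | i | i | i
  · rfl
  · rfl
  · rfl
  · rfl
  · obtain ⟨u, rfl⟩ := (freeEquiv d A).surjective i
    rcases u with ⟨q, k, l⟩ | k <;> simp [tok, getW, getY]
  · rfl

theorem tok_add {a' : Fin d → ℝ} {ρ' : ℝ} {b' : Fin A → Fin d → ℝ} {c' : Fin A → ℝ}
    {W' : Fin 6 → Fin A → Fin d → ℝ} {y' : Fin A → ℝ} {P' : Fin 3 → ℝ} :
    tok a ρ b c W y P + tok a' ρ' b' c' W' y' P' =
      tok (a + a') (ρ + ρ') (b + b') (c + c') (W + W') (y + y') (P + P') := by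
  rw [← tok_get (tok a ρ b c W y P + tok a' ρ' b' c' W' y' P')]
  simp

theorem tok_smul : t • tok a ρ b c W y P =
    tok (t • a) (t * ρ) (t • b) (t • c) (t • W) (t • y) (t • P) := by
  rw [← tok_get (t • tok a ρ b c W y P)]
  simp

theorem tok_zero : tok (0 : Fin d → ℝ) 0 (0 : Fin A → Fin d → ℝ) 0 0 0 0 = 0 := by
  rw [← tok_get (0 : TokIdx d A → ℝ)]
  rfl

theorem tok_dotProduct : tok a ρ b c W y P ⬝ᵥ h =
    (∑ l, a l * getA h l) + ρ * getR h + (∑ k, ∑ l, b k l * getB h k l) + (∑ k, c k * getC h k) +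
    (∑ q, ∑ k, ∑ l, W q k l * getW h q k l) + (∑ k, y k * getY h k) + ∑ l, P l * getP h l := by
  simp only [dotProduct, Fintype.sum_sum_type]
  rw [← (freeEquiv d A).sum_comp]
  simp [tok, Fintype.sum_prod_type, getA, getR, getB, getC, getW, getY, getP]
  ring

theorem norm_sq_eq : ‖WithLp.toLp 2 h‖ ^ 2 =
    (∑ l, getA h l ^ 2) + getR h ^ 2 + (∑ k, ∑ l, getB h k l ^ 2) + (∑ k, getC h k ^ 2) +
    (∑ q, ∑ k, ∑ l, getW h q k l ^ 2) + (∑ k, getY h k ^ 2) + ∑ l, getP h l ^ 2 := by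
  have := tok_dotProduct (getA h) (getR h) (getB h) (getC h) (getW h) (getY h) (getP h) h
  rw [tok_get] at this
  rw [norm_toLp_sq, this]
  simp only [sq]

end Layout

/-! ### Linear maps on tokens and their operator norms -/

theorem norm_toMatrix'_le {ι κ : Type} [Fintype ι] [Fintype κ] [DecidableEq ι]
    (f : (ι → ℝ) →ₗ[ℝ] (κ → ℝ)) {C : ℝ} (hC : 0 ≤ C)
    (h : ∀ v, ‖WithLp.toLp 2 (f v)‖ ^ 2 ≤ C ^ 2 * ‖WithLp.toLp 2 v‖ ^ 2) :
    ‖LinearMap.toMatrix' f‖ ≤ C := by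
  classical
  rw [Matrix.l2_opNorm_def]
  refine ContinuousLinearMap.opNorm_le_bound _ hC fun v => ?_
  refine le_of_sq_le_sq ?_ (by positivity)
  have e : ((Matrix.toEuclideanLin ≪≫ₗ LinearMap.toContinuousLinearMap)
      (LinearMap.toMatrix' f)) v = WithLp.toLp 2 (f v.ofLp) := by
    rw [← LinearMap.toMatrix'_mulVec f]
    rfl
  rw [mul_pow, e]
  exact h v.ofLp

/-- A linear map between tokens given by formulas for its blocks. -/
abbrev TokMap (d A : ℕ) : Type := (TokIdx d A → ℝ) →ₗ[ℝ] (TokIdx d A → ℝ)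

/-- The query that turns the positional encoding `(i, i², 1)` into `(i, 1 / (2T), -i²)`; its product
with `(j, j², 1)` is positive at `j = i` and nonpositive at `j < i`. -/
def qPos (d A T : ℕ) : TokMap d A where
  toFun h := tok 0 0 0 0 0 0 ![getP h 0, getP h 2 / (2 * T), -getP h 1]
  map_add' h h' := by
    rw [tok_add]; congr 1 <;> simp
    · ring_nf; simp
  map_smul' t h := by
    rw [tok_smul]; congr 1 <;> simp
    ring_nf

/-- The key that extracts the positional encoding. -/
def kPos (d A : ℕ) : TokMap d A where
  toFun h := tok 0 0 0 0 0 0 (getP h)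
  map_add' h h' := by rw [tok_add]; simp
  map_smul' t h := by rw [tok_smul]; simp

/-- The value that copies the `k`-th vector of slot `q` into the scratch slot `slotScaled`. -/
def vCopy (q : Fin 6) (k : Fin A) : TokMap d A where
  toFun h := tok 0 0 0 0 (Pi.single slotScaled (Pi.single k (getW h q k))) 0 0
  map_add' h h' := by rw [tok_add]; simp [Pi.single_add]
  map_smul' t h := by rw [tok_smul]; simp [Pi.single_smul]

/-- The query that puts `t` times the `k`-th vector of the scratch slot into the action block. -/
def qScaled (t : ℝ) (k : Fin A) : TokMap d A where
  toFun h := tok (t • getW h slotScaled k) 0 0 0 0 0 0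
  map_add' h h' := by rw [tok_add]; simp
  map_smul' u h := by rw [tok_smul]; simp [smul_comm t u]

/-- The key that extracts the action block. -/
def kAct (d A : ℕ) : TokMap d A where
  toFun h := tok (getA h) 0 0 0 0 0 0
  map_add' h h' := by rw [tok_add]; simp
  map_smul' t h := by rw [tok_smul]; simp

/-- The value that adds `t` times the action to the `k`-th vector of the Gram slot. -/
def vGram (t : ℝ) (k : Fin A) : TokMap d A where
  toFun h := tok 0 0 0 0 (Pi.single slotGram (Pi.single k (t • getA h))) 0 0
  map_add' h h' := by rw [tok_add]; simp [Pi.single_add]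
  map_smul' u h := by rw [tok_smul]; simp [Pi.single_smul, smul_comm t u]

/-- The value that adds `t` times the reward to the `k`-th scalar. -/
def vReward (t : ℝ) (k : Fin A) : TokMap d A where
  toFun h := tok 0 0 0 0 0 (Pi.single k (t * getR h)) 0
  map_add' h h' := by rw [tok_add]; simp [Pi.single_add, mul_add]
  map_smul' u h := by rw [tok_smul]; simp [← Pi.single_smul, mul_left_comm t u]

theorem sum_single_sq (k : Fin A) (v : Fin d → ℝ) :
    ∑ k', ∑ l, (Pi.single k v : Fin A → Fin d → ℝ) k' l ^ 2 = ∑ l, v l ^ 2 := by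
  rw [Finset.sum_eq_single k]
  · simp
  · intro k' _ hk'; simp [Pi.single_eq_of_ne hk']
  · simp

theorem sum_single_single_sq (q : Fin 6) (k : Fin A) (v : Fin d → ℝ) :
    ∑ q', ∑ k', ∑ l, (Pi.single q (Pi.single k v) : Fin 6 → Fin A → Fin d → ℝ) q' k' l ^ 2 =
      ∑ l, v l ^ 2 := by
  rw [Finset.sum_eq_single q]
  · rw [Pi.single_eq_same, sum_single_sq]
  · intro q' _ hq'; simp [Pi.single_eq_of_ne hq']
  · simp

section BlockNorms

variable (h : TokIdx d A → ℝ)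

theorem sum_getW_sq_le : ∑ q, ∑ k, ∑ l, getW h q k l ^ 2 ≤ ‖WithLp.toLp 2 h‖ ^ 2 := by
  rw [norm_sq_eq]
  have h1 : 0 ≤ ∑ l, getA h l ^ 2 := by positivity
  have h2 : 0 ≤ ∑ k, ∑ l, getB h k l ^ 2 := by positivity
  have h3 : 0 ≤ ∑ k, getC h k ^ 2 := by positivity
  have h4 : 0 ≤ ∑ k, getY h k ^ 2 := by positivity
  have h5 : 0 ≤ ∑ l, getP h l ^ 2 := by positivity
  nlinarith [sq_nonneg (getR h)]

theorem sum_getW_slot_sq_le (q : Fin 6) (k : Fin A) :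
    ∑ l, getW h q k l ^ 2 ≤ ‖WithLp.toLp 2 h‖ ^ 2 := by
  refine le_trans ?_ (sum_getW_sq_le h)
  refine le_trans ?_ (Finset.single_le_sum
    (f := fun q => ∑ k, ∑ l, getW h q k l ^ 2) (fun _ _ => by positivity) (Finset.mem_univ q))
  exact Finset.single_le_sum
    (f := fun k => ∑ l, getW h q k l ^ 2) (fun _ _ => by positivity) (Finset.mem_univ k)

theorem sum_getA_sq_add_le : ∑ l, getA h l ^ 2 + getR h ^ 2 ≤ ‖WithLp.toLp 2 h‖ ^ 2 := by
  rw [norm_sq_eq]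
  have h1 : 0 ≤ ∑ q, ∑ k, ∑ l, getW h q k l ^ 2 := by positivity
  have h2 : 0 ≤ ∑ k, ∑ l, getB h k l ^ 2 := by positivity
  have h3 : 0 ≤ ∑ k, getC h k ^ 2 := by positivity
  have h4 : 0 ≤ ∑ k, getY h k ^ 2 := by positivity
  have h5 : 0 ≤ ∑ l, getP h l ^ 2 := by positivity
  linarith

theorem sum_getP_sq_le : ∑ l, getP h l ^ 2 ≤ ‖WithLp.toLp 2 h‖ ^ 2 := by
  rw [norm_sq_eq]
  have h1 : 0 ≤ ∑ q, ∑ k, ∑ l, getW h q k l ^ 2 := by positivity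
  have h2 : 0 ≤ ∑ k, ∑ l, getB h k l ^ 2 := by positivity
  have h3 : 0 ≤ ∑ k, getC h k ^ 2 := by positivity
  have h4 : 0 ≤ ∑ k, getY h k ^ 2 := by positivity
  have h5 : 0 ≤ ∑ l, getA h l ^ 2 := by positivity
  nlinarith [sq_nonneg (getR h)]

theorem sum_getB_add_getW_sq_le : (∑ k, ∑ l, getB h k l ^ 2) + ∑ q, ∑ k, ∑ l, getW h q k l ^ 2 ≤
    ‖WithLp.toLp 2 h‖ ^ 2 := by
  rw [norm_sq_eq]
  have h1 : 0 ≤ ∑ l, getA h l ^ 2 := by positivity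
  have h3 : 0 ≤ ∑ k, getC h k ^ 2 := by positivity
  have h4 : 0 ≤ ∑ k, getY h k ^ 2 := by positivity
  have h5 : 0 ≤ ∑ l, getP h l ^ 2 := by positivity
  nlinarith [sq_nonneg (getR h)]

end BlockNorms

theorem norm_qPos_le {T : ℕ} (hT : 1 ≤ T) : ‖LinearMap.toMatrix' (qPos d A T)‖ ≤ 1 := by
  refine norm_toMatrix'_le _ zero_le_one fun h => ?_
  have h1 := sum_getP_sq_le h
  have hT' : (1 : ℝ) ≤ T := by exact_mod_cast hT
  have h2 : (getP h 2 / (2 * T)) ^ 2 ≤ getP h 2 ^ 2 := by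
    rw [div_pow]
    exact div_le_self (sq_nonneg _) (by nlinarith)
  rw [norm_sq_eq]
  simp only [qPos, LinearMap.coe_mk, AddHom.coe_mk, getA_tok, getR_tok, getB_tok, getC_tok,
    getW_tok, getY_tok, getP_tok]
  rw [Fin.sum_univ_three] at h1 ⊢
  simp
  linarith

theorem norm_kPos_le : ‖LinearMap.toMatrix' (kPos d A)‖ ≤ 1 := by
  refine norm_toMatrix'_le _ zero_le_one fun h => ?_
  rw [norm_sq_eq]
  simpa [kPos] using sum_getP_sq_le h

theorem norm_vCopy_le (q : Fin 6) (k : Fin A) :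
    ‖LinearMap.toMatrix' (vCopy (d := d) q k)‖ ≤ 1 := by
  refine norm_toMatrix'_le _ zero_le_one fun h => ?_
  rw [norm_sq_eq]
  simpa [vCopy, sum_single_single_sq] using sum_getW_slot_sq_le h q k

theorem norm_qScaled_le {t : ℝ} (ht : t ^ 2 = 1) (k : Fin A) :
    ‖LinearMap.toMatrix' (qScaled (d := d) t k)‖ ≤ 1 := by
  refine norm_toMatrix'_le _ zero_le_one fun h => ?_
  rw [norm_sq_eq]
  simpa [qScaled, mul_pow, ht] using sum_getW_slot_sq_le h slotScaled k

theorem norm_kAct_le : ‖LinearMap.toMatrix' (kAct d A)‖ ≤ 1 := by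
  refine norm_toMatrix'_le _ zero_le_one fun h => ?_
  rw [norm_sq_eq]
  simpa [kAct] using le_trans (by nlinarith [sq_nonneg (getR h)]) (sum_getA_sq_add_le h)

theorem norm_vGram_le {t : ℝ} (ht : t ^ 2 = 1) (k : Fin A) :
    ‖LinearMap.toMatrix' (vGram (d := d) t k)‖ ≤ 1 := by
  refine norm_toMatrix'_le _ zero_le_one fun h => ?_
  rw [norm_sq_eq]
  simpa [vGram, sum_single_single_sq, mul_pow, ht] using
    le_trans (by nlinarith [sq_nonneg (getR h)]) (sum_getA_sq_add_le h)

theorem norm_vReward_le {t : ℝ} (ht : t ^ 2 = 1) (k : Fin A) :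
    ‖LinearMap.toMatrix' (vReward (d := d) t k)‖ ≤ 1 := by
  refine norm_toMatrix'_le _ zero_le_one fun h => ?_
  rw [norm_sq_eq]
  have h1 : ∑ k', (Pi.single k (t * getR h) : Fin A → ℝ) k' ^ 2 = getR h ^ 2 := by
    rw [Finset.sum_eq_single k]
    · simp [mul_pow, ht]
    · intro k' _ hk'; simp [Pi.single_eq_of_ne hk']
    · simp
  have h2 : 0 ≤ ∑ l, getA h l ^ 2 := by positivity
  simpa [vReward, h1] using le_trans (by linarith) (sum_getA_sq_add_le h)

/-! ### Attention layers -/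

/-- The sign of a head: every action uses a pair of heads of opposite signs, whose ReLU weights
combine to a linear weight. -/
def headSign (σ : Fin 2) : ℝ := if σ = 0 then 1 else -1

theorem headSign_sq (σ : Fin 2) : headSign σ ^ 2 = 1 := by
  unfold headSign; split_ifs <;> norm_num

/-- The attention layer that adds `i / (2T)` times slot `q` to the scratch slot at position `i`. -/
def scaleAttn (d A T : ℕ) (q : Fin 6) : AttnParams (TokIdx d A) (A * 2) where
  V m := if (finProdFinEquiv.symm m).2 = 0 then
    LinearMap.toMatrix' (vCopy q (finProdFinEquiv.symm m).1) else 0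
  Q _ := LinearMap.toMatrix' (qPos d A T)
  K _ := LinearMap.toMatrix' (kPos d A)

/-- The attention layer that applies `(1 / i) ∑_{j ≤ i} a_j a_jᵀ` to the vectors of the scratch
slot. -/
def gramAttn (d A : ℕ) : AttnParams (TokIdx d A) (A * 2) where
  V m := LinearMap.toMatrix' (vGram (headSign (finProdFinEquiv.symm m).2) (finProdFinEquiv.symm m).1)
  Q m := LinearMap.toMatrix'
    (qScaled (headSign (finProdFinEquiv.symm m).2) (finProdFinEquiv.symm m).1)
  K _ := LinearMap.toMatrix' (kAct d A)

/-- The attention layer that adds `(1 / i) ∑_{j ≤ i} r_j ⟨a_j, ·⟩` of the vectors of the scratch slot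
to the scalars. -/
def rewardAttn (d A : ℕ) : AttnParams (TokIdx d A) (A * 2) where
  V m := LinearMap.toMatrix'
    (vReward (headSign (finProdFinEquiv.symm m).2) (finProdFinEquiv.symm m).1)
  Q m := LinearMap.toMatrix'
    (qScaled (headSign (finProdFinEquiv.symm m).2) (finProdFinEquiv.symm m).1)
  K _ := LinearMap.toMatrix' (kAct d A)

/-- The attention layer that does nothing. -/
def idleAttn (d A : ℕ) : AttnParams (TokIdx d A) (A * 2) where
  V _ := 0
  Q _ := 0
  K _ := 0

theorem relu_sub_relu_neg (x : ℝ) : relu x - relu (-x) = x := by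
  unfold relu
  rcases le_total x 0 with h | h
  · rw [max_eq_right h, max_eq_left (by linarith)]; ring
  · rw [max_eq_left h, max_eq_right (by linarith)]; ring

/-- On positions up to `2 T` the ReLU weight of the scaling head vanishes except at `j = i`: for `j < i`
the term `j² / (2 T) ≤ j` does not make up for `i (i - j) ≥ i`. -/
theorem relu_position {T i j : ℕ} (hT : 1 ≤ T) (hi : i ≤ 2 * T) (hj : j ≤ i) :
    relu ((i : ℝ) * j + 1 / (2 * T) * (j : ℝ) ^ 2 - (i : ℝ) ^ 2) =
      if j = i then (i : ℝ) ^ 2 / (2 * T) else 0 := by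
  have hT' : (0 : ℝ) < 2 * T := by
    have : (1 : ℝ) ≤ T := by exact_mod_cast hT
    linarith
  unfold relu
  split_ifs with h
  · subst h
    rw [max_eq_left]
    · ring
    · have : 0 ≤ 1 / (2 * (T : ℝ)) * (j : ℝ) ^ 2 := by positivity
      nlinarith
  · refine max_eq_right ?_
    have h1 : (j : ℝ) + 1 ≤ i := by exact_mod_cast lt_of_le_of_ne hj h
    have h2 : (i : ℝ) ≤ 2 * T := by exact_mod_cast hi
    have h0 : (0 : ℝ) ≤ j := Nat.cast_nonneg j
    have h3 : 1 / (2 * (T : ℝ)) * (j : ℝ) ^ 2 ≤ j := by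
      rw [div_mul_eq_mul_div, one_mul, div_le_iff₀ hT', sq]
      exact mul_le_mul_of_nonneg_left (by linarith) h0
    nlinarith

theorem sum_tok_W {J : Type} (s : Finset J) (f : J → Fin 6 → Fin A → Fin d → ℝ) :
    ∑ j ∈ s, (tok 0 0 0 0 (f j) 0 0 : TokIdx d A → ℝ) = tok 0 0 0 0 (∑ j ∈ s, f j) 0 0 := by
  let F : (Fin 6 → Fin A → Fin d → ℝ) →+ (TokIdx d A → ℝ) :=
    { toFun := fun W => tok 0 0 0 0 W 0 0
      map_zero' := tok_zero
      map_add' := fun W W' => by rw [tok_add]; simp }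
  exact (map_sum F f s).symm

theorem sum_tok_Y {J : Type} (s : Finset J) (f : J → Fin A → ℝ) :
    ∑ j ∈ s, (tok 0 0 0 0 0 (f j) 0 : TokIdx d A → ℝ) = tok 0 0 0 0 0 (∑ j ∈ s, f j) 0 := by
  let F : (Fin A → ℝ) →+ (TokIdx d A → ℝ) :=
    { toFun := fun y => tok 0 0 0 0 0 y 0
      map_zero' := tok_zero
      map_add' := fun W W' => by rw [tok_add]; simp }
  exact (map_sum F f s).symm

theorem sum_single_single (q : Fin 6) (f : Fin A → Fin d → ℝ) :
    ∑ k, (Pi.single q (Pi.single k (f k)) : Fin 6 → Fin A → Fin d → ℝ) = Pi.single q f := by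
  have := map_sum (AddMonoidHom.single (fun _ : Fin 6 => Fin A → Fin d → ℝ) q)
    (fun k => (Pi.single k (f k) : Fin A → Fin d → ℝ)) Finset.univ
  rw [Finset.univ_sum_single f] at this
  exact this.symm

theorem sum_single_single' {J : Type} (s : Finset J) (q : Fin 6) (k : Fin A) (f : J → Fin d → ℝ) :
    ∑ j ∈ s, (Pi.single q (Pi.single k (f j)) : Fin 6 → Fin A → Fin d → ℝ) =
      Pi.single q (Pi.single k (∑ j ∈ s, f j)) :=
  (map_sum ((AddMonoidHom.single (fun _ : Fin 6 => Fin A → Fin d → ℝ) q).comp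
    (AddMonoidHom.single (fun _ : Fin A => Fin d → ℝ) k)) f s).symm

theorem sum_single_scalar {J : Type} (s : Finset J) (k : Fin A) (f : J → ℝ) :
    ∑ j ∈ s, (Pi.single k (f j) : Fin A → ℝ) = Pi.single k (∑ j ∈ s, f j) :=
  (map_sum (AddMonoidHom.single (fun _ : Fin A => ℝ) k) f s).symm

section AttnApply

variable {N : ℕ} (a : Fin N → Fin d → ℝ) (ρ : Fin N → ℝ) (b : Fin N → Fin A → Fin d → ℝ)
  (c : Fin N → Fin A → ℝ) (W : Fin N → Fin 6 → Fin A → Fin d → ℝ) (y : Fin N → Fin A → ℝ)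

theorem idleAttn_apply (H : Fin N → TokIdx d A → ℝ) : (idleAttn d A).apply H = H := by
  funext i; simp [AttnParams.apply, idleAttn]

theorem scaleAttn_apply {T : ℕ} (hT : 1 ≤ T) (hN : N ≤ 2 * T) (q : Fin 6) :
    (scaleAttn d A T q).apply (fun i => tok (a i) (ρ i) (b i) (c i) (W i) (y i) (pos (i + 1))) =
      fun i => tok (a i) (ρ i) (b i) (c i)
        (W i + Pi.single slotScaled ((((i : ℝ) + 1) / (2 * T)) • W i q)) (y i) (pos (i + 1)) := by
  funext i
  have hi := i.2
  have key : ∀ j ∈ Finset.Iic i, relu ((qPos d A T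
        (tok (a i) (ρ i) (b i) (c i) (W i) (y i) (pos (i + 1)))) ⬝ᵥ
      kPos d A (tok (a j) (ρ j) (b j) (c j) (W j) (y j) (pos (j + 1)))) =
      if j = i then ((i : ℝ) + 1) ^ 2 / (2 * T) else 0 := by
    intro j hj
    have hj' : j.1 + 1 ≤ i.1 + 1 := by
      have : j ≤ i := Finset.mem_Iic.1 hj
      omega
    have h1 := relu_position hT (i := i.1 + 1) (j := j.1 + 1) (by omega) hj'
    have h2 : (j.1 + 1 = i.1 + 1) ↔ j = i := by rw [Fin.ext_iff]; omega
    simp only [h2] at h1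
    push_cast at h1
    rw [← h1]
    simp only [qPos, kPos, LinearMap.coe_mk, AddHom.coe_mk, getP_tok, tok_dotProduct]
    rw [Fin.sum_univ_three]
    simp [pos]
    ring_nf
  have head : ∀ m : Fin (A * 2), (1 / ((i : ℝ) + 1)) • ∑ j ∈ Finset.Iic i,
      relu ((((scaleAttn d A T q).Q m).mulVec (tok (a i) (ρ i) (b i) (c i) (W i) (y i)
        (pos (i + 1)))) ⬝ᵥ ((scaleAttn d A T q).K m).mulVec (tok (a j) (ρ j) (b j) (c j) (W j)
          (y j) (pos (j + 1)))) • ((scaleAttn d A T q).V m).mulVec (tok (a j) (ρ j) (b j) (c j)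
            (W j) (y j) (pos (j + 1))) =
      if (finProdFinEquiv.symm m).2 = 0 then tok 0 0 0 0 (Pi.single slotScaled
        (Pi.single (finProdFinEquiv.symm m).1 ((((i : ℝ) + 1) / (2 * T)) •
          W i q (finProdFinEquiv.symm m).1))) 0 0 else 0 := by
    intro m
    simp only [scaleAttn, LinearMap.toMatrix'_mulVec]
    rw [Finset.sum_congr rfl fun j hj => by rw [key j hj]]
    simp only [ite_smul, zero_smul]
    rw [Finset.sum_ite_eq' (Finset.Iic i) i, if_pos (Finset.mem_Iic.2 le_rfl)]
    split_ifs
    · rw [LinearMap.toMatrix'_mulVec, smul_smul]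
      simp only [vCopy, LinearMap.coe_mk, AddHom.coe_mk, getW_tok]
      rw [tok_smul]
      have : 1 / ((i : ℝ) + 1) * (((i : ℝ) + 1) ^ 2 / (2 * T)) = ((i : ℝ) + 1) / (2 * T) := by
        field_simp
      rw [this]
      simp [← Pi.single_smul]
    · simp
  rw [AttnParams.apply, Finset.sum_congr rfl fun m _ => head m, ← finProdFinEquiv.sum_comp,
    Fintype.sum_prod_type]
  simp only [Equiv.symm_apply_apply, Fin.sum_univ_two, if_true, Fin.isValue, one_ne_zero, if_false,
    add_zero]
  rw [← tok_get (tok (a i) _ _ _ _ _ _ + _)]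
  rw [sum_tok_W]
  simp only [getA_add, getA_tok, getR_add, getR_tok, getB_add, getB_tok, getC_add, getC_tok,
    getW_add, getW_tok, getY_add, getY_tok, getP_add, getP_tok, add_zero]
  congr 2
  exact sum_single_single slotScaled fun k => (((i : ℝ) + 1) / (2 * T)) • W i q k

theorem qScaled_dotProduct_kAct (t : ℝ) (k : Fin A) (h h' : TokIdx d A → ℝ) :
    qScaled t k h ⬝ᵥ kAct d A h' = t * (getW h slotScaled k ⬝ᵥ getA h') := by
  simp only [qScaled, kAct, LinearMap.coe_mk, AddHom.coe_mk, tok_dotProduct, getA_tok]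
  simp [dotProduct, Finset.mul_sum, mul_assoc]

theorem gramAttn_apply :
    (gramAttn d A).apply (fun i => tok (a i) (ρ i) (b i) (c i) (W i) (y i) (pos (i + 1))) =
      fun i => tok (a i) (ρ i) (b i) (c i)
        (W i + Pi.single slotGram fun k => (1 / ((i : ℝ) + 1)) •
          ∑ j ∈ Finset.Iic i, (W i slotScaled k ⬝ᵥ a j) • a j) (y i) (pos (i + 1)) := by
  funext i
  rw [AttnParams.apply, ← finProdFinEquiv.sum_comp, Fintype.sum_prod_type]
  simp only [gramAttn, LinearMap.toMatrix'_mulVec, Equiv.symm_apply_apply,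
    qScaled_dotProduct_kAct, getW_tok, getA_tok, Fin.sum_univ_two]
  have head : ∀ k : Fin A,
      (1 / ((i : ℝ) + 1)) • (∑ j ∈ Finset.Iic i, relu (headSign 0 * (W i slotScaled k ⬝ᵥ a j)) •
        vGram (headSign 0) k (tok (a j) (ρ j) (b j) (c j) (W j) (y j) (pos (j + 1)))) +
      (1 / ((i : ℝ) + 1)) • (∑ j ∈ Finset.Iic i, relu (headSign 1 * (W i slotScaled k ⬝ᵥ a j)) •
        vGram (headSign 1) k (tok (a j) (ρ j) (b j) (c j) (W j) (y j) (pos (j + 1)))) =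
      tok 0 0 0 0 (Pi.single slotGram (Pi.single k ((1 / ((i : ℝ) + 1)) •
          ∑ j ∈ Finset.Iic i, (W i slotScaled k ⬝ᵥ a j) • a j))) 0 0 := by
    intro k
    rw [← smul_add, ← Finset.sum_add_distrib]
    have h1 : ∀ j ∈ Finset.Iic i, relu (headSign 0 * (W i slotScaled k ⬝ᵥ a j)) •
        vGram (headSign 0) k (tok (a j) (ρ j) (b j) (c j) (W j) (y j) (pos (j + 1))) +
        relu (headSign 1 * (W i slotScaled k ⬝ᵥ a j)) •
        vGram (headSign 1) k (tok (a j) (ρ j) (b j) (c j) (W j) (y j) (pos (j + 1))) =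
        tok 0 0 0 0 (Pi.single slotGram (Pi.single k ((W i slotScaled k ⬝ᵥ a j) • a j))) 0 0 := by
      intro j _
      simp only [vGram, LinearMap.coe_mk, AddHom.coe_mk, getA_tok, tok_smul, tok_add]
      rw [← Pi.single_smul, ← Pi.single_smul, ← Pi.single_smul, ← Pi.single_smul, ← Pi.single_add,
        ← Pi.single_add, smul_smul, smul_smul]
      have h2 : relu (headSign 0 * (W i slotScaled k ⬝ᵥ a j)) * headSign 0 +
          relu (headSign 1 * (W i slotScaled k ⬝ᵥ a j)) * headSign 1 =
          W i slotScaled k ⬝ᵥ a j := by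
        simpa [headSign, sub_eq_add_neg] using relu_sub_relu_neg (W i slotScaled k ⬝ᵥ a j)
      rw [← add_smul (_ * headSign 0), h2]
      simp
    rw [Finset.sum_congr rfl h1, sum_tok_W, tok_smul, sum_single_single']
    simp [← Pi.single_smul]
  rw [Finset.sum_congr rfl fun k _ => head k, sum_tok_W, tok_add, sum_single_single]
  simp

theorem rewardAttn_apply :
    (rewardAttn d A).apply (fun i => tok (a i) (ρ i) (b i) (c i) (W i) (y i) (pos (i + 1))) =
      fun i => tok (a i) (ρ i) (b i) (c i) (W i) (y i + fun k => (1 / ((i : ℝ) + 1)) *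
          ∑ j ∈ Finset.Iic i, (W i slotScaled k ⬝ᵥ a j) * ρ j) (pos (i + 1)) := by
  funext i
  rw [AttnParams.apply, ← finProdFinEquiv.sum_comp, Fintype.sum_prod_type]
  simp only [rewardAttn, LinearMap.toMatrix'_mulVec, Equiv.symm_apply_apply,
    qScaled_dotProduct_kAct, getW_tok, getA_tok, Fin.sum_univ_two]
  have head : ∀ k : Fin A,
      (1 / ((i : ℝ) + 1)) • (∑ j ∈ Finset.Iic i, relu (headSign 0 * (W i slotScaled k ⬝ᵥ a j)) •
        vReward (headSign 0) k (tok (a j) (ρ j) (b j) (c j) (W j) (y j) (pos (j + 1)))) +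
      (1 / ((i : ℝ) + 1)) • (∑ j ∈ Finset.Iic i, relu (headSign 1 * (W i slotScaled k ⬝ᵥ a j)) •
        vReward (headSign 1) k (tok (a j) (ρ j) (b j) (c j) (W j) (y j) (pos (j + 1)))) =
      tok 0 0 0 0 0 (Pi.single k ((1 / ((i : ℝ) + 1)) *
          ∑ j ∈ Finset.Iic i, (W i slotScaled k ⬝ᵥ a j) * ρ j)) 0 := by
    intro k
    rw [← smul_add, ← Finset.sum_add_distrib]
    have h1 : ∀ j ∈ Finset.Iic i, relu (headSign 0 * (W i slotScaled k ⬝ᵥ a j)) •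
        vReward (headSign 0) k (tok (a j) (ρ j) (b j) (c j) (W j) (y j) (pos (j + 1))) +
        relu (headSign 1 * (W i slotScaled k ⬝ᵥ a j)) •
        vReward (headSign 1) k (tok (a j) (ρ j) (b j) (c j) (W j) (y j) (pos (j + 1))) =
        tok 0 0 0 0 0 (Pi.single k ((W i slotScaled k ⬝ᵥ a j) * ρ j)) 0 := by
      intro j _
      simp only [vReward, LinearMap.coe_mk, AddHom.coe_mk, getR_tok, tok_smul, tok_add]
      rw [← Pi.single_smul, ← Pi.single_smul, ← Pi.single_add, smul_eq_mul, smul_eq_mul,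
        ← mul_assoc, ← mul_assoc]
      have h2 : relu (headSign 0 * (W i slotScaled k ⬝ᵥ a j)) * headSign 0 +
          relu (headSign 1 * (W i slotScaled k ⬝ᵥ a j)) * headSign 1 =
          W i slotScaled k ⬝ᵥ a j := by
        simpa [headSign, sub_eq_add_neg] using relu_sub_relu_neg (W i slotScaled k ⬝ᵥ a j)
      rw [← add_mul (_ * headSign 0), h2]
      simp
    rw [Finset.sum_congr rfl h1, sum_tok_Y, tok_smul, sum_single_scalar]
    simp [← Pi.single_smul]
  rw [Finset.sum_congr rfl fun k _ => head k, sum_tok_Y, tok_add, Finset.univ_sum_single]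
  simp

end AttnApply

end

end TSTransformer

namespace TSTransformer

noncomputable section

variable {d A : ℕ}

/-! ### MLP layers -/

/-- Hidden neurons of the MLP layers: a pair of neurons of opposite signs for every coordinate of
the action set block (`none`) and of the working slots, and `M₀` neurons per action for the sums of
ReLUs. -/
abbrev HidIdx (d A M₀ : ℕ) : Type := (Option (Fin 6) × Fin A × Fin d × Fin 2) ⊕ (Fin A × Fin M₀)

/-- The number of hidden neurons. -/
def numHid (d A M₀ : ℕ) : ℕ := Fintype.card (HidIdx d A M₀)

/-- An enumeration of the hidden neurons. -/
def hidEquiv (d A M₀ : ℕ) : HidIdx d A M₀ ≃ Fin (numHid d A M₀) := Fintype.equivFin _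

/-- The action set block (`none`) and the working slots of a token. -/
def src (h : TokIdx d A → ℝ) (o : Option (Fin 6)) : Fin A → Fin d → ℝ := o.elim (getB h) (getW h)

theorem src_add (h h' : TokIdx d A → ℝ) (o : Option (Fin 6)) (k : Fin A) (l : Fin d) :
    src (h + h') o k l = src h o k l + src h' o k l := by cases o <;> rfl

theorem src_smul (t : ℝ) (h : TokIdx d A → ℝ) (o : Option (Fin 6)) (k : Fin A) (l : Fin d) :
    src (t • h) o k l = t * src h o k l := by cases o <;> rfl

/-- The first map of a mixing layer: all coordinates of the action set block and the slots, with
both signs. -/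
def mixIn (d A M₀ : ℕ) : (TokIdx d A → ℝ) →ₗ[ℝ] (Fin (numHid d A M₀) → ℝ) where
  toFun h u := Sum.elim (fun q => headSign q.2.2.2 * src h q.1 q.2.1 q.2.2.1) (fun _ => 0)
    ((hidEquiv d A M₀).symm u)
  map_add' h h' := by
    funext u
    rcases hu : (hidEquiv d A M₀).symm u with q | q <;> simp [hu, src_add, mul_add]
  map_smul' t h := by
    funext u
    rcases hu : (hidEquiv d A M₀).symm u with q | q <;> simp [hu, src_smul, mul_left_comm]

/-- The second map of a mixing layer, with coefficients `B`. -/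
def mixOut (d A M₀ : ℕ) (B : Fin 6 → Option (Fin 6) → ℝ) :
    (Fin (numHid d A M₀) → ℝ) →ₗ[ℝ] (TokIdx d A → ℝ) where
  toFun u := tok 0 0 0 0 (fun q k l => ∑ o, B q o *
    (u (hidEquiv d A M₀ (Sum.inl (o, k, l, 0))) - u (hidEquiv d A M₀ (Sum.inl (o, k, l, 1))))) 0 0
  map_add' u u' := by
    rw [tok_add]
    congr 1 <;> simp [-Fintype.sum_option]
    funext q k l
    simp only [Pi.add_apply]
    rw [← Finset.sum_add_distrib]
    refine Finset.sum_congr rfl fun o _ => ?_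
    ring
  map_smul' t u := by
    rw [tok_smul]
    congr 1 <;> simp [-Fintype.sum_option]
    funext q k l
    simp only [Pi.smul_apply, smul_eq_mul]
    rw [Finset.mul_sum]
    refine Finset.sum_congr rfl fun o _ => ?_
    ring

/-- The mixing layer: adds to every slot a fixed linear combination of the action set block and the
slots. -/
def mixMLP (d A M₀ : ℕ) (B : Fin 6 → Option (Fin 6) → ℝ) :
    MLPParams (TokIdx d A) (numHid d A M₀) where
  W₁ := LinearMap.toMatrix' (mixIn d A M₀)
  W₂ := LinearMap.toMatrix' (mixOut d A M₀ B)

theorem mixMLP_apply {M₀ N : ℕ} (B : Fin 6 → Option (Fin 6) → ℝ) (H : Fin N → TokIdx d A → ℝ) :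
    (mixMLP d A M₀ B).apply H = fun i => H i +
      tok 0 0 0 0 (fun q => ∑ o, B q o • src (H i) o) 0 0 := by
  funext i
  simp only [MLPParams.apply, mixMLP, LinearMap.toMatrix'_mulVec]
  congr 1
  simp only [mixOut, mixIn, LinearMap.coe_mk, AddHom.coe_mk, Equiv.symm_apply_apply, Sum.elim_inl]
  congr 1
  funext q k l
  simp only [Finset.sum_apply, Pi.smul_apply, smul_eq_mul]
  refine Finset.sum_congr rfl fun o _ => ?_
  congr 1
  simpa [headSign] using relu_sub_relu_neg (src (H i) o k l)

/-- The first map of the read-out layer: the affine forms of the sums of ReLUs, evaluated at the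
slot `slotSqrt` and the scalars. -/
def readIn {M₀ : ℕ} (w : Fin A → Fin M₀ → Feat d A → ℝ) (β : Fin A → Fin M₀ → ℝ) :
    (TokIdx d A → ℝ) →ₗ[ℝ] (Fin (numHid d A M₀) → ℝ) where
  toFun h u := Sum.elim (fun _ => 0) (fun q =>
    (∑ i, w q.1 q.2 i * Sum.elim (fun p : Fin A × Fin d => getW h slotSqrt p.1 p.2) (getY h) i) +
      β q.1 q.2 * getP h 2) ((hidEquiv d A M₀).symm u)
  map_add' h h' := by
    funext u
    rcases hu : (hidEquiv d A M₀).symm u with q | q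
    · simp [hu]
    · simp [hu, mul_add, Finset.sum_add_distrib]
      ring
  map_smul' t h := by
    funext u
    rcases hu : (hidEquiv d A M₀).symm u with q | q
    · simp [hu]
    · simp [hu, mul_add, Finset.mul_sum, mul_left_comm t]

/-- The second map of the read-out layer. -/
def readOut {M₀ : ℕ} (cf : Fin A → Fin M₀ → ℝ) :
    (Fin (numHid d A M₀) → ℝ) →ₗ[ℝ] (TokIdx d A → ℝ) where
  toFun u := tok 0 0 0 (fun k => ∑ m, cf k m * u (hidEquiv d A M₀ (Sum.inr (k, m)))) 0 0 0
  map_add' u u' := by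
    rw [tok_add]
    congr 1 <;> simp
    funext k
    simp [mul_add, Finset.sum_add_distrib]
  map_smul' t u := by
    rw [tok_smul]
    congr 1 <;> simp
    funext k
    simp [Finset.mul_sum, mul_left_comm t]

/-- The read-out layer: adds to the policy block the sums of ReLUs of the features. -/
def readMLP {M₀ : ℕ} (cf : Fin A → Fin M₀ → ℝ) (w : Fin A → Fin M₀ → Feat d A → ℝ)
    (β : Fin A → Fin M₀ → ℝ) : MLPParams (TokIdx d A) (numHid d A M₀) where
  W₁ := LinearMap.toMatrix' (readIn w β)
  W₂ := LinearMap.toMatrix' (readOut cf)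

theorem readMLP_apply {M₀ N : ℕ} (cf : Fin A → Fin M₀ → ℝ) (w : Fin A → Fin M₀ → Feat d A → ℝ)
    (β : Fin A → Fin M₀ → ℝ) (H : Fin N → TokIdx d A → ℝ) :
    (readMLP cf w β).apply H = fun i => H i +
      tok 0 0 0 (fun k => ∑ m, cf k m * relu ((∑ i', w k m i' *
        Sum.elim (fun p : Fin A × Fin d => getW (H i) slotSqrt p.1 p.2) (getY (H i)) i') +
          β k m * getP (H i) 2)) 0 0 0 := by
  funext i
  simp only [MLPParams.apply, readMLP, LinearMap.toMatrix'_mulVec]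
  congr 1
  simp only [readOut, readIn, LinearMap.coe_mk, AddHom.coe_mk, Equiv.symm_apply_apply, Sum.elim_inr]

theorem norm_sq_hidden {M₀ : ℕ} (u : Fin (numHid d A M₀) → ℝ) :
    ‖WithLp.toLp 2 u‖ ^ 2 = (∑ o, ∑ k, ∑ l, ((u (hidEquiv d A M₀ (Sum.inl (o, k, l, 0)))) ^ 2 +
      (u (hidEquiv d A M₀ (Sum.inl (o, k, l, 1)))) ^ 2)) +
      ∑ k, ∑ m, u (hidEquiv d A M₀ (Sum.inr (k, m))) ^ 2 := by
  rw [norm_toLp_sq, dotProduct, ← (hidEquiv d A M₀).sum_comp, Fintype.sum_sum_type]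
  simp only [Fintype.sum_prod_type, Fin.sum_univ_two, sq]

theorem norm_mixIn_le (d A M₀ : ℕ) : ‖LinearMap.toMatrix' (mixIn d A M₀)‖ ≤ 2 := by
  refine norm_toMatrix'_le _ zero_le_two fun h => ?_
  rw [norm_sq_hidden]
  simp only [mixIn, LinearMap.coe_mk, AddHom.coe_mk, Equiv.symm_apply_apply, Sum.elim_inl,
    Sum.elim_inr, mul_pow, headSign_sq, one_mul]
  have h1 := sum_getB_add_getW_sq_le h
  rw [Fintype.sum_option]
  have h2 : ∀ o : Option (Fin 6), ∑ k, ∑ l, (src h o k l ^ 2 + src h o k l ^ 2) =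
      2 * ∑ k, ∑ l, src h o k l ^ 2 := by
    intro o
    simp only [← two_mul, Finset.mul_sum]
  rw [h2, Finset.sum_congr rfl fun q _ => h2 (some q), ← Finset.mul_sum]
  simp only [src, Option.elim]
  have h3 := sq_nonneg ‖WithLp.toLp 2 h‖
  simp
  linarith

theorem norm_mixOut_le (M₀ : ℕ) {B : Fin 6 → Option (Fin 6) → ℝ} {β : ℝ} (hβ : 0 ≤ β)
    (hB : ∀ q o, |B q o| ≤ β) : ‖LinearMap.toMatrix' (mixOut d A M₀ B)‖ ≤ 10 * β := by
  refine norm_toMatrix'_le _ (by positivity) fun u => ?_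
  have hterm : ∀ (q : Fin 6) (k : Fin A) (l : Fin d), (∑ o, B q o *
      (u (hidEquiv d A M₀ (Sum.inl (o, k, l, 0))) -
        u (hidEquiv d A M₀ (Sum.inl (o, k, l, 1))))) ^ 2 ≤
      14 * β ^ 2 * ∑ o, ((u (hidEquiv d A M₀ (Sum.inl (o, k, l, 0)))) ^ 2 +
      (u (hidEquiv d A M₀ (Sum.inl (o, k, l, 1)))) ^ 2) := by
    intro q k l
    refine (sq_sum_le_card_mul_sum_sq).trans ?_
    have hc : ((Finset.univ : Finset (Option (Fin 6))).card : ℝ) = 7 := by simp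
    rw [hc, show (14 : ℝ) * β ^ 2 = 7 * (2 * β ^ 2) by ring, mul_assoc, Finset.mul_sum _ _ (2 * β ^ 2)]
    refine mul_le_mul_of_nonneg_left (Finset.sum_le_sum fun o _ => ?_) (by norm_num)
    rw [mul_pow, mul_comm 2 (β ^ 2), mul_assoc]
    refine mul_le_mul (sq_le_sq' (by linarith [abs_le.1 (hB q o)]) (abs_le.1 (hB q o)).2) ?_
      (sq_nonneg _) (sq_nonneg _)
    nlinarith [sq_nonneg (u (hidEquiv d A M₀ (Sum.inl (o, k, l, 0))) +
      u (hidEquiv d A M₀ (Sum.inl (o, k, l, 1))))]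
  have hrest : 0 ≤ ∑ k, ∑ m, u (hidEquiv d A M₀ (Sum.inr (k, m))) ^ 2 := by positivity
  have hmain : ‖WithLp.toLp 2 (mixOut d A M₀ B u)‖ ^ 2 ≤ 84 * β ^ 2 *
      ∑ o, ∑ k, ∑ l, ((u (hidEquiv d A M₀ (Sum.inl (o, k, l, 0)))) ^ 2 +
      (u (hidEquiv d A M₀ (Sum.inl (o, k, l, 1)))) ^ 2) := by
    rw [norm_sq_eq]
    simp only [mixOut, LinearMap.coe_mk, AddHom.coe_mk, getA_tok, getR_tok, getB_tok, getC_tok,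
      getW_tok, getY_tok, getP_tok, Pi.zero_apply, ne_eq, OfNat.ofNat_ne_zero, not_false_eq_true,
      zero_pow, Finset.sum_const_zero, zero_add, add_zero]
    refine (Finset.sum_le_sum fun q _ => Finset.sum_le_sum fun k _ => Finset.sum_le_sum fun l _ =>
      hterm q k l).trans (le_of_eq ?_)
    rw [Finset.sum_const, Finset.card_univ, Fintype.card_fin, nsmul_eq_mul]
    simp only [← Finset.mul_sum]
    rw [← mul_assoc]
    congr 1
    · push_cast; ring
    · exact (Finset.sum_congr rfl fun k _ => Finset.sum_comm).trans Finset.sum_comm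
  rw [norm_sq_hidden]
  have h3 : 0 ≤ ∑ o, ∑ k, ∑ l, ((u (hidEquiv d A M₀ (Sum.inl (o, k, l, 0)))) ^ 2 +
      (u (hidEquiv d A M₀ (Sum.inl (o, k, l, 1)))) ^ 2) := by positivity
  nlinarith [sq_nonneg β, mul_nonneg (sq_nonneg β) h3, mul_nonneg (sq_nonneg β) hrest]

theorem norm_readIn_le {M₀ : ℕ} {w : Fin A → Fin M₀ → Feat d A → ℝ} {β : Fin A → Fin M₀ → ℝ}
    (hw : ∀ k m, ∑ i, |w k m i| + |β k m| ≤ 1) :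
    ‖LinearMap.toMatrix' (readIn w β)‖ ≤ √(M₀ * A) := by
  refine norm_toMatrix'_le _ (by positivity) fun h => ?_
  rw [norm_sq_hidden, Real.sq_sqrt (by positivity)]
  simp only [readIn, LinearMap.coe_mk, AddHom.coe_mk, Equiv.symm_apply_apply, Sum.elim_inl,
    Sum.elim_inr]
  have hterm : ∀ k m, ((∑ i, w k m i *
      Sum.elim (fun p : Fin A × Fin d => getW h slotSqrt p.1 p.2) (getY h) i) +
      β k m * getP h 2) ^ 2 ≤ ‖WithLp.toLp 2 h‖ ^ 2 := by
    intro k m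
    have habs : ∀ i, |h i| ≤ ‖WithLp.toLp 2 h‖ := abs_apply_le_norm h
    rw [← sq_abs]
    refine pow_le_pow_left₀ (abs_nonneg _) ?_ 2
    calc _ ≤ (∑ i, |w k m i| * ‖WithLp.toLp 2 h‖) + |β k m| * ‖WithLp.toLp 2 h‖ := by
          refine (abs_add_le _ _).trans (add_le_add ?_ ?_)
          · refine (Finset.abs_sum_le_sum_abs _ _).trans (Finset.sum_le_sum fun i _ => ?_)
            rw [abs_mul]
            refine mul_le_mul_of_nonneg_left ?_ (abs_nonneg _)
            rcases i with i | i <;> exact habs _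
          · rw [abs_mul]
            exact mul_le_mul_of_nonneg_left (habs _) (abs_nonneg _)
      _ ≤ 1 * ‖WithLp.toLp 2 h‖ := by
          rw [← Finset.sum_mul, ← add_mul]
          exact mul_le_mul_of_nonneg_right (hw k m) (norm_nonneg _)
      _ = _ := one_mul _
  have h2 := Finset.sum_le_sum fun (k : Fin A) (_ : k ∈ Finset.univ) =>
    Finset.sum_le_sum fun (m : Fin M₀) (_ : m ∈ Finset.univ) => hterm k m
  simp only [Finset.sum_const, Finset.card_univ, Fintype.card_fin, nsmul_eq_mul] at h2
  simp only [ne_eq, OfNat.ofNat_ne_zero, not_false_eq_true, zero_pow, add_zero,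
    Finset.sum_const_zero, zero_add]
  linarith

theorem norm_readOut_le {M₀ : ℕ} {cf : Fin A → Fin M₀ → ℝ} {C₀ : ℝ} (hC : 0 ≤ C₀)
    (hcf : ∀ k, ∑ m, |cf k m| ≤ C₀) :
    ‖LinearMap.toMatrix' (readOut (d := d) cf)‖ ≤ C₀ := by
  refine norm_toMatrix'_le _ hC fun u => ?_
  rw [norm_sq_eq, norm_sq_hidden]
  simp only [readOut, LinearMap.coe_mk, AddHom.coe_mk, getA_tok, getR_tok, getB_tok, getC_tok,
    getW_tok, getY_tok, getP_tok, Pi.zero_apply, ne_eq, OfNat.ofNat_ne_zero, not_false_eq_true,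
    zero_pow, Finset.sum_const_zero, zero_add, add_zero]
  have hterm : ∀ k, (∑ m, cf k m * u (hidEquiv d A M₀ (Sum.inr (k, m)))) ^ 2 ≤
      C₀ ^ 2 * ∑ m, u (hidEquiv d A M₀ (Sum.inr (k, m))) ^ 2 := by
    intro k
    refine (Finset.sum_mul_sq_le_sq_mul_sq _ _ _).trans ?_
    refine mul_le_mul_of_nonneg_right ?_ (by positivity)
    calc ∑ m, cf k m ^ 2 = ∑ m, |cf k m| ^ 2 := by simp
      _ ≤ (∑ m, |cf k m|) ^ 2 := Finset.sum_sq_le_sq_sum_of_nonneg (fun _ _ => abs_nonneg _)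
      _ ≤ C₀ ^ 2 := pow_le_pow_left₀ (by positivity) (hcf k) 2
  refine (Finset.sum_le_sum fun k _ => hterm k).trans ?_
  rw [← Finset.mul_sum]
  refine mul_le_mul_of_nonneg_left ?_ (sq_nonneg _)
  refine le_add_of_nonneg_left (by positivity)

end

end TSTransformer

namespace TSTransformer

noncomputable section

variable {d A : ℕ}

/-! ### The transformer and its forward pass -/

/-- The contents of the working slots. -/
def slots (v p x w s g : Fin A → Fin d → ℝ) : Fin 6 → Fin A → Fin d → ℝ := ![v, p, x, w, s, g]

/-- The mixing coefficients that load the action set into the slot of the current vector. -/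
def loadMix : Fin 6 → Option (Fin 6) → ℝ :=
  fun q o => o.elim (if q = 0 then 1 else 0) fun _ => 0

/-- The mixing coefficients of one step of the Chebyshev recursion: with `v`, `p` the current and the
previous vector and `g` the contents of the Gram slot, `v` becomes `u (e v - f g) - p`, `p` becomes
`v`, the two accumulators are increased by `ξ v` and `ω v`, and the scratch slots are cleared. -/
def iterMix (u e f ξ ω : ℝ) : Fin 6 → Option (Fin 6) → ℝ :=
  fun q o => o.elim 0 fun q' => (![![u * e - 1, -1, 0, 0, 0, -(u * f)], ![1, -1, 0, 0, 0, 0],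
    ![ξ, 0, 0, 0, 0, 0], ![ω, 0, 0, 0, 0, 0], ![0, 0, 0, 0, -1, 0],
    ![0, 0, 0, 0, 0, -1]] : Fin 6 → Fin 6 → ℝ) q q'

/-- The data that determine the transformer: the horizon, bounds on the spectrum of `Σ`, the number of
Chebyshev steps, the coefficients of the two Chebyshev expansions, and the sums of ReLUs. -/
structure TSData (d A M₀ : ℕ) where
  T : ℕ
  m : ℝ
  Mx : ℝ
  N : ℕ
  ξ : ℕ → ℝ
  ω : ℕ → ℝ
  cf : Fin A → Fin M₀ → ℝ
  w : Fin A → Fin M₀ → Feat d A → ℝ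
  β : Fin A → Fin M₀ → ℝ

namespace TSData

variable {M₀ : ℕ} (D : TSData d A M₀)

/-- The mixing coefficients of the `j`-th step. The step from `T_0` to `T_1` has half the usual
weight, as the vector preceding `T_0` is taken to be zero. -/
def stepMix (j : ℕ) : Fin 6 → Option (Fin 6) → ℝ :=
  iterMix (if j = 0 then 1 / 2 else 1)
    ((1 + rate D.m D.Mx ^ 2 - D.Mx⁻¹ * D.m) / rate D.m D.Mx)
    (2 * D.T * D.Mx⁻¹ / rate D.m D.Mx) (D.ξ j) (D.ω j)

/-- The attention part of the layers: a loading layer, then for each Chebyshev step a scaling layer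
and a Gram layer, then the scaling and the reward layer of the posterior means. -/
def layerAttn (l : ℕ) : AttnParams (TokIdx d A) (A * 2) :=
  if l = 0 then idleAttn d A else if l = 2 * D.N + 4 then rewardAttn d A
  else if l = 2 * D.N + 3 then scaleAttn d A D.T slotInv
  else if l % 2 = 1 then scaleAttn d A D.T slotCur else gramAttn d A

/-- The MLP part of the layers. -/
def layerMLP (l : ℕ) : MLPParams (TokIdx d A) (numHid d A M₀) :=
  if l = 0 then mixMLP d A M₀ loadMix else if l = 2 * D.N + 4 then readMLP D.cf D.w D.β
  else if l % 2 = 1 then mixMLP d A M₀ 0 else mixMLP d A M₀ (D.stepMix (l / 2 - 1))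

/-- The transformer. -/
def params : TFParams (TokIdx d A) (2 * D.N + 5) (A * 2) (numHid d A M₀) where
  attn l := D.layerAttn l
  mlp l := D.layerMLP l

end TSData

theorem mixMLP_apply_tok {M₀ n : ℕ} (B : Fin 6 → Option (Fin 6) → ℝ) (a : Fin n → Fin d → ℝ)
    (ρ : Fin n → ℝ) (b : Fin n → Fin A → Fin d → ℝ) (c : Fin n → Fin A → ℝ)
    (W : Fin n → Fin 6 → Fin A → Fin d → ℝ) (y : Fin n → Fin A → ℝ) (P : Fin n → Fin 3 → ℝ) :
    (mixMLP d A M₀ B).apply (fun i => tok (a i) (ρ i) (b i) (c i) (W i) (y i) (P i)) =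
      fun i => tok (a i) (ρ i) (b i) (c i)
        (W i + fun q => B q none • b i + ∑ q', B q (some q') • W i q') (y i) (P i) := by
  rw [mixMLP_apply]
  funext i
  rw [tok_add]
  simp [src]

theorem mixMLP_zero_apply {M₀ n : ℕ} (H : Fin n → TokIdx d A → ℝ) :
    (mixMLP d A M₀ 0).apply H = H := by
  rw [mixMLP_apply]
  funext i
  have : (fun q : Fin 6 => ∑ o, (0 : Fin 6 → Option (Fin 6) → ℝ) q o • src (H i) o) = 0 := by
    funext q; simp
  rw [this, tok_zero, add_zero]

theorem slots_load (b : Fin A → Fin d → ℝ) :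
    (slots 0 0 0 0 0 0 + fun q => loadMix q none • b +
      ∑ q', loadMix q (some q') • slots 0 0 0 0 0 0 q') = slots b 0 0 0 0 0 := by
  funext q
  fin_cases q <;> simp [slots, loadMix]

theorem slots_iter (u e f ξ ω : ℝ) (b v p x w s g : Fin A → Fin d → ℝ) :
    (slots v p x w s g + fun q => iterMix u e f ξ ω q none • b +
      ∑ q', iterMix u e f ξ ω q (some q') • slots v p x w s g q') =
      slots (u • (e • v - f • g) - p) v (x + ξ • v) (w + ω • v) 0 0 := by
  funext q
  fin_cases q <;> simp [slots, iterMix, Fin.sum_univ_six]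
  · module

theorem slots_add_scaled (v p x w s g z : Fin A → Fin d → ℝ) :
    slots v p x w s g + Pi.single slotScaled z = slots v p x w (s + z) g := by
  funext q
  fin_cases q <;> simp [slots, Pi.single_apply] <;> intro h <;> exact absurd h (by decide)

theorem slots_add_gram (v p x w s g z : Fin A → Fin d → ℝ) :
    slots v p x w s g + Pi.single slotGram z = slots v p x w s (g + z) := by
  funext q
  fin_cases q <;> simp [slots, Pi.single_apply] <;> intro h <;> exact absurd h (by decide)

theorem norm_le_card_mul {ι : Type} [Fintype ι] {v : ι → ℝ} {B : ℝ}
    (h : ∀ i, |v i| ≤ B) : ‖WithLp.toLp 2 v‖ ≤ Fintype.card ι * B := by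
  rcases isEmpty_or_nonempty ι with hι | ⟨⟨i₀⟩⟩
  · have : WithLp.toLp 2 v = 0 := Subsingleton.elim _ _
    simp [this]
  have hB : 0 ≤ B := (abs_nonneg _).trans (h i₀)
  have hc : (1 : ℝ) ≤ Fintype.card ι := by
    exact_mod_cast Fintype.card_pos_iff.2 ⟨i₀⟩
  refine le_of_sq_le_sq ?_ (by positivity)
  rw [EuclideanSpace.real_norm_sq_eq]
  calc ∑ i, v i ^ 2 ≤ ∑ _i : ι, B ^ 2 := Finset.sum_le_sum fun i _ => by
        rw [← sq_abs]; exact pow_le_pow_left₀ (abs_nonneg _) (h i) 2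
    _ = Fintype.card ι * B ^ 2 := by simp
    _ ≤ (Fintype.card ι * B) ^ 2 := by
        rw [mul_pow]
        exact mul_le_mul_of_nonneg_right (by nlinarith) (sq_nonneg B)

theorem clip_eq_self {n : ℕ} {R B : ℝ} {H : Fin n → TokIdx d A → ℝ}
    (hR : Fintype.card (TokIdx d A) * B ≤ R) (h : ∀ i l, |H i l| ≤ B) : clip R H = H := by
  funext i
  exact if_pos ((norm_le_card_mul (h i)).trans hR)

theorem abs_tok_le {B : ℝ} {a : Fin d → ℝ} {ρ : ℝ} {b : Fin A → Fin d → ℝ} {c : Fin A → ℝ}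
    {W : Fin 6 → Fin A → Fin d → ℝ} {y : Fin A → ℝ} {P : Fin 3 → ℝ} (ha : ∀ l, |a l| ≤ B)
    (hρ : |ρ| ≤ B) (hb : ∀ k l, |b k l| ≤ B) (hc : ∀ k, |c k| ≤ B) (hW : ∀ q k l, |W q k l| ≤ B)
    (hy : ∀ k, |y k| ≤ B) (hP : ∀ l, |P l| ≤ B) (i : TokIdx d A) :
    |tok a ρ b c W y P i| ≤ B := by
  rcases i with (i | i) | i | i | i | i
  · exact ha i
  · exact hρ
  · exact hb i.1 i.2
  · exact hc i
  · obtain ⟨u, rfl⟩ := (freeEquiv d A).surjective i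
    rcases u with ⟨q, k, l⟩ | k
    · simpa [tok] using hW q k l
    · simpa [tok] using hy k
  · exact hP i

/-- The Gram matrix of the actions up to position `i`. -/
def gramAt {n : ℕ} (a : Fin n → Fin d → ℝ) (i : Fin n) : Matrix (Fin d) (Fin d) ℝ :=
  ∑ j ∈ Finset.Iic i, Matrix.vecMulVec (a j) (a j)

theorem gramAt_mulVec {n : ℕ} (a : Fin n → Fin d → ℝ) (i : Fin n) (v : Fin d → ℝ) :
    (gramAt a i).mulVec v = ∑ j ∈ Finset.Iic i, (v ⬝ᵥ a j) • a j := by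
  rw [gramAt, Matrix.sum_mulVec]
  refine Finset.sum_congr rfl fun j _ => ?_
  rw [Matrix.vecMulVec_mulVec, dotProduct_comm]
  simp

/-- Inputs of the transformer for which no intermediate token has a coordinate that exceeds `B`. -/
structure Bounded {M₀ n : ℕ} (D : TSData d A M₀) (a : Fin n → Fin d → ℝ) (ρ : Fin n → ℝ)
    (b : Fin n → Fin A → Fin d → ℝ) (Ba ρm X C₀ B : ℝ) : Prop where
  one_le_T : 1 ≤ D.T
  length_le : n ≤ 2 * D.T
  m_pos : 0 < D.m
  m_le : D.m ≤ D.Mx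
  spectrum : ∀ i, SpectrumIn (D.m • (1 : Matrix (Fin d) (Fin d) ℝ) + gramAt a i) D.m D.Mx
  norm_a : ∀ i, ‖WithLp.toLp 2 (a i)‖ ≤ Ba
  abs_ρ : ∀ i, |ρ i| ≤ ρm
  norm_b : ∀ i k, ‖WithLp.toLp 2 (b i k)‖ ≤ Ba
  Ba_nonneg : 0 ≤ Ba
  X_nonneg : 0 ≤ X
  abs_ξ : ∀ j ≤ D.N, |D.ξ j| ≤ X
  abs_ω : ∀ j ≤ D.N, |D.ω j| ≤ X
  cf_le : ∀ k, ∑ m, |D.cf k m| ≤ C₀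
  w_le : ∀ k m, ∑ i, |D.w k m i| + |D.β k m| ≤ 1
  one_le : 1 ≤ B
  Ba_le : Ba ≤ B
  ρm_le : ρm ≤ B
  pos_le : (2 * (D.T : ℝ)) ^ 2 ≤ B
  acc_le : (D.N + 1) * X * Ba ≤ B
  y_le : (D.N + 1) * X * Ba * Ba * ρm ≤ B

section Forward

variable {M₀ n : ℕ} (D : TSData d A M₀) (a : Fin n → Fin d → ℝ) (ρ : Fin n → ℝ)
  (b : Fin n → Fin A → Fin d → ℝ)

/-- The `j`-th Chebyshev vectors at position `i`. -/
def chebAt (i : Fin n) (j : ℕ) (k : Fin A) : Fin d → ℝ :=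
  chebVec (chebMatrix (D.m • (1 : Matrix (Fin d) (Fin d) ℝ) + gramAt a i) D.m D.Mx) (b i k) j

/-- The Chebyshev vectors preceding the `j`-th ones, zero for `j = 0`. -/
def chebPrev (i : Fin n) : ℕ → Fin A → Fin d → ℝ
  | 0 => 0
  | j + 1 => chebAt D a b i j

/-- The accumulators before the `j`-th step. -/
def accAt (cf : ℕ → ℝ) (i : Fin n) (j : ℕ) : Fin A → Fin d → ℝ :=
  ∑ j' ∈ Finset.range j, cf j' • chebAt D a b i j'

/-- The tokens before the `j`-th step, with `s` in the scratch slot. -/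
def stepTok (j : ℕ) (s : Fin n → Fin A → Fin d → ℝ) : Fin n → TokIdx d A → ℝ := fun i =>
  tok (a i) (ρ i) (b i) 0 (slots (chebAt D a b i j) (chebPrev D a b i j) (accAt D a b D.ξ i j)
    (accAt D a b D.ω i j) (s i) 0) 0 (pos (i + 1))

/-- The approximate posterior means. -/
def yAt (i : Fin n) (k : Fin A) : ℝ := (1 / ((i : ℝ) + 1)) * ∑ j ∈ Finset.Iic i,
  (((((i : ℝ) + 1) / (2 * D.T)) • accAt D a b D.ω i (D.N + 1)) k ⬝ᵥ a j) * ρ j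

/-- The approximate features of the Thompson sampling probabilities. -/
def featAt (i : Fin n) : Feat d A → ℝ :=
  Sum.elim (fun p => accAt D a b D.ξ i (D.N + 1) p.1 p.2) (yAt D a ρ b i)

/-- The approximate log-probabilities. -/
def logitAt (i : Fin n) (k : Fin A) : ℝ :=
  ∑ m, D.cf k m * relu (∑ i', D.w k m i' * featAt D a ρ b i i' + D.β k m)

theorem hidden_succ (R : ℝ) (H : Fin n → TokIdx d A → ℝ) {l : ℕ} (hl : l < 2 * D.N + 5) :
    D.params.hidden R H (l + 1) =
      clip R ((D.layerMLP l).apply ((D.layerAttn l).apply (D.params.hidden R H l))) := by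
  rw [TFParams.hidden, dif_pos hl]
  rfl

variable {D a ρ b} {Ba ρm X C₀ B : ℝ} (hB : Bounded D a ρ b Ba ρm X C₀ B)

include hB

theorem norm_chebAt_le (i : Fin n) (j : ℕ) (k : Fin A) :
    ‖WithLp.toLp 2 (chebAt D a b i j k)‖ ≤ Ba :=
  ((hB.spectrum i).norm_chebVec_le _ _).trans (hB.norm_b i k)

theorem norm_accAt_le {cf : ℕ → ℝ} (hcf : ∀ j ≤ D.N, |cf j| ≤ X) (i : Fin n) {j : ℕ}
    (hj : j ≤ D.N + 1) (k : Fin A) :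
    ‖WithLp.toLp 2 (accAt D a b cf i j k)‖ ≤ (D.N + 1) * X * Ba := by
  have h1 : WithLp.toLp 2 (accAt D a b cf i j k) =
      ∑ j' ∈ Finset.range j, cf j' • WithLp.toLp 2 (chebAt D a b i j' k) := by
    simp only [accAt, Finset.sum_apply, Pi.smul_apply, WithLp.toLp_sum, WithLp.toLp_smul]
  rw [h1]
  refine (norm_sum_le _ _).trans ?_
  have h2 : ∀ j' ∈ Finset.range j, ‖cf j' • WithLp.toLp 2 (chebAt D a b i j' k)‖ ≤ X * Ba := by
    intro j' hj'
    rw [Finset.mem_range] at hj'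
    rw [norm_smul]
    exact mul_le_mul (hcf j' (by omega)) (norm_chebAt_le hB i j' k) (norm_nonneg _) hB.X_nonneg
  refine (Finset.sum_le_sum h2).trans ?_
  rw [Finset.sum_const, Finset.card_range, nsmul_eq_mul, mul_assoc]
  refine mul_le_mul_of_nonneg_right ?_ (mul_nonneg hB.X_nonneg hB.Ba_nonneg)
  exact_mod_cast hj

theorem abs_pos_le (i : Fin n) (l : Fin 3) : |pos (i + 1) l| ≤ B := by
  have h1 : ((i.1 + 1 : ℕ) : ℝ) ≤ 2 * D.T := by
    have := i.2; have := hB.length_le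
    exact_mod_cast (by omega : i.1 + 1 ≤ 2 * D.T)
  have h2 : (1 : ℝ) ≤ ((i.1 + 1 : ℕ) : ℝ) := by exact_mod_cast (by omega)
  have h3 := hB.pos_le
  have h4 := hB.one_le
  fin_cases l
  · simp only [pos, Fin.zero_eta, Fin.isValue, Matrix.cons_val_zero]
    rw [abs_of_nonneg (by linarith)]
    nlinarith
  · simp only [pos, Fin.mk_one, Fin.isValue, Matrix.cons_val_one, Matrix.cons_val_zero]
    rw [abs_of_nonneg (by positivity)]
    nlinarith
  · simpa [pos] using h4

theorem position_ratio (i : Fin n) : 0 ≤ ((i : ℝ) + 1) / (2 * D.T) ∧ ((i : ℝ) + 1) / (2 * D.T) ≤ 1 := by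
  have h1 : ((i.1 : ℝ) + 1) ≤ 2 * D.T := by
    have := i.2; have := hB.length_le
    exact_mod_cast (by omega : i.1 + 1 ≤ 2 * D.T)
  have h0 : (0 : ℝ) ≤ i := Nat.cast_nonneg _
  exact ⟨by positivity, div_le_one_of_le₀ h1 (by positivity)⟩

theorem abs_stepTok_le {j : ℕ} (hj : j ≤ D.N + 1) {s : Fin n → Fin A → Fin d → ℝ}
    (hs : ∀ i k, ‖WithLp.toLp 2 (s i k)‖ ≤ B) (i : Fin n) (l : TokIdx d A) :
    |stepTok D a ρ b j s i l| ≤ B := by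
  have hB0 : 0 ≤ B := zero_le_one.trans hB.one_le
  refine abs_tok_le (fun l => ((abs_apply_le_norm _ l).trans (hB.norm_a i)).trans hB.Ba_le)
    ((hB.abs_ρ i).trans hB.ρm_le)
    (fun k l => ((abs_apply_le_norm _ l).trans (hB.norm_b i k)).trans hB.Ba_le) (fun k => by simpa using hB0)
    ?_ (fun k => by simpa using hB0) (abs_pos_le hB i) l
  intro q k l
  have hch : ∀ j, |chebAt D a b i j k l| ≤ B := fun j =>
    ((abs_apply_le_norm _ l).trans (norm_chebAt_le hB i j k)).trans hB.Ba_le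
  fin_cases q
  · exact hch j
  · cases j with
    | zero => simpa [slots, chebPrev] using hB0
    | succ j => exact hch j
  · exact ((abs_apply_le_norm _ l).trans (norm_accAt_le hB hB.abs_ξ i hj k)).trans hB.acc_le
  · exact ((abs_apply_le_norm _ l).trans (norm_accAt_le hB hB.abs_ω i hj k)).trans hB.acc_le
  · exact (abs_apply_le_norm _ l).trans (hs i k)
  · simpa [slots] using hB0

theorem norm_scaled_le {v : Fin n → Fin A → Fin d → ℝ} (hv : ∀ i k, ‖WithLp.toLp 2 (v i k)‖ ≤ B)
    (i : Fin n) (k : Fin A) :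
    ‖WithLp.toLp 2 (((((i : ℝ) + 1) / (2 * D.T)) • v i) k)‖ ≤ B := by
  obtain ⟨h0, h1⟩ := position_ratio hB i
  rw [Pi.smul_apply, WithLp.toLp_smul, norm_smul, Real.norm_of_nonneg h0]
  exact (mul_le_of_le_one_left (norm_nonneg _) h1).trans (hv i k)

theorem abs_yAt_le (i : Fin n) (k : Fin A) : |yAt D a ρ b i k| ≤ B := by
  obtain ⟨h0, h1⟩ := position_ratio hB i
  have hi : (0 : ℝ) < (i : ℝ) + 1 := by positivity
  have hterm : ∀ j ∈ Finset.Iic i,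
      |((((((i : ℝ) + 1) / (2 * D.T)) • accAt D a b D.ω i (D.N + 1)) k) ⬝ᵥ a j) * ρ j| ≤ B := by
    intro j _
    rw [abs_mul]
    refine le_trans ?_ hB.y_le
    refine mul_le_mul ((abs_dotProduct_le _ _).trans (mul_le_mul ?_ (hB.norm_a j) (norm_nonneg _)
      ?_)) (hB.abs_ρ j) (abs_nonneg _) ?_
    · rw [Pi.smul_apply, WithLp.toLp_smul, norm_smul, Real.norm_of_nonneg h0]
      exact (mul_le_of_le_one_left (norm_nonneg _) h1).trans
        (norm_accAt_le hB hB.abs_ω i le_rfl k)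
    all_goals have := hB.X_nonneg; have := hB.Ba_nonneg; positivity
  rw [yAt, abs_mul, abs_of_nonneg (by positivity)]
  have h2 := (Finset.abs_sum_le_sum_abs _ _).trans (Finset.sum_le_sum hterm)
  rw [Finset.sum_const, Fin.card_Iic, nsmul_eq_mul] at h2
  push_cast at h2
  rw [one_div, inv_mul_le_iff₀ hi]
  exact h2

theorem abs_featAt_le (i : Fin n) (i' : Feat d A) : |featAt D a ρ b i i'| ≤ B := by
  rcases i' with ⟨k, l⟩ | k
  · exact ((abs_apply_le_norm _ l).trans (norm_accAt_le hB hB.abs_ξ i le_rfl k)).trans hB.acc_le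
  · exact abs_yAt_le hB i k

theorem abs_logitAt_le (i : Fin n) (k : Fin A) : |logitAt D a ρ b i k| ≤ C₀ * B := by
  have hB0 : 0 ≤ B := zero_le_one.trans hB.one_le
  have hin : ∀ m, |∑ i', D.w k m i' * featAt D a ρ b i i' + D.β k m| ≤ B := by
    intro m
    calc _ ≤ (∑ i', |D.w k m i'| * B) + |D.β k m| * B := by
          refine (abs_add_le _ _).trans (add_le_add ?_ ?_)
          · refine (Finset.abs_sum_le_sum_abs _ _).trans (Finset.sum_le_sum fun i' _ => ?_)
            rw [abs_mul]
            exact mul_le_mul_of_nonneg_left (abs_featAt_le hB i i') (abs_nonneg _)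
          · exact le_mul_of_one_le_right (abs_nonneg _) hB.one_le
      _ ≤ 1 * B := by
          rw [← Finset.sum_mul, ← add_mul]
          exact mul_le_mul_of_nonneg_right (hB.w_le k m) hB0
      _ = B := one_mul _
  calc _ ≤ ∑ m, |D.cf k m| * B := by
        refine (Finset.abs_sum_le_sum_abs _ _).trans (Finset.sum_le_sum fun m _ => ?_)
        rw [abs_mul]
        refine mul_le_mul_of_nonneg_left ?_ (abs_nonneg _)
        rw [relu, abs_of_nonneg (le_max_right _ _)]
        exact max_le ((le_abs_self _).trans (hin m)) hB0
    _ ≤ C₀ * B := by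
        rw [← Finset.sum_mul]
        exact mul_le_mul_of_nonneg_right (hB.cf_le k) hB0

variable {R : ℝ} (hR : Fintype.card (TokIdx d A) * B ≤ R)

include hR

theorem hidden_one :
    D.params.hidden R (fun i => tok (a i) (ρ i) (b i) 0 0 0 (pos (i + 1))) 1 =
      stepTok D a ρ b 0 0 := by
  have hB0 : 0 ≤ B := zero_le_one.trans hB.one_le
  have h0 : (0 : Fin 6 → Fin A → Fin d → ℝ) = slots 0 0 0 0 0 0 := by
    funext q; fin_cases q <;> simp [slots]
  have h1 : clip R (fun i => tok (a i) (ρ i) (b i) 0 0 0 (pos (i + 1))) =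
      fun i => tok (a i) (ρ i) (b i) 0 0 0 (pos (i + 1)) := by
    refine clip_eq_self hR fun i l => abs_tok_le
      (fun l => ((abs_apply_le_norm _ l).trans (hB.norm_a i)).trans hB.Ba_le)
      ((hB.abs_ρ i).trans hB.ρm_le)
      (fun k l => ((abs_apply_le_norm _ l).trans (hB.norm_b i k)).trans hB.Ba_le)
      (fun k => by simpa using hB0) (fun q k l => by simpa using hB0)
      (fun k => by simpa using hB0) (abs_pos_le hB i) l
  rw [hidden_succ D R _ (by omega), TFParams.hidden, h1]
  simp only [TSData.layerMLP, TSData.layerAttn, if_true]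
  rw [idleAttn_apply, mixMLP_apply_tok]
  have h2 : (fun i => tok (a i) (ρ i) (b i) 0 (0 + fun q => loadMix q none • b i +
      ∑ q', loadMix q (some q') • (0 : Fin 6 → Fin A → Fin d → ℝ) q') 0 (pos (i + 1))) =
      stepTok D a ρ b 0 0 := by
    funext i
    rw [h0, slots_load, stepTok]
    rfl
  rw [h2]
  exact clip_eq_self hR (abs_stepTok_le hB (Nat.zero_le _) (fun i k => by simpa using hB0))

theorem hidden_scale {H : Fin n → TokIdx d A → ℝ} {j : ℕ} (hj : j ≤ D.N)
    (h : D.params.hidden R H (2 * j + 1) = stepTok D a ρ b j 0) :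
    D.params.hidden R H (2 * j + 2) = stepTok D a ρ b j
      (fun i => (((i : ℝ) + 1) / (2 * D.T)) • chebAt D a b i j) := by
  rw [hidden_succ D R _ (by omega), h]
  have e1 : D.layerAttn (2 * j + 1) = scaleAttn d A D.T slotCur := by
    rw [TSData.layerAttn, if_neg (by omega), if_neg (by omega), if_neg (by omega),
      if_pos (by omega)]
  have e2 : D.layerMLP (2 * j + 1) = mixMLP d A M₀ 0 := by
    rw [TSData.layerMLP, if_neg (by omega), if_neg (by omega), if_pos (by omega)]
  rw [e1, e2]
  unfold stepTok
  rw [scaleAttn_apply _ _ _ _ _ _ hB.one_le_T hB.length_le, mixMLP_zero_apply]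
  refine Eq.trans ?_ (clip_eq_self hR (abs_stepTok_le hB (by omega) (norm_scaled_le hB
    fun i k => (norm_chebAt_le hB i j k).trans hB.Ba_le)))
  congr 1
  funext i
  rw [slots_add_scaled, Pi.zero_apply, zero_add]
  rfl

/-- A Gram layer and the following mixing layer complete one step of the Chebyshev recursion. -/
theorem hidden_step {H : Fin n → TokIdx d A → ℝ} {j : ℕ} (hj : j ≤ D.N)
    (h : D.params.hidden R H (2 * j + 2) = stepTok D a ρ b j
      (fun i => (((i : ℝ) + 1) / (2 * D.T)) • chebAt D a b i j)) :
    D.params.hidden R H (2 * (j + 1) + 1) = stepTok D a ρ b (j + 1) 0 := by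
  have hB0 : 0 ≤ B := zero_le_one.trans hB.one_le
  rw [show 2 * (j + 1) + 1 = 2 * j + 2 + 1 by ring, hidden_succ D R _ (by omega), h]
  have e1 : D.layerAttn (2 * j + 2) = gramAttn d A := by
    rw [TSData.layerAttn, if_neg (by omega), if_neg (by omega), if_neg (by omega),
      if_neg (by omega)]
  have e2 : D.layerMLP (2 * j + 2) = mixMLP d A M₀ (D.stepMix j) := by
    rw [TSData.layerMLP, if_neg (by omega), if_neg (by omega), if_neg (by omega),
      show (2 * j + 2) / 2 - 1 = j by omega]
  rw [e1, e2]
  refine Eq.trans ?_ (clip_eq_self hR (abs_stepTok_le hB (j := j + 1) (by omega) (s := 0)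
    (fun i k => by simpa using hB0)))
  congr 1
  unfold stepTok
  rw [gramAttn_apply, mixMLP_apply_tok]
  funext i
  rw [slots_add_gram, TSData.stepMix, slots_iter]
  congr 1
  have hcur : (if j = 0 then (1 / 2 : ℝ) else 1) •
      (((1 + rate D.m D.Mx ^ 2 - D.Mx⁻¹ * D.m) / rate D.m D.Mx) • chebAt D a b i j -
        (2 * D.T * D.Mx⁻¹ / rate D.m D.Mx) • ((0 : Fin A → Fin d → ℝ) +
          fun k => (1 / ((i : ℝ) + 1)) • ∑ j' ∈ Finset.Iic i,
            ((((((i : ℝ) + 1) / (2 * D.T)) • chebAt D a b i j) k) ⬝ᵥ a j') • a j')) -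
      chebPrev D a b i j = chebAt D a b i (j + 1) := by
    funext k
    have hs := (rate_bounds hB.m_pos hB.m_le).1
    have hs0 : rate D.m D.Mx ≠ 0 := by linarith
    have hT : (D.T : ℝ) ≠ 0 := by
      have := hB.one_le_T
      exact_mod_cast (by omega : D.T ≠ 0)
    have hi : ((i : ℝ) + 1) ≠ 0 := by positivity
    have hg : (1 / ((i : ℝ) + 1)) • ∑ j' ∈ Finset.Iic i,
        ((((((i : ℝ) + 1) / (2 * D.T)) • chebAt D a b i j) k) ⬝ᵥ a j') • a j' =
        (1 / (2 * (D.T : ℝ))) • (gramAt a i).mulVec (chebAt D a b i j k) := by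
      rw [gramAt_mulVec, Finset.smul_sum, Finset.smul_sum]
      refine Finset.sum_congr rfl fun j' _ => ?_
      simp only [Pi.smul_apply, smul_dotProduct, smul_smul, smul_eq_mul]
      congr 1
      field_simp
    have h2Z : ((1 + rate D.m D.Mx ^ 2 - D.Mx⁻¹ * D.m) / rate D.m D.Mx) • chebAt D a b i j k -
        (2 * D.T * D.Mx⁻¹ / rate D.m D.Mx) • (1 / (2 * (D.T : ℝ))) •
          (gramAt a i).mulVec (chebAt D a b i j k) =
        (2 : ℝ) • (chebMatrix (D.m • (1 : Matrix (Fin d) (Fin d) ℝ) + gramAt a i) D.m D.Mx).mulVec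
          (chebAt D a b i j k) := by
      rw [chebMatrix, Matrix.sub_mulVec, Matrix.smul_mulVec, Matrix.smul_mulVec,
        Matrix.add_mulVec, Matrix.smul_mulVec, Matrix.one_mulVec]
      funext l
      simp only [Pi.sub_apply, Pi.smul_apply, Pi.add_apply, smul_eq_mul]
      field_simp
      ring
    simp only [Pi.sub_apply, Pi.smul_apply, zero_add]
    simp only [Pi.smul_apply] at hg
    rw [hg, h2Z]
    cases j with
    | zero =>
      simp only [if_true, chebPrev, Pi.zero_apply, sub_zero, smul_smul]
      norm_num
      rfl
    | succ j =>
      simp only [Nat.add_eq_zero_iff, one_ne_zero, and_false, if_false, one_smul]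
      rfl
  have hacc : ∀ cf : ℕ → ℝ, accAt D a b cf i j + cf j • chebAt D a b i j =
      accAt D a b cf i (j + 1) := fun cf => by rw [accAt, accAt, Finset.sum_range_succ]
  rw [hacc, hacc]
  exact congrArg (fun v => slots v _ _ _ _ _) hcur

theorem hidden_last_scale {H : Fin n → TokIdx d A → ℝ}
    (h : D.params.hidden R H (2 * D.N + 3) = stepTok D a ρ b (D.N + 1) 0) :
    D.params.hidden R H (2 * D.N + 4) = stepTok D a ρ b (D.N + 1)
      (fun i => (((i : ℝ) + 1) / (2 * D.T)) • accAt D a b D.ω i (D.N + 1)) := by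
  rw [hidden_succ D R _ (by omega), h]
  have e1 : D.layerAttn (2 * D.N + 3) = scaleAttn d A D.T slotInv := by
    rw [TSData.layerAttn, if_neg (by omega), if_neg (by omega), if_pos (by omega)]
  have e2 : D.layerMLP (2 * D.N + 3) = mixMLP d A M₀ 0 := by
    rw [TSData.layerMLP, if_neg (by omega), if_neg (by omega), if_pos (by omega)]
  rw [e1, e2]
  unfold stepTok
  rw [scaleAttn_apply _ _ _ _ _ _ hB.one_le_T hB.length_le, mixMLP_zero_apply]
  refine Eq.trans ?_ (clip_eq_self hR (abs_stepTok_le hB le_rfl (norm_scaled_le hB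
    fun i k => (norm_accAt_le hB hB.abs_ω i le_rfl k).trans hB.acc_le)))
  congr 1
  funext i
  rw [slots_add_scaled, Pi.zero_apply, zero_add]
  rfl

theorem hidden_stepTok {j : ℕ} (hj : j ≤ D.N + 1) :
    D.params.hidden R (fun i => tok (a i) (ρ i) (b i) 0 0 0 (pos (i + 1))) (2 * j + 1) =
      stepTok D a ρ b j 0 := by
  induction j with
  | zero => exact hidden_one hB hR
  | succ j ih =>
    exact hidden_step hB hR (by omega) (hidden_scale hB hR (by omega) (ih (by omega)))

/-- The forward pass: the policy block of the output holds the sums of ReLUs at the approximate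
features. -/
theorem params_apply (hR' : Fintype.card (TokIdx d A) * ((1 + C₀) * B) ≤ R) (i : Fin n)
    (k : Fin A) :
    D.params.apply R (fun i => tok (a i) (ρ i) (b i) 0 0 0 (pos (i + 1))) i
      (Sum.inr (Sum.inr (Sum.inl k))) = logitAt D a ρ b i k := by
  have hB0 : 0 ≤ B := zero_le_one.trans hB.one_le
  have hC₀ : 0 ≤ C₀ := (Finset.sum_nonneg fun _ _ => abs_nonneg _).trans (hB.cf_le k)
  have hB1 : B ≤ (1 + C₀) * B := by nlinarith
  have hfin := hidden_last_scale hB hR (hidden_stepTok hB hR le_rfl)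
  have e1 : D.layerAttn (2 * D.N + 4) = rewardAttn d A := by
    rw [TSData.layerAttn, if_neg (by omega), if_pos (by omega)]
  have e2 : D.layerMLP (2 * D.N + 4) = readMLP D.cf D.w D.β := by
    rw [TSData.layerMLP, if_neg (by omega), if_pos (by omega)]
  rw [TFParams.apply, hidden_succ D R _ (by omega), hfin, e1, e2]
  have hout : (readMLP D.cf D.w D.β).apply ((rewardAttn d A).apply (stepTok D a ρ b (D.N + 1)
      (fun i => (((i : ℝ) + 1) / (2 * D.T)) • accAt D a b D.ω i (D.N + 1)))) =
      fun i => tok (a i) (ρ i) (b i) (logitAt D a ρ b i)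
        (slots (chebAt D a b i (D.N + 1)) (chebPrev D a b i (D.N + 1))
          (accAt D a b D.ξ i (D.N + 1)) (accAt D a b D.ω i (D.N + 1))
          ((((i : ℝ) + 1) / (2 * D.T)) • accAt D a b D.ω i (D.N + 1)) 0)
        (yAt D a ρ b i) (pos (i + 1)) := by
    unfold stepTok
    rw [rewardAttn_apply, readMLP_apply]
    funext i
    rw [tok_add]
    simp only [getW_tok, getY_tok, getP_tok, zero_add, add_zero]
    congr 1
    funext k
    rw [logitAt]
    refine Finset.sum_congr rfl fun m _ => ?_
    have : pos (i + 1) 2 = 1 := by simp [pos]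
    rw [this, mul_one]
    rfl
  rw [hout, clip_eq_self (B := (1 + C₀) * B) hR']
  · rfl
  intro i l
  refine abs_tok_le (fun l => (((abs_apply_le_norm _ l).trans (hB.norm_a i)).trans hB.Ba_le).trans
      hB1) (((hB.abs_ρ i).trans hB.ρm_le).trans hB1)
    (fun k l => (((abs_apply_le_norm _ l).trans (hB.norm_b i k)).trans hB.Ba_le).trans hB1)
    (fun k => (abs_logitAt_le hB i k).trans (by nlinarith)) ?_
    (fun k => (abs_yAt_le hB i k).trans hB1) (fun l => (abs_pos_le hB i l).trans hB1) l
  intro q k l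
  refine le_trans ?_ hB1
  have := abs_stepTok_le hB (j := D.N + 1) le_rfl (norm_scaled_le hB
    fun i k => (norm_accAt_le hB hB.abs_ω i le_rfl k).trans hB.acc_le) i
    (Sum.inr (Sum.inr (Sum.inr (Sum.inl (freeEquiv d A (Sum.inl (q, k, l)))))))
  simpa [stepTok, tok] using this

end Forward

end

end TSTransformer

namespace TSTransformer

noncomputable section

variable {d A : ℕ}

/-! ### The norm of the parameters -/

theorem norm_layerAttn_le {M₀ : ℕ} (D : TSData d A M₀) (hT : 1 ≤ D.T) (l : ℕ) (m : Fin (A * 2)) :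
    ‖(D.layerAttn l).Q m‖ ≤ 1 ∧ ‖(D.layerAttn l).K m‖ ≤ 1 ∧ ‖(D.layerAttn l).V m‖ ≤ 1 := by
  have hs := headSign_sq (finProdFinEquiv.symm m).2
  have hscale : ∀ q, ‖(scaleAttn d A D.T q).Q m‖ ≤ 1 ∧ ‖(scaleAttn d A D.T q).K m‖ ≤ 1 ∧
      ‖(scaleAttn d A D.T q).V m‖ ≤ 1 := by
    intro q
    refine ⟨norm_qPos_le hT, norm_kPos_le, ?_⟩
    simp only [scaleAttn]
    split_ifs
    · exact norm_vCopy_le _ _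
    · simp
  unfold TSData.layerAttn
  split_ifs
  · simp [idleAttn]
  · exact ⟨norm_qScaled_le hs _, norm_kAct_le, norm_vReward_le hs _⟩
  · exact hscale _
  · exact hscale _
  · exact ⟨norm_qScaled_le hs _, norm_kAct_le, norm_vGram_le hs _⟩

theorem abs_stepMix_le {M₀ : ℕ} (D : TSData d A M₀) (hm : 0 < D.m) (hM : D.m ≤ D.Mx) {X : ℝ}
    (hX : 0 ≤ X) {j : ℕ} (hξ : |D.ξ j| ≤ X) (hω : |D.ω j| ≤ X) (q : Fin 6) (o : Option (Fin 6)) :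
    |D.stepMix j q o| ≤ 4 + 4 * D.T / D.Mx + X := by
  have hM0 : 0 < D.Mx := lt_of_lt_of_le hm hM
  obtain ⟨h1, h2, -⟩ := rate_bounds hm hM
  have hs : 0 < rate D.m D.Mx := by linarith
  have hcm : 0 ≤ D.Mx⁻¹ * D.m ∧ D.Mx⁻¹ * D.m ≤ 1 :=
    ⟨by positivity, by rw [inv_mul_le_one₀ hM0]; exact hM⟩
  set e := (1 + rate D.m D.Mx ^ 2 - D.Mx⁻¹ * D.m) / rate D.m D.Mx with he
  set f := 2 * D.T * D.Mx⁻¹ / rate D.m D.Mx with hf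
  set u : ℝ := if j = 0 then 1 / 2 else 1 with hu
  have hu0 : 0 ≤ u ∧ u ≤ 1 := by rw [hu]; split_ifs <;> norm_num
  have he0 : 0 ≤ e ∧ e ≤ 4 := by
    constructor
    · rw [he]; apply div_nonneg _ hs.le; nlinarith
    · rw [he, div_le_iff₀ hs]; nlinarith
  have hf0 : 0 ≤ f ∧ f ≤ 4 * D.T / D.Mx := by
    constructor
    · rw [hf]; positivity
    · rw [hf, div_le_iff₀ hs, ← div_eq_mul_inv]
      have : 0 ≤ D.T / D.Mx := by positivity
      rw [mul_div_assoc, mul_div_assoc]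
      nlinarith
  have hue : 0 ≤ u * e ∧ u * e ≤ 4 :=
    ⟨mul_nonneg hu0.1 he0.1, (mul_le_of_le_one_left he0.1 hu0.2).trans he0.2⟩
  have huf : 0 ≤ u * f ∧ u * f ≤ 4 * D.T / D.Mx :=
    ⟨mul_nonneg hu0.1 hf0.1, (mul_le_of_le_one_left hf0.1 hu0.2).trans hf0.2⟩
  have hTM : 0 ≤ 4 * D.T / D.Mx := by positivity
  have c1 : |u * e - 1| ≤ 4 + 4 * D.T / D.Mx + X := by
    rw [abs_le]; constructor <;> linarith [hue.1, hue.2]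
  have c2 : |(1 : ℝ)| ≤ 4 + 4 * D.T / D.Mx + X := by rw [abs_one]; linarith
  have c3 : |-(1 : ℝ)| ≤ 4 + 4 * D.T / D.Mx + X := by rw [abs_neg]; exact c2
  have c4 : |-(u * f)| ≤ 4 + 4 * D.T / D.Mx + X := by
    rw [abs_neg, abs_of_nonneg huf.1]; linarith [huf.2]
  have c5 : |D.ξ j| ≤ 4 + 4 * D.T / D.Mx + X := by linarith
  have c6 : |D.ω j| ≤ 4 + 4 * D.T / D.Mx + X := by linarith
  have c7 : |(0 : ℝ)| ≤ 4 + 4 * D.T / D.Mx + X := by rw [abs_zero]; linarith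
  rcases o with _ | o
  · exact c7
  · fin_cases q <;> fin_cases o <;>
    first | exact c1 | exact c2 | exact c3 | exact c4 | exact c5 | exact c6 | exact c7

/-- The term `T / Mx` comes from the weight of the Gram matrix in the recursion, `√(M₀ A)` and `C₀`
from the two maps of the read-out layer. -/
theorem nrm_params_le {M₀ : ℕ} (D : TSData d A M₀) (hT : 1 ≤ D.T) (hm : 0 < D.m) (hM : D.m ≤ D.Mx)
    {X C₀ : ℝ} (hX : 0 ≤ X) (hξ : ∀ j ≤ D.N, |D.ξ j| ≤ X) (hω : ∀ j ≤ D.N, |D.ω j| ≤ X)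
    (hC : 0 ≤ C₀) (hcf : ∀ k, ∑ m, |D.cf k m| ≤ C₀)
    (hw : ∀ k m, ∑ i, |D.w k m i| + |D.β k m| ≤ 1) :
    D.params.nrm ≤ 43 + 2 * A + √(M₀ * A) + 40 * D.T / D.Mx + 10 * X + C₀ := by
  have hM0 : 0 < D.Mx := lt_of_lt_of_le hm hM
  have hTM : 0 ≤ 4 * D.T / D.Mx := by positivity
  have hsq : 0 ≤ √((M₀ : ℝ) * A) := Real.sqrt_nonneg _
  refine Real.iSup_le (fun l => ?_) (by positivity)
  have hQK : (⨆ m : Fin (A * 2), max ‖(D.layerAttn l).Q m‖ ‖(D.layerAttn l).K m‖) ≤ 1 :=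
    Real.iSup_le (fun m => max_le (norm_layerAttn_le D hT l m).1 (norm_layerAttn_le D hT l m).2.1)
      zero_le_one
  have hV : ∑ m : Fin (A * 2), ‖(D.layerAttn l).V m‖ ≤ 2 * A := by
    refine (Finset.sum_le_sum fun m _ => (norm_layerAttn_le D hT l m).2.2).trans ?_
    simp [mul_comm]
  have hmix : ∀ B : Fin 6 → Option (Fin 6) → ℝ, (∀ q o, |B q o| ≤ 4 + 4 * D.T / D.Mx + X) →
      ‖(mixMLP d A M₀ B).W₁‖ + ‖(mixMLP d A M₀ B).W₂‖ ≤
        2 + √(M₀ * A) + 10 * (4 + 4 * D.T / D.Mx + X) + C₀ := by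
    intro B hB
    have h1 := norm_mixIn_le d A M₀
    have h2 := norm_mixOut_le (d := d) (A := A) M₀ (by positivity) hB
    simp only [mixMLP]
    linarith
  have hMLP : ‖(D.layerMLP l).W₁‖ + ‖(D.layerMLP l).W₂‖ ≤
      2 + √(M₀ * A) + 10 * (4 + 4 * D.T / D.Mx + X) + C₀ := by
    have hl := l.2
    unfold TSData.layerMLP
    split_ifs with h1 h2 h3
    · refine hmix _ fun q o => ?_
      rcases o with _ | o
      · simp only [loadMix, Option.elim]
        split_ifs
        · rw [abs_one]; linarith
        · rw [abs_zero]; linarith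
      · simp only [loadMix, Option.elim, abs_zero]; linarith
    · have h4 := norm_readIn_le (A := A) (d := d) hw
      have h5 := norm_readOut_le (d := d) hC hcf
      simp only [readMLP]
      linarith
    · refine hmix _ fun q o => ?_
      simp only [Pi.zero_apply, abs_zero]; linarith
    · exact hmix _ (abs_stepMix_le D hm hM hX (hξ _ (by omega)) (hω _ (by omega)))
  have e : 10 * (4 + 4 * D.T / D.Mx + X) = 40 + 40 * D.T / D.Mx + 10 * X := by ring
  rw [e] at hMLP
  change (⨆ m : Fin (A * 2), max ‖(D.layerAttn l).Q m‖ ‖(D.layerAttn l).K m‖) +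
    ∑ m : Fin (A * 2), ‖(D.layerAttn l).V m‖ + ‖(D.layerMLP l).W₁‖ + ‖(D.layerMLP l).W₂‖ ≤ _
  linarith

/-! ### The tokens of an observation -/

variable {n : ℕ}

/-- The action blocks of the tokens of an observation. -/
def obsA (o : Obs d A n) (i : Fin (2 * n + 1)) : Fin d → ℝ :=
  if h : i.1 % 2 = 0 then 0 else fun l => o.action ⟨i.1 / 2, by omega⟩ l

/-- The rewards of the tokens of an observation. -/
def obsR (o : Obs d A n) (i : Fin (2 * n + 1)) : ℝ :=
  if h : i.1 % 2 = 0 then 0 else o.reward ⟨i.1 / 2, by omega⟩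

/-- The action set blocks of the tokens of an observation. -/
def obsB (o : Obs d A n) (i : Fin (2 * n + 1)) : Fin A → Fin d → ℝ :=
  if h : i.1 % 2 = 0 then fun k l => o.1 ⟨i.1 / 2, by omega⟩ k l else 0

theorem tokens_eq (o : Obs d A n) : o.tokens (numFree d A) = fun i =>
    tok (obsA o i) (obsR o i) (obsB o i) 0 0 0 (pos (i + 1)) := by
  funext i
  have h0 : ∀ l : Fin (numFree d A), (0 : ℝ) = Sum.elim (fun _ : Fin 6 × Fin A × Fin d => 0)
      (0 : Fin A → ℝ) ((freeEquiv d A).symm l) := by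
    intro l
    rcases (freeEquiv d A).symm l with q | k <;> rfl
  unfold Obs.tokens obsA obsR obsB
  split_ifs with h
  · funext c
    rcases c with (c | c) | c | c | c | c <;> simp [stateToken, tok]
    exact h0 c
  · funext c
    rcases c with (c | c) | c | c | c | c <;> simp [actionToken, tok]
    exact h0 c

/-- Sums over the positions of actions are sums over the past rounds. -/
theorem sum_tokens_eq {V : Type} [AddCommMonoid V] (o : Obs d A n) (F : (Fin d → ℝ) → ℝ → V)
    (hF : F 0 0 = 0) :
    ∑ j ∈ Finset.Iic (Fin.last (2 * n)), F (obsA o j) (obsR o j) =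
      ∑ j : Fin n, F (fun l => o.action j l) (o.reward j) := by
  have h1 : Finset.Iic (Fin.last (2 * n)) = Finset.univ := by
    ext j; simp [Fin.le_last]
  rw [h1]
  symm
  have hinj : Function.Injective fun j : Fin n => (⟨2 * j.1 + 1, by omega⟩ : Fin (2 * n + 1)) := by
    intro j j' h
    simp only [Fin.mk.injEq] at h
    exact Fin.ext (by omega)
  refine Finset.sum_of_injOn (fun j : Fin n => (⟨2 * j.1 + 1, by omega⟩ : Fin (2 * n + 1)))
    hinj.injOn (by simp) ?_ ?_
  · intro i _ hi
    have : i.1 % 2 = 0 := by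
      by_contra hne
      refine hi ⟨⟨i.1 / 2, by omega⟩, by simp, Fin.ext ?_⟩
      simp only
      omega
    simp [obsA, obsR, this, hF]
  · intro j _
    have hne : ¬ ((2 * j.1 + 1) % 2 = 0) := by omega
    have he : (⟨(2 * j.1 + 1) / 2, by omega⟩ : Fin n) = j := Fin.ext (by simp only; omega)
    simp [obsA, obsR, he]

theorem obsB_last (o : Obs d A n) (k : Fin A) :
    obsB o (Fin.last (2 * n)) k = fun l => o.current k l := by
  have h : (Fin.last (2 * n)).1 % 2 = 0 := by simp
  have he : (⟨(Fin.last (2 * n)).1 / 2, by omega⟩ : Fin (n + 1)) = Fin.last n :=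
    Fin.ext (by simp)
  rw [obsB, dif_pos h, he]
  rfl

theorem gramAt_last (o : Obs d A n) (lam r : ℝ) :
    (r / lam) • (1 : Matrix (Fin d) (Fin d) ℝ) + gramAt (obsA o) (Fin.last (2 * n)) =
      tsSigma lam r o := by
  rw [gramAt, sum_tokens_eq o (fun a _ => Matrix.vecMulVec a a) (by simp), tsSigma]

end

end TSTransformer

namespace TSTransformer

noncomputable section

variable {d A n : ℕ}

/-! ### Accuracy of the features -/

/-- The parameters of the transformer that approximates Thompson sampling, with `N` Chebyshev
steps. -/
def tsData {M₀ : ℕ} (T : ℕ) (lam r Ba : ℝ) (N : ℕ) (cf : Fin A → Fin M₀ → ℝ)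
    (w : Fin A → Fin M₀ → Feat d A → ℝ) (β : Fin A → Fin M₀ → ℝ) : TSData d A M₀ where
  T := T
  m := r / lam
  Mx := r / lam + T * Ba ^ 2
  N := N
  ξ j := √(r * (r / lam + T * Ba ^ 2)⁻¹) *
    chebCoeff invSqrtCoeff (rate (r / lam) (r / lam + T * Ba ^ 2)) N j
  ω j := 2 * T * ((r / lam + T * Ba ^ 2)⁻¹ *
    chebCoeff (fun _ => 1) (rate (r / lam) (r / lam + T * Ba ^ 2)) N j)
  cf := cf
  w := w
  β := β

open scoped MatrixOrder in
/-- The exact features of the Thompson sampling probabilities: `x_k = √r Σ^(-1/2) a_k` and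
`y_k = ⟨μ, a_k⟩`. -/
def tsFeat (lam r : ℝ) (o : Obs d A n) : Feat d A → ℝ :=
  Sum.elim (fun p => (CFC.sqrt (r • (tsSigma lam r o)⁻¹)).mulVec (fun l => o.current p.1 l) p.2)
    fun k => (tsMean lam r o : Fin d → ℝ) ⬝ᵥ fun l => o.current k l

theorem norm_obsA_le {o : Obs d A n} {Ba : ℝ} (hBa : 0 ≤ Ba) (ho : ∀ t k, ‖o.1 t k‖ ≤ Ba)
    (i : Fin (2 * n + 1)) : ‖WithLp.toLp 2 (obsA o i)‖ ≤ Ba := by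
  unfold obsA
  split_ifs
  · simpa using hBa
  · exact ho _ _

theorem norm_obsB_le {o : Obs d A n} {Ba : ℝ} (hBa : 0 ≤ Ba) (ho : ∀ t k, ‖o.1 t k‖ ≤ Ba)
    (i : Fin (2 * n + 1)) (k : Fin A) : ‖WithLp.toLp 2 (obsB o i k)‖ ≤ Ba := by
  unfold obsB
  split_ifs
  · exact ho _ _
  · simpa using hBa

theorem abs_obsR_le {o : Obs d A n} {ρm : ℝ} (hρ : 0 ≤ ρm) (ho : ∀ t, |o.reward t| ≤ ρm)
    (i : Fin (2 * n + 1)) : |obsR o i| ≤ ρm := by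
  unfold obsR
  split_ifs
  · simpa using hρ
  · exact ho _

theorem isHermitian_vecMulVec_self (a : Fin d → ℝ) : (Matrix.vecMulVec a a).IsHermitian := by
  ext i j
  simp [Matrix.vecMulVec_apply, mul_comm]

theorem dot_vecMulVec (a v : Fin d → ℝ) : v ⬝ᵥ (Matrix.vecMulVec a a).mulVec v = (v ⬝ᵥ a) ^ 2 := by
  rw [Matrix.vecMulVec_mulVec, dotProduct_comm a v]
  simp [sq]

theorem spectrumIn_gramAt {T : ℕ} (hn : n ≤ T) {m Ba : ℝ} (hm : 0 < m)
    {o : Obs d A n} (ho : ∀ t k, ‖o.1 t k‖ ≤ Ba) (i : Fin (2 * n + 1)) :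
    SpectrumIn (m • (1 : Matrix (Fin d) (Fin d) ℝ) + gramAt (obsA o) i) m (m + T * Ba ^ 2) := by
  have hquad : ∀ v : Fin d → ℝ, v ⬝ᵥ (m • (1 : Matrix (Fin d) (Fin d) ℝ) +
      gramAt (obsA o) i).mulVec v = m * (v ⬝ᵥ v) + ∑ j ∈ Finset.Iic i, (v ⬝ᵥ obsA o j) ^ 2 := by
    intro v
    rw [Matrix.add_mulVec, Matrix.smul_mulVec, Matrix.one_mulVec, dotProduct_add, dotProduct_smul,
      smul_eq_mul, gramAt, Matrix.sum_mulVec, dotProduct_sum]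
    simp only [dot_vecMulVec]
  refine ⟨?_, hm, fun v => ?_, fun v => ?_⟩
  · refine Matrix.IsHermitian.add ?_ ?_
    · exact (Matrix.isHermitian_one.smul (by simp [IsSelfAdjoint]))
    · unfold gramAt
      refine Finset.sum_induction _ Matrix.IsHermitian (fun _ _ h h' => h.add h')
        Matrix.isHermitian_zero fun j _ => isHermitian_vecMulVec_self _
  · rw [hquad]
    have : 0 ≤ ∑ j ∈ Finset.Iic i, (v ⬝ᵥ obsA o j) ^ 2 := by positivity
    linarith
  · rw [hquad, add_mul]
    have h1 : ∑ j ∈ Finset.Iic i, (v ⬝ᵥ obsA o j) ^ 2 ≤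
        ∑ j ∈ Finset.Iic (Fin.last (2 * n)), (v ⬝ᵥ obsA o j) ^ 2 :=
      Finset.sum_le_sum_of_subset_of_nonneg (Finset.Iic_subset_Iic.2 (Fin.le_last _))
        fun _ _ _ => sq_nonneg _
    rw [sum_tokens_eq o (fun a _ => (v ⬝ᵥ a) ^ 2) (by simp)] at h1
    have h2 : ∀ j : Fin n, (v ⬝ᵥ fun l => o.action j l) ^ 2 ≤ Ba ^ 2 * (v ⬝ᵥ v) := by
      intro j
      rw [← norm_toLp_sq, mul_comm, ← mul_pow, ← sq_abs]
      refine pow_le_pow_left₀ (abs_nonneg _) ((abs_dotProduct_le _ _).trans ?_) 2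
      exact mul_le_mul_of_nonneg_left (ho _ _) (norm_nonneg _)
    have h3 := Finset.sum_le_sum fun j (_ : j ∈ Finset.univ) => h2 j
    rw [Finset.sum_const, Finset.card_univ, Fintype.card_fin, nsmul_eq_mul] at h3
    have h4 : (n : ℝ) * (Ba ^ 2 * (v ⬝ᵥ v)) ≤ T * (Ba ^ 2 * (v ⬝ᵥ v)) := by
      refine mul_le_mul_of_nonneg_right (by exact_mod_cast hn) ?_
      rw [← norm_toLp_sq]; positivity
    linarith

theorem spectrumIn_tsSigma {T : ℕ} (hn : n ≤ T) {lam r Ba : ℝ} (hlam : 0 < lam) (hr : 0 < r)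
    {o : Obs d A n} (ho : ∀ t k, ‖o.1 t k‖ ≤ Ba) :
    SpectrumIn (tsSigma lam r o) (r / lam) (r / lam + T * Ba ^ 2) := by
  rw [← gramAt_last]
  exact spectrumIn_gramAt hn (by positivity) ho _

theorem dot_mulVec_symm {S : Matrix (Fin d) (Fin d) ℝ} (hS : S.IsHermitian) (u v : Fin d → ℝ) :
    S.mulVec u ⬝ᵥ v = u ⬝ᵥ S.mulVec v := by
  have hT : Matrix.transpose S = S := by simpa [Matrix.IsHermitian] using hS
  rw [Matrix.dotProduct_mulVec, ← Matrix.mulVec_transpose, hT]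

/-- At the last token the features computed by the transformer are close to the exact ones. -/
theorem abs_featAt_sub_tsFeat_le {M₀ T : ℕ} (hn : n < T) {lam r Ba ρm : ℝ} (hlam : 0 < lam)
    (hr : 0 < r) (hBa : 0 < Ba) (hρ : 0 ≤ ρm) {o : Obs d A n} (ho : ∀ t k, ‖o.1 t k‖ ≤ Ba)
    (hoρ : ∀ t, |o.reward t| ≤ ρm) (N : ℕ) (cf : Fin A → Fin M₀ → ℝ)
    (w : Fin A → Fin M₀ → Feat d A → ℝ) (β : Fin A → Fin M₀ → ℝ) (i : Feat d A) :
    |featAt (tsData T lam r Ba N cf w β) (obsA o) (obsR o) (obsB o) (Fin.last (2 * n)) i -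
      tsFeat lam r o i| ≤ (√lam * Ba + ρm) * chebErr (r / lam) (r / lam + T * Ba ^ 2) N := by
  have hm : 0 < r / lam := by positivity
  have hT : (1 : ℝ) ≤ T := by exact_mod_cast (by omega : 1 ≤ T)
  have hM : r / lam ≤ r / lam + T * Ba ^ 2 := by
    have : 0 ≤ (T : ℝ) * Ba ^ 2 := by positivity
    linarith
  have hS := spectrumIn_tsSigma (T := T) hn.le hlam hr ho
  have hM0 : 0 < r / lam + T * Ba ^ 2 := by positivity
  have hτ := chebErr_nonneg hm hM N
  set τ := chebErr (r / lam) (r / lam + T * Ba ^ 2) N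
  set Mx := r / lam + T * Ba ^ 2 with hMx
  have hacc : ∀ (cf' : ℕ → ℝ) (k : Fin A),
      accAt (tsData T lam r Ba N cf w β) (obsA o) (obsB o) cf' (Fin.last (2 * n)) (N + 1) k =
      ∑ j ∈ Finset.range (N + 1), cf' j • chebVec (chebMatrix (tsSigma lam r o) (r / lam) Mx)
        (fun l => o.current k l) j := by
    intro cf' k
    rw [accAt, Finset.sum_apply]
    refine Finset.sum_congr rfl fun j _ => ?_
    rw [Pi.smul_apply, chebAt, obsB_last, ← gramAt_last o lam r]
    rfl
  have hcur : ∀ k, ‖WithLp.toLp 2 (fun l => o.current k l)‖ ≤ Ba := fun k => ho _ _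
  rcases i with ⟨k, l⟩ | k
  · have h1 := hS.norm_sqrt_approx hr (fun l => o.current k l) N
    have h2 := (abs_apply_le_norm _ l).trans h1
    have h3 : √(r * Mx⁻¹) ≤ √lam := by
      refine Real.sqrt_le_sqrt ?_
      rw [← div_eq_mul_inv, div_le_iff₀ hM0]
      have : lam * (r / lam) = r := by field_simp
      nlinarith
    have h4 : √(r * Mx⁻¹) * τ * ‖WithLp.toLp 2 (fun l => o.current k l)‖ ≤ √lam * τ * Ba := by
      gcongr
      exact hcur k
    have h5 : 0 ≤ ρm * τ := by positivity
    simp only [featAt, tsFeat, Sum.elim_inl]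
    change |accAt _ _ _ _ _ (N + 1) k l - _| ≤ _
    rw [hacc]
    refine (h2.trans h4).trans ?_
    linarith
  · have h1 := hS.norm_inv_approx (fun l => o.current k l) N
    set e := (∑ j ∈ Finset.range (N + 1), (Mx⁻¹ * chebCoeff (fun _ => 1) (rate (r / lam) Mx) N j) •
      chebVec (chebMatrix (tsSigma lam r o) (r / lam) Mx) (fun l => o.current k l) j) -
        (tsSigma lam r o)⁻¹.mulVec (fun l => o.current k l) with he
    have hωacc : accAt (tsData T lam r Ba N cf w β) (obsA o) (obsB o)
        (tsData T lam r Ba N cf w β).ω (Fin.last (2 * n)) (N + 1) k =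
        (2 * (T : ℝ)) • ((tsSigma lam r o)⁻¹.mulVec (fun l => o.current k l) + e) := by
      rw [hacc, he, add_sub_cancel, Finset.smul_sum]
      refine Finset.sum_congr rfl fun j _ => ?_
      rw [smul_smul]
      rfl
    have hy : yAt (tsData T lam r Ba N cf w β) (obsA o) (obsR o) (obsB o) (Fin.last (2 * n)) k =
        ∑ j : Fin n, (((tsSigma lam r o)⁻¹.mulVec (fun l => o.current k l) + e) ⬝ᵥ
          fun l => o.action j l) * o.reward j := by
      unfold yAt
      rw [sum_tokens_eq o (fun a ρ => ((((((Fin.last (2 * n) : Fin (2 * n + 1)) : ℝ) + 1) /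
        (2 * (tsData T lam r Ba N cf w β).T)) • accAt (tsData T lam r Ba N cf w β) (obsA o) (obsB o)
        (tsData T lam r Ba N cf w β).ω (Fin.last (2 * n))
          ((tsData T lam r Ba N cf w β).N + 1)) k ⬝ᵥ a) * ρ) (by simp), Finset.mul_sum]
      refine Finset.sum_congr rfl fun j _ => ?_
      rw [Pi.smul_apply]
      change _ * ((_ / (2 * (T : ℝ))) • accAt _ _ _ _ _ (N + 1) k ⬝ᵥ _ * _) = _
      rw [hωacc, smul_smul, smul_dotProduct, smul_eq_mul]
      have hi : (((Fin.last (2 * n) : Fin (2 * n + 1)) : ℝ) + 1) ≠ 0 := by positivity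
      field_simp
    have hμ : tsFeat lam r o (Sum.inr k) = ∑ j : Fin n,
        ((tsSigma lam r o)⁻¹.mulVec (fun l => o.current k l) ⬝ᵥ fun l => o.action j l) *
          o.reward j := by
      simp only [tsFeat, Sum.elim_inr, tsMean]
      rw [dot_mulVec_symm hS.isHermitian.inv, sum_dotProduct]
      refine Finset.sum_congr rfl fun j _ => ?_
      rw [smul_dotProduct, smul_eq_mul, mul_comm, dotProduct_comm]
    have hen : ‖WithLp.toLp 2 e‖ ≤ Mx⁻¹ * τ * Ba := by
      refine h1.trans ?_
      rw [abs_of_pos (by positivity)]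
      exact mul_le_mul_of_nonneg_left (hcur k) (by positivity)
    simp only [featAt, Sum.elim_inr]
    rw [hy, hμ, ← Finset.sum_sub_distrib]
    have hterm : ∀ j : Fin n, |(((tsSigma lam r o)⁻¹.mulVec (fun l => o.current k l) + e) ⬝ᵥ
          fun l => o.action j l) * o.reward j -
        ((tsSigma lam r o)⁻¹.mulVec (fun l => o.current k l) ⬝ᵥ fun l => o.action j l) *
          o.reward j| ≤ Mx⁻¹ * τ * Ba * Ba * ρm := by
      intro j
      rw [← sub_mul, add_dotProduct, add_sub_cancel_left, abs_mul]
      refine mul_le_mul ((abs_dotProduct_le _ _).trans (mul_le_mul hen (ho _ _) (norm_nonneg _)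
        (by positivity))) (hoρ j) (abs_nonneg _) (by positivity)
    refine (Finset.abs_sum_le_sum_abs _ _).trans ((Finset.sum_le_sum fun j _ => hterm j).trans ?_)
    rw [Finset.sum_const, Finset.card_univ, Fintype.card_fin, nsmul_eq_mul]
    have h6 : (n : ℝ) * Ba ^ 2 ≤ Mx := by
      have : (n : ℝ) * Ba ^ 2 ≤ T * Ba ^ 2 :=
        mul_le_mul_of_nonneg_right (by exact_mod_cast hn.le) (sq_nonneg _)
      linarith
    have h7 : (n : ℝ) * Ba ^ 2 * Mx⁻¹ ≤ 1 := by
      rw [← div_eq_mul_inv]; exact div_le_one_of_le₀ h6 hM0.le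
    have h8 : 0 ≤ √lam * Ba * τ := by positivity
    have h9 : (n : ℝ) * (Mx⁻¹ * τ * Ba * Ba * ρm) ≤ 1 * (τ * ρm) := by
      have : (n : ℝ) * (Mx⁻¹ * τ * Ba * Ba * ρm) = (n : ℝ) * Ba ^ 2 * Mx⁻¹ * (τ * ρm) := by ring
      rw [this]
      exact mul_le_mul_of_nonneg_right h7 (by positivity)
    linarith

end

end TSTransformer

namespace TSTransformer

noncomputable section

variable {d A n : ℕ}

/-! ### Thompson sampling probabilities as functions of the features -/

open scoped MatrixOrder in
theorem inner_toEuclideanCLM_sqrt {C : Matrix (Fin d) (Fin d) ℝ} (a u : Vec d) :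
    inner ℝ a (Matrix.toEuclideanCLM (𝕜 := ℝ) (CFC.sqrt C) u) =
      inner ℝ (WithLp.toLp 2 ((CFC.sqrt C).mulVec fun l => a l)) u := by
  have hR : (CFC.sqrt C).PosSemidef := Matrix.nonneg_iff_posSemidef.1 (CFC.sqrt_nonneg C)
  rw [EuclideanSpace.inner_eq_star_dotProduct, EuclideanSpace.inner_eq_star_dotProduct,
    star_trivial, star_trivial, Matrix.ofLp_toEuclideanCLM, WithLp.ofLp_toLp,
    dot_mulVec_symm hR.isHermitian]

/-- The Gaussian event that action `k` is optimal, in terms of the features `z`. -/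
def optEvent (z : Feat d A → ℝ) (k : Fin A) : Set (Vec d) :=
  {u | ∀ j, 0 ≤ inner ℝ (featX z k - featX z j) u + featY z k - featY z j}

theorem measurableSet_optEvent (z : Feat d A → ℝ) (k : Fin A) : MeasurableSet (optEvent z k) := by
  unfold optEvent
  rw [Set.ofPred_forall]
  refine MeasurableSet.iInter fun j => measurableSet_le measurable_const ?_
  fun_prop

open scoped MatrixOrder in
/-- Thompson sampling expressed through the features, by the reparametrization
`w = μ + √r Σ^(-1/2) u` with `u` standard Gaussian. -/
theorem tsPolicy_eq {lam r : ℝ} (o : Obs d A n) (k : Fin A) :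
    tsPolicy lam r o k = (stdGaussian (Vec d)).real (optEvent (tsFeat lam r o) k) := by
  have hmeas : MeasurableSet {w : Vec d | ∀ j : Fin A,
      inner ℝ (o.current j) w ≤ inner ℝ (o.current k) w} := by
    rw [Set.ofPred_forall]
    refine MeasurableSet.iInter fun j => measurableSet_le ?_ ?_ <;> fun_prop
  rw [tsPolicy, multivariateGaussian, map_measureReal_apply (by fun_prop) hmeas]
  congr 1
  ext u
  simp only [Set.mem_preimage, Set.mem_ofPred_eq, optEvent]
  refine forall_congr' fun j => ?_
  have hy : ∀ j, inner ℝ (o.current j) (tsMean lam r o) = featY (tsFeat lam r o) j := by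
    intro j
    rw [EuclideanSpace.inner_eq_star_dotProduct, star_trivial]
    rfl
  have hx : ∀ j, inner ℝ (o.current j) (Matrix.toEuclideanCLM (𝕜 := ℝ)
      (CFC.sqrt (r • (tsSigma lam r o)⁻¹)) u) = inner ℝ (featX (tsFeat lam r o) j) u := by
    intro j
    rw [inner_toEuclideanCLM_sqrt]
    rfl
  rw [inner_add_right, inner_add_right, hy, hy, hx, hx, inner_sub_left]
  constructor <;> intro h <;> linarith

theorem stdGaussian_hyperplane {v : Vec d} (hv : v ≠ 0) (c : ℝ) :
    stdGaussian (Vec d) {u | inner ℝ v u = c} = 0 := by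
  have h1 : (stdGaussian (Vec d)).map (innerSL ℝ v) =
      gaussianReal 0 (‖v‖ ^ 2).toNNReal := by
    rw [IsGaussian.map_eq_gaussianReal, integral_strongDual_stdGaussian, variance_dual_stdGaussian,
      innerSL_apply_norm]
  have h2 : {u : Vec d | inner ℝ v u = c} = (innerSL ℝ v) ⁻¹' {c} := by
    ext u; simp
  have : NullSingletonClass (gaussianReal 0 (‖v‖ ^ 2).toNNReal) := by
    refine nullSingletonClass_gaussianReal ?_
    have : 0 < ‖v‖ ^ 2 := by positivity
    simpa using hv
  rw [h2, ← Measure.map_apply (by fun_prop) (measurableSet_singleton c), h1, measure_singleton]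

/-- Ties have probability zero, so that the probabilities of optimality sum to at most one. -/
theorem sum_optEvent_le_one {z : Feat d A → ℝ} (hz : ∀ i j, i ≠ j → featX z i ≠ featX z j) :
    ∑ k, (stdGaussian (Vec d)).real (optEvent z k) ≤ 1 := by
  have h1 : ∑ k ∈ Finset.univ, stdGaussian (Vec d) (optEvent z k) ≤
      stdGaussian (Vec d) Set.univ := by
    refine sum_measure_le_measure_univ
      (fun k _ => (measurableSet_optEvent z k).nullMeasurableSet) ?_
    intro i _ j _ hij
    refine measure_mono_null ?_ (stdGaussian_hyperplane (sub_ne_zero.2 (hz i j hij))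
      (featY z j - featY z i))
    intro u hu
    have h2 := hu.1 j
    have h3 := hu.2 i
    simp only [Set.mem_ofPred_eq]
    rw [inner_sub_left] at h2 h3 ⊢
    linarith
  rw [measure_univ] at h1
  have h2 := ENNReal.toReal_mono ENNReal.one_ne_top h1
  rw [ENNReal.toReal_sum fun k _ => measure_ne_top _ _] at h2
  simpa [Measure.real] using h2

/-! ### From log-probabilities to policies -/

theorem abs_relu_sub_relu_le (x y : ℝ) : |relu x - relu y| ≤ |x - y| :=
  abs_max_sub_max_le_abs x y 0

/-- A sum of ReLUs with `∑ |c_m| ≤ C₀` and weights of `ℓ¹`-norm at most one is `C₀`-Lipschitz for the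
supremum norm. -/
theorem abs_sum_relu_sub_le {κ : Type} [Fintype κ] {M₀ : ℕ} {c : Fin M₀ → ℝ} {w : Fin M₀ → κ → ℝ}
    {b : Fin M₀ → ℝ} {C₀ e : ℝ} (hc : ∑ m, |c m| ≤ C₀) (hw : ∀ m, ∑ i, |w m i| + |b m| ≤ 1)
    (he : 0 ≤ e) {u v : κ → ℝ} (huv : ∀ i, |u i - v i| ≤ e) :
    |∑ m, c m * relu (∑ i, w m i * u i + b m) - ∑ m, c m * relu (∑ i, w m i * v i + b m)| ≤
      C₀ * e := by
  rw [← Finset.sum_sub_distrib]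
  calc _ ≤ ∑ m, |c m| * e := by
        refine (Finset.abs_sum_le_sum_abs _ _).trans (Finset.sum_le_sum fun m _ => ?_)
        rw [← mul_sub, abs_mul]
        refine mul_le_mul_of_nonneg_left ((abs_relu_sub_relu_le _ _).trans ?_) (abs_nonneg _)
        rw [add_sub_add_right_eq_sub, ← Finset.sum_sub_distrib]
        calc _ ≤ ∑ i, |w m i| * e := by
              refine (Finset.abs_sum_le_sum_abs _ _).trans (Finset.sum_le_sum fun i _ => ?_)
              rw [← mul_sub, abs_mul]
              exact mul_le_mul_of_nonneg_left (huv i) (abs_nonneg _)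
          _ ≤ 1 * e := by
              rw [← Finset.sum_mul]
              exact mul_le_mul_of_nonneg_right (by linarith [hw m, abs_nonneg (b m)]) he
          _ = e := one_mul e
    _ ≤ C₀ * e := by
        rw [← Finset.sum_mul]
        exact mul_le_mul_of_nonneg_right hc he

/-- If `v` approximates the truncated logarithms of a subprobability vector `p`, then its softmax is
not much smaller than `p`. -/
theorem log_sub_log_softmax_le {p v : Fin A → ℝ} {ε : ℝ} (hε : 0 < ε) (hp : ∀ k, 0 ≤ p k)
    (hsum : ∑ k, p k ≤ 1) (hv : ∀ k, |Real.log (max (p k) (ε / (4 * A))) - v k| ≤ 3 * ε / 8)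
    {k : Fin A} (hk : 0 < p k) : Real.log (p k) - Real.log (softmax v k) ≤ ε := by
  have hA : (0 : ℝ) < A := by exact_mod_cast k.pos
  have hη : 0 < ε / (4 * A) := by positivity
  have hS : 0 < ∑ j, Real.exp (v j) :=
    Finset.sum_pos (fun _ _ => Real.exp_pos _) ⟨k, Finset.mem_univ k⟩
  have h1 : Real.log (p k) ≤ Real.log (max (p k) (ε / (4 * A))) :=
    Real.log_le_log hk (le_max_left _ _)
  have h2 : Real.log (softmax v k) = v k - Real.log (∑ j, Real.exp (v j)) := by
    rw [softmax, Real.log_div (Real.exp_pos _).ne' hS.ne', Real.log_exp]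
  have h3 : ∑ j, Real.exp (v j) ≤ Real.exp (3 * ε / 8) * (1 + ε / 4) := by
    have h4 : ∀ j, Real.exp (v j) ≤ Real.exp (3 * ε / 8) * (p j + ε / (4 * A)) := by
      intro j
      have hpos : 0 < max (p j) (ε / (4 * A)) := lt_max_of_lt_right hη
      have h5 : v j ≤ 3 * ε / 8 + Real.log (max (p j) (ε / (4 * A))) := by
        linarith [(abs_le.1 (hv j)).1]
      calc Real.exp (v j) ≤ Real.exp (3 * ε / 8 + Real.log (max (p j) (ε / (4 * A)))) :=
            Real.exp_le_exp.2 h5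
        _ = Real.exp (3 * ε / 8) * max (p j) (ε / (4 * A)) := by
            rw [Real.exp_add, Real.exp_log hpos]
        _ ≤ _ := by
            refine mul_le_mul_of_nonneg_left ?_ (Real.exp_pos _).le
            exact max_le (by linarith) (by linarith [hp j])
    refine (Finset.sum_le_sum fun j _ => h4 j).trans ?_
    rw [← Finset.mul_sum, Finset.sum_add_distrib, Finset.sum_const, Finset.card_univ,
      Fintype.card_fin, nsmul_eq_mul]
    refine mul_le_mul_of_nonneg_left ?_ (Real.exp_pos _).le
    have : (A : ℝ) * (ε / (4 * A)) = ε / 4 := by field_simp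
    rw [this]
    linarith
  have h4 : Real.log (∑ j, Real.exp (v j)) ≤ 3 * ε / 8 + ε / 4 := by
    refine (Real.log_le_log hS h3).trans ?_
    rw [Real.log_mul (Real.exp_pos _).ne' (by positivity), Real.log_exp]
    have := Real.log_le_sub_one_of_pos (by positivity : 0 < 1 + ε / 4)
    linarith
  rw [h2]
  linarith [(abs_le.1 (hv k)).2]

/-- Whenever the features of an observation are well approximated and lie in the box where the sums of
ReLUs approximate the truncated log-probabilities, the softmax is close to Thompson sampling. -/
theorem log_tsPolicy_sub_le {M₀ : ℕ} {lam r ε R γ C₀ e : ℝ} (hε : 0 < ε) (hγ : 0 < γ)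
    {o : Obs d A n} {cf : Fin A → Fin M₀ → ℝ} {w : Fin A → Fin M₀ → Feat d A → ℝ}
    {β : Fin A → Fin M₀ → ℝ} (hcf : ∀ k, ∑ m, |cf k m| ≤ C₀)
    (hw : ∀ k m, ∑ i, |w k m i| + |β k m| ≤ 1)
    (happ : ∀ k, ∀ z ∈ separated d A γ, (∀ i, z i ∈ Set.Icc (-R) R) →
      |truncLogProb (ε / (4 * A)) k z - ∑ m, cf k m * relu (∑ i, w k m i * z i + β k m)| ≤ ε / 4)
    (hsep : tsFeat lam r o ∈ separated d A γ) (hbox : ∀ i, |tsFeat lam r o i| ≤ R) (he : 0 ≤ e)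
    (heC : C₀ * e ≤ ε / 8) {v : Feat d A → ℝ} (hv : ∀ i, |v i - tsFeat lam r o i| ≤ e)
    {k : Fin A} (hk : 0 < tsPolicy lam r o k) :
    Real.log (tsPolicy lam r o k) - Real.log (softmax
      (fun j => ∑ m, cf j m * relu (∑ i, w j m i * v i + β j m)) k) ≤ ε := by
  have hne : ∀ i j, i ≠ j → featX (tsFeat lam r o) i ≠ featX (tsFeat lam r o) j := by
    intro i j hij heq
    have := hsep i j hij
    rw [heq, sub_self, norm_zero] at this
    linarith
  refine log_sub_log_softmax_le hε (p := fun k => tsPolicy lam r o k)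
    (fun k => measureReal_nonneg) ?_ ?_ hk
  · simp only [tsPolicy_eq]
    exact sum_optEvent_le_one hne
  · intro j
    have h1 := happ j _ hsep fun i => abs_le.1 (hbox i)
    have h2 := abs_sum_relu_sub_le (hcf j) (hw j) he hv
    have h3 : truncLogProb (ε / (4 * A)) j (tsFeat lam r o) =
        Real.log (max (tsPolicy lam r o j) (ε / (4 * A))) := by
      rw [tsPolicy_eq]; rfl
    rw [h3] at h1
    rw [abs_le] at h1 h2 ⊢
    constructor <;> linarith [h1.1, h1.2, h2.1, h2.2]

end

end TSTransformer

namespace TSTransformer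

noncomputable section

variable {d A n : ℕ}

/-! ### The features lie in the box and are separated -/

open scoped MatrixOrder in
theorem featX_tsFeat_sub {lam r : ℝ} (o : Obs d A n) (i j : Fin A) :
    featX (tsFeat lam r o) i - featX (tsFeat lam r o) j =
      WithLp.toLp 2 ((CFC.sqrt (r • (tsSigma lam r o)⁻¹)).mulVec
        fun l => (o.current i - o.current j) l) := by
  have : (fun l => (o.current i - o.current j) l) =
      (fun l => o.current i l) - fun l => o.current j l := rfl
  rw [this, Matrix.mulVec_sub]
  rfl

theorem tsFeat_mem_separated {T : ℕ} (hn : n ≤ T) {lam r Ba η : ℝ} (hlam : 0 < lam) (hr : 0 < r)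
    {o : Obs d A n} (ho : ∀ t k, ‖o.1 t k‖ ≤ Ba)
    (hsep : ∀ i j, i ≠ j → η ≤ ‖o.current i - o.current j‖) :
    tsFeat lam r o ∈ separated d A (η * √(r / (r / lam + T * Ba ^ 2))) := by
  intro i j hij
  rw [featX_tsFeat_sub]
  refine le_trans ?_ ((spectrumIn_tsSigma hn hlam hr ho).le_norm_sqrt hr _)
  rw [mul_comm]
  exact mul_le_mul_of_nonneg_left (hsep i j hij) (Real.sqrt_nonneg _)

theorem abs_tsFeat_le {T : ℕ} (hn : n ≤ T) {lam r Ba δ : ℝ} (hlam : 0 < lam) (hr : 0 < r)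
    (hBa : 0 ≤ Ba) {o : Obs d A n} (ho : ∀ t k, ‖o.1 t k‖ ≤ Ba)
    (hμ : ‖tsMean lam r o‖ ≤ 2 * √lam * (1 + 2 * √(Real.log (2 / δ)) + √(d : ℝ))) (i : Feat d A) :
    |tsFeat lam r o i| ≤ featRadius d Ba lam δ := by
  have h0 : √lam * Ba ≤ featRadius d Ba lam δ := by
    have h1 : 0 ≤ √lam * Ba := by positivity
    have h2 : 0 ≤ 2 * √(Real.log (2 / δ)) + √(d : ℝ) := by positivity
    unfold featRadius
    nlinarith
  rcases i with ⟨k, l⟩ | k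
  · have h1 := (spectrumIn_tsSigma hn hlam hr ho).norm_sqrt_le hr fun l => o.current k l
    have h2 := (abs_apply_le_norm _ l).trans h1
    have h3 : r / (r / lam) = lam := by field_simp
    rw [h3] at h2
    exact (h2.trans (mul_le_mul_of_nonneg_left (ho _ _) (Real.sqrt_nonneg _))).trans h0
  · have h1 : |tsFeat lam r o (Sum.inr k)| ≤ ‖tsMean lam r o‖ * ‖o.current k‖ :=
      abs_dotProduct_le (fun l => tsMean lam r o l) fun l => o.current k l
    refine (h1.trans (mul_le_mul hμ (ho _ _) (norm_nonneg _) (by positivity))).trans_eq ?_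
    unfold featRadius
    ring

end

end TSTransformer

namespace TSTransformer

noncomputable section

variable {d A n T : ℕ}

/-! ### Integrating out the future actions -/

open scoped ENNReal

/-- Resampling one coordinate uniformly. -/
theorem sum_sum_update {β : Type*} [AddCommMonoid β] (m : Fin T) (H : (Fin T → Fin A) → β) :
    ∑ k, ∑ a, H (Function.update k m a) = A • ∑ k, H k := by
  have hinv : Function.Involutive fun p : (Fin T → Fin A) × Fin A =>
      (Function.update p.1 m p.2, p.1 m) := by
    rintro ⟨k, a⟩
    simp
  calc ∑ k, ∑ a, H (Function.update k m a)
      = ∑ p : (Fin T → Fin A) × Fin A, H (Function.update p.1 m p.2) := by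
        rw [Fintype.sum_prod_type]
    _ = ∑ p : (Fin T → Fin A) × Fin A, H p.1 :=
        Fintype.sum_equiv hinv.toPerm _ _ fun p => rfl
    _ = A • ∑ k, H k := by
        rw [Fintype.sum_prod_type, Finset.smul_sum]
        simp

/-- If `q s k` are conditional probabilities of the `s`-th coordinate of `k` given the previous ones,
then summing a function of the first `m` coordinates against all of them only involves the first `m`
factors. The power of `A` accounts for the free coordinates that remain in the sum. -/
theorem pow_mul_sum_mul_prod {q : Fin T → (Fin T → Fin A) → ℝ≥0∞}
    (hdep : ∀ m k k', (∀ s ≤ m, k s = k' s) → q m k = q m k')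
    (hsum : ∀ m k, ∑ a, q m (Function.update k m a) = 1) (j : ℕ) :
    ∀ (m : ℕ) (_ : m + j = T) (F : (Fin T → Fin A) → ℝ≥0∞)
      (_ : ∀ k k', (∀ s : Fin T, s.1 < m → k s = k' s) → F k = F k'),
      (A : ℝ≥0∞) ^ j * ∑ k, F k * ∏ s, q s k =
        ∑ k, F k * ∏ s : Fin T with s.1 < m, q s k := by
  induction j with
  | zero =>
    intro m hm F _
    have : (Finset.univ.filter fun s : Fin T => s.1 < m) = Finset.univ := by
      ext s
      have := s.2
      simp
      omega
    rw [this, pow_zero, one_mul]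
  | succ j ih =>
    intro m hm F hF
    have hlt : m < T := by omega
    set m' : Fin T := ⟨m, hlt⟩
    have h1 := ih (m + 1) (by omega) F fun k k' h => hF k k' fun s hs => h s (by omega)
    have hset : (Finset.univ.filter fun s : Fin T => s.1 < m + 1) =
        insert m' (Finset.univ.filter fun s : Fin T => s.1 < m) := by
      ext s
      simp [m', Fin.ext_iff]
      omega
    have hG : ∀ k a, F (Function.update k m' a) *
        ∏ s : Fin T with s.1 < m, q s (Function.update k m' a) =
        F k * ∏ s : Fin T with s.1 < m, q s k := by
      intro k a
      have hk : ∀ s : Fin T, s.1 < m → Function.update k m' a s = k s := fun s hs =>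
        Function.update_of_ne (by rintro rfl; exact lt_irrefl _ hs) _ _
      rw [hF _ _ hk]
      congr 1
      refine Finset.prod_congr rfl fun s hs => hdep _ _ _ fun u hu => hk u ?_
      exact lt_of_le_of_lt hu (by simpa using hs)
    have h2 := sum_sum_update m' fun k => F k * ∏ s : Fin T with s.1 < m + 1, q s k
    have h3 : ∀ k, ∑ a, F (Function.update k m' a) *
        ∏ s : Fin T with s.1 < m + 1, q s (Function.update k m' a) =
        F k * ∏ s : Fin T with s.1 < m, q s k := by
      intro k
      have h4 : ∀ a, F (Function.update k m' a) *
          ∏ s : Fin T with s.1 < m + 1, q s (Function.update k m' a) =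
          (F k * ∏ s : Fin T with s.1 < m, q s k) * q m' (Function.update k m' a) := by
        intro a
        rw [hset, Finset.prod_insert (by simp [m']), mul_left_comm, hG, mul_comm]
      simp_rw [h4]
      rw [← Finset.mul_sum, hsum, mul_one]
    simp_rw [h3] at h2
    rw [pow_succ', mul_assoc, h1, h2, nsmul_eq_mul]

/-- The probability that the algorithm selects `k s` at round `s`, given the past. -/
def stepProb (alg : Algorithm d A T) (e : Env d A T) (s : Fin T) (k : Fin T → Fin A) : ℝ≥0∞ :=
  ENNReal.ofReal (alg.prob s (obsAt e k s) (k s))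

theorem obsAt_congr (e : Env d A T) {k k' : Fin T → Fin A} {t : Fin T}
    (h : ∀ s < t, k s = k' s) : obsAt e k t = obsAt e k' t := by
  unfold obsAt
  refine Prod.ext rfl ?_
  funext j
  have := h ⟨j.1, by omega⟩ (Fin.lt_def.2 j.2)
  simp only [this]

theorem stepProb_congr (alg : Algorithm d A T) (e : Env d A T) (m : Fin T) (k k' : Fin T → Fin A)
    (h : ∀ s ≤ m, k s = k' s) : stepProb alg e m k = stepProb alg e m k' := by
  rw [stepProb, stepProb, obsAt_congr e fun s hs => h s hs.le, h m le_rfl]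

theorem sum_stepProb_update (alg : Algorithm d A T) (e : Env d A T) (m : Fin T)
    (k : Fin T → Fin A) : ∑ a, stepProb alg e m (Function.update k m a) = 1 := by
  have h : ∀ a, stepProb alg e m (Function.update k m a) =
      ENNReal.ofReal (alg.prob m (obsAt e k m) a) := by
    intro a
    rw [stepProb, Function.update_self,
      obsAt_congr e (k' := k) fun s hs => Function.update_of_ne hs.ne _ _]
  simp_rw [h]
  rw [← ENNReal.ofReal_sum_of_nonneg fun a _ => alg.nonneg _ _ _, alg.sum_eq_one, ENNReal.ofReal_one]

/-! ### Measurability of the interaction -/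

theorem measurable_obsAt (k : Fin T → Fin A) (t : Fin T) :
    Measurable fun e : Env d A T => obsAt e k t := by
  unfold obsAt
  refine Measurable.prodMk (by fun_prop) (measurable_pi_lambda _ fun j => ?_)
  refine Measurable.prodMk measurable_const ?_
  fun_prop

theorem measurable_stepProb (alg : Algorithm d A T) (s : Fin T) (k : Fin T → Fin A) :
    Measurable fun e => stepProb alg e s k :=
  ((alg.measurable s (k s)).comp (measurable_obsAt k s)).ennreal_ofReal

/-- The posterior mean as a function of the selected actions and the rewards. -/
def ridge (lam r : ℝ) (x : (Fin n → Vec d) × (Fin n → ℝ)) : Vec d :=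
  WithLp.toLp 2 (((r / lam) • (1 : Matrix (Fin d) (Fin d) ℝ) + ∑ j : Fin n,
    Matrix.vecMulVec (fun l => x.1 j l) (fun l => x.1 j l))⁻¹.mulVec
      (∑ j : Fin n, x.2 j • fun l => x.1 j l))

theorem tsMean_eq_ridge (lam r : ℝ) (o : Obs d A n) :
    tsMean lam r o = ridge lam r (fun j => o.action j, fun j => o.reward j) := rfl

theorem measurable_ridge (lam r : ℝ) : Measurable (ridge (d := d) (n := n) lam r) := by
  unfold ridge
  have hS : Continuous fun x : (Fin n → Vec d) × (Fin n → ℝ) =>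
      (r / lam) • (1 : Matrix (Fin d) (Fin d) ℝ) + ∑ j : Fin n,
        Matrix.vecMulVec (fun l => x.1 j l) (fun l => x.1 j l) := by
    refine continuous_const.add (continuous_finsetSum _ fun j _ => ?_)
    exact Continuous.matrix_vecMulVec (by fun_prop) (by fun_prop)
  have hb : Continuous fun x : (Fin n → Vec d) × (Fin n → ℝ) =>
      ∑ j : Fin n, x.2 j • fun l => x.1 j l := by
    refine continuous_finsetSum _ fun j _ => ?_
    fun_prop
  simp_rw [Matrix.inv_def, Ring.inverse_eq_inv', Matrix.smul_mulVec, WithLp.toLp_smul]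
  refine Measurable.smul hS.matrix_det.measurable.inv ?_
  have h1 := hS.matrix_adjugate.matrix_mulVec hb
  exact ((PiLp.continuous_toLp 2 _).comp h1).measurable

theorem measurable_tsMean_obsAt (lam r : ℝ) (k : Fin T → Fin A) (t : Fin T) :
    Measurable fun e : Env d A T => tsMean lam r (obsAt e k t) := by
  have h : Measurable fun e : Env d A T =>
      ((fun j => (obsAt e k t).action j, fun j => (obsAt e k t).reward j) :
        (Fin t.1 → Vec d) × (Fin t.1 → ℝ)) := by
    simp only [obsAt, Obs.action, Obs.reward]
    fun_prop
  simp only [tsMean_eq_ridge]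
  exact (measurable_ridge lam r).comp h

/-! ### The law of the trajectory -/

variable {ν : Measure (Fin T → ActionSet d A)} {lam r : ℝ}

theorem trajLaw_apply (alg : Algorithm d A T) {S : Set (Env d A T × (Fin T → Fin A))}
    (hS : MeasurableSet S) : trajLaw ν lam r alg S =
      ∑ k, ∫⁻ e, S.indicator (fun _ => (1 : ℝ≥0∞)) (e, k) * ∏ s, stepProb alg e s k ∂(envLaw ν lam r) := by
  have hw : ∀ k : Fin T → Fin A, (fun e : Env d A T =>
      ENNReal.ofReal (∏ t : Fin T, alg.prob t (obsAt e k t) (k t))) =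
      fun e => ∏ s, stepProb alg e s k := by
    intro k
    funext e
    exact ENNReal.ofReal_prod_of_nonneg fun t _ => alg.nonneg _ _ _
  rw [trajLaw, Measure.finsetSum_apply]
  refine Finset.sum_congr rfl fun k _ => ?_
  have hm : Measurable fun e : Env d A T => (e, k) := by fun_prop
  rw [Measure.map_apply hm hS, withDensity_apply _ (hm hS), hw, ← lintegral_indicator (hm hS)]
  refine lintegral_congr fun e => ?_
  by_cases h : (e, k) ∈ S
  · rw [Set.indicator_of_mem (by exact h), Set.indicator_of_mem h, one_mul]
  · rw [Set.indicator_of_notMem (by exact h), Set.indicator_of_notMem h, zero_mul]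

theorem measurable_indicator_slice {S : Set (Env d A T × (Fin T → Fin A))} (hS : MeasurableSet S)
    (k : Fin T → Fin A) : Measurable fun e => S.indicator (fun _ => (1 : ℝ≥0∞)) (e, k) :=
  (measurable_const.indicator hS).comp measurable_prodMk_right

/-- Events that only depend on the first `m` actions. -/
def DependsOnPast (m : ℕ) (S : Set (Env d A T × (Fin T → Fin A))) : Prop :=
  ∀ e k k', (∀ s : Fin T, s.1 < m → k s = k' s) → ((e, k) ∈ S ↔ (e, k') ∈ S)

theorem pow_mul_trajLaw (alg : Algorithm d A T) {S : Set (Env d A T × (Fin T → Fin A))}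
    (hS : MeasurableSet S) {m : ℕ} (hm : m ≤ T) (hdep : DependsOnPast m S) :
    (A : ℝ≥0∞) ^ (T - m) * trajLaw ν lam r alg S =
      ∑ k, ∫⁻ e, S.indicator (fun _ => (1 : ℝ≥0∞)) (e, k) * ∏ s : Fin T with s.1 < m, stepProb alg e s k
        ∂(envLaw ν lam r) := by
  have hmeas := measurable_stepProb alg
  rw [trajLaw_apply alg hS, ← lintegral_finsetSum, ← lintegral_finsetSum,
    ← lintegral_const_mul]
  · refine lintegral_congr fun e => ?_
    refine pow_mul_sum_mul_prod (q := stepProb alg e) (stepProb_congr alg e)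
      (sum_stepProb_update alg e) (T - m) m (by omega) (fun k => S.indicator (fun _ => (1 : ℝ≥0∞)) (e, k)) ?_
    intro k k' h
    by_cases hk : (e, k) ∈ S
    · rw [Set.indicator_of_mem hk, Set.indicator_of_mem ((hdep e k k' h).1 hk)]
    · rw [Set.indicator_of_notMem hk, Set.indicator_of_notMem fun h' => hk ((hdep e k k' h).2 h')]
  · exact Finset.measurable_sum _ fun k _ => (measurable_indicator_slice hS k).mul
      (Finset.measurable_prod _ fun s _ => hmeas s k)
  · exact fun k _ => (measurable_indicator_slice hS k).mul
      (Finset.measurable_prod _ fun s _ => hmeas s k)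
  · exact fun k _ => (measurable_indicator_slice hS k).mul
      (Finset.measurable_prod _ fun s _ => hmeas s k)

/-- The environment has law `envLaw` under the law of the trajectory. -/
theorem trajLaw_fst (hA : 1 ≤ A) (alg : Algorithm d A T) {E : Set (Env d A T)}
    (hE : MeasurableSet E) : trajLaw ν lam r alg {x | x.1 ∈ E} = envLaw ν lam r E := by
  have hS : MeasurableSet {x : Env d A T × (Fin T → Fin A) | x.1 ∈ E} := measurable_fst hE
  have h := pow_mul_trajLaw (ν := ν) (lam := lam) (r := r) alg hS (Nat.zero_le T)
    fun e k k' _ => Iff.rfl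
  have h2 : ∀ k : Fin T → Fin A, ∫⁻ e,
      ({x : Env d A T × (Fin T → Fin A) | x.1 ∈ E}).indicator (fun _ => (1 : ℝ≥0∞)) (e, k) *
        ∏ s : Fin T with s.1 < 0, stepProb alg e s k ∂(envLaw ν lam r) = envLaw ν lam r E := by
    intro k
    rw [← lintegral_indicator_one hE]
    refine lintegral_congr fun e => ?_
    simp [Set.indicator]
  simp_rw [h2] at h
  rw [Finset.sum_const, Finset.card_univ, Fintype.card_fun, Fintype.card_fin, Fintype.card_fin,
    nsmul_eq_mul, Nat.sub_zero, Nat.cast_pow] at h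
  have hA0 : (A : ℝ≥0∞) ^ T ≠ 0 := pow_ne_zero _ (by exact_mod_cast (by omega : A ≠ 0))
  exact (ENNReal.mul_right_inj hA0 (ENNReal.pow_ne_top (ENNReal.natCast_ne_top A))).1 h

end

end TSTransformer

namespace TSTransformer

noncomputable section

variable {d A n T : ℕ}

/-! ### The reflection of the environment at the posterior mean -/

open scoped ENNReal

/-- The joint law of the parameter and of the noises. -/
def paramLaw (d T : ℕ) (lam r : ℝ) : Measure (Vec d × (Fin T → ℝ)) :=
  (multivariateGaussian (0 : Vec d) (lam • 1)).prod
    (Measure.pi fun _ : Fin T => gaussianReal 0 r.toNNReal)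

instance (d T : ℕ) (lam r : ℝ) : IsProbabilityMeasure (paramLaw d T lam r) := by
  unfold paramLaw; infer_instance

/-- A linear form on the space of parameters and noises. -/
def linForm (ξ : Vec d) (η : Fin T → ℝ) (x : Vec d × (Fin T → ℝ)) : ℝ :=
  inner ℝ x.1 ξ + ∑ j, x.2 j * η j

theorem integral_exp_linForm {lam r : ℝ} (hlam : 0 < lam) (hr : 0 < r) (ξ : Vec d)
    (η : Fin T → ℝ) :
    ∫ x, Complex.exp (linForm ξ η x * Complex.I) ∂(paramLaw d T lam r) =
      Complex.exp (-(((lam * ‖ξ‖ ^ 2 + r * ∑ j, η j ^ 2) / 2 : ℝ) : ℂ)) := by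
  have h1 : ∀ x : Vec d × (Fin T → ℝ), Complex.exp (linForm ξ η x * Complex.I) =
      Complex.exp ((inner ℝ x.1 ξ : ℝ) * Complex.I) *
        ∏ j, Complex.exp ((inner ℝ (x.2 j) (η j) : ℝ) * Complex.I) := by
    intro x
    rw [← Complex.exp_sum, ← Complex.exp_add, ← Finset.sum_mul, ← add_mul]
    congr 2
    rw [linForm]
    push_cast
    congr 1
    refine Finset.sum_congr rfl fun j _ => ?_
    simp [mul_comm]
  simp_rw [h1]
  rw [paramLaw, integral_prod_mul (fun w : Vec d => Complex.exp ((inner ℝ w ξ : ℝ) * Complex.I))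
    (fun e : Fin T → ℝ => ∏ j, Complex.exp ((inner ℝ (e j) (η j) : ℝ) * Complex.I)),
    integral_fintype_prod_eq_prod
      (fun j (e : ℝ) => Complex.exp ((inner ℝ e (η j) : ℝ) * Complex.I))]
  simp_rw [← charFun_apply]
  have hps : (lam • (1 : Matrix (Fin d) (Fin d) ℝ)).PosSemidef :=
    Matrix.PosSemidef.one.smul hlam.le
  rw [charFun_multivariateGaussian hps]
  simp_rw [charFun_gaussianReal]
  rw [← Complex.exp_sum, ← Complex.exp_add]
  congr 1
  have h2 : ξ.ofLp ⬝ᵥ (lam • (1 : Matrix (Fin d) (Fin d) ℝ)).mulVec ξ.ofLp = lam * ‖ξ‖ ^ 2 := by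
    rw [Matrix.smul_mulVec, Matrix.one_mulVec, dotProduct_smul, ← norm_toLp_sq, smul_eq_mul]
  rw [h2]
  simp only [inner_zero_right, Complex.ofReal_zero, zero_mul, mul_zero, zero_sub,
    Finset.sum_neg_distrib]
  rw [Real.coe_toNNReal _ hr.le, ← Finset.sum_div, ← Finset.mul_sum]
  push_cast
  ring

/-- A map of the parameters and noises that acts on linear forms without changing their variance
preserves the law. -/
theorem map_paramLaw_eq {lam r : ℝ} (hlam : 0 < lam) (hr : 0 < r)
    {g : Vec d × (Fin T → ℝ) → Vec d × (Fin T → ℝ)} (hg : Measurable g)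
    (h : ∀ (ξ : Vec d) (η : Fin T → ℝ), ∃ (ξ' : Vec d) (η' : Fin T → ℝ),
      lam * ‖ξ'‖ ^ 2 + r * ∑ j, η' j ^ 2 = lam * ‖ξ‖ ^ 2 + r * ∑ j, η j ^ 2 ∧
      ∀ x, linForm ξ η (g x) = linForm ξ' η' x) :
    (paramLaw d T lam r).map g = paramLaw d T lam r := by
  have : IsProbabilityMeasure ((paramLaw d T lam r).map g) :=
    Measure.isProbabilityMeasure_map hg.aemeasurable
  refine Measure.ext_of_charFunDual ?_
  funext L
  have hL : ∃ (ξ : Vec d) (η : Fin T → ℝ), ∀ x, L x = linForm ξ η x := by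
    refine ⟨(InnerProductSpace.toDual ℝ (Vec d)).symm (L ∘SL ContinuousLinearMap.inl ℝ _ _),
      fun j => L (0, Pi.single j 1), fun x => ?_⟩
    have h1 : L x = L (x.1, 0) + L (0, x.2) := by
      rw [← map_add]; simp
    have h2 : L (0, x.2) = ∑ j, x.2 j * L (0, Pi.single j 1) := by
      have h3 : x.2 = ∑ j, x.2 j • (Pi.single j 1 : Fin T → ℝ) := by
        rw [← pi_eq_sum_univ']
      have h4 := map_sum (L ∘SL ContinuousLinearMap.inr ℝ (Vec d) (Fin T → ℝ))
        (fun j => x.2 j • (Pi.single j 1 : Fin T → ℝ)) Finset.univ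
      rw [← h3] at h4
      simpa [map_smul] using h4
    rw [linForm, real_inner_comm, InnerProductSpace.toDual_symm_apply, h1, h2]
    rfl
  obtain ⟨ξ, η, hL⟩ := hL
  obtain ⟨ξ', η', hq, hlin⟩ := h ξ η
  have hcont : Continuous fun v => Complex.exp ((L v : ℂ) * Complex.I) := by fun_prop
  rw [charFunDual_apply, charFunDual_apply, integral_map hg.aemeasurable
    hcont.aestronglyMeasurable]
  simp_rw [hL, hlin]
  rw [integral_exp_linForm hlam hr, integral_exp_linForm hlam hr, hq]

/-- Reflection of the parameter at the posterior mean of round `t`, for the actions `k`; the noises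
of the rounds before `t` are changed such that the rewards of these rounds stay the same. -/
def reflect (lam r : ℝ) (k : Fin T → Fin A) (t : Fin T) (e : Env d A T) : Env d A T :=
  (e.1, (2 : ℝ) • tsMean lam r (obsAt e k t) - e.2.1, fun j =>
    if j < t then e.2.2 j + 2 * inner ℝ (e.1 j (k j)) (e.2.1 - tsMean lam r (obsAt e k t))
    else e.2.2 j)

theorem obsAt_reflect (lam r : ℝ) (k : Fin T → Fin A) (t : Fin T) (e : Env d A T) {s : Fin T}
    (hs : s ≤ t) : obsAt (reflect lam r k t e) k s = obsAt e k s := by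
  unfold obsAt
  refine Prod.ext rfl (funext fun j => Prod.ext rfl ?_)
  have hj : (⟨j.1, by omega⟩ : Fin T) < t := lt_of_lt_of_le (Fin.lt_def.2 j.2) hs
  simp only [reflect, if_pos hj, inner_sub_right, inner_smul_right]
  ring

theorem sum_castLE {t : Fin T} {β : Type*} [AddCommMonoid β] (f : Fin T → β) :
    ∑ j : Fin t.1, f ⟨j.1, by omega⟩ = ∑ j, if j < t then f j else 0 := by
  refine Fintype.sum_of_injective (Fin.castLE t.2.le) (Fin.castLE_injective _) _ _ ?_ ?_
  · intro i hi
    rw [if_neg]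
    intro hlt
    exact hi ⟨⟨i.1, hlt⟩, rfl⟩
  · intro i
    rw [if_pos (Fin.lt_def.2 i.2)]
    rfl

theorem measurable_reflect (lam r : ℝ) (k : Fin T → Fin A) (t : Fin T) :
    Measurable (reflect (d := d) lam r k t) := by
  have h := measurable_tsMean_obsAt (d := d) lam r k t
  unfold reflect
  refine Measurable.prodMk (by fun_prop) (Measurable.prodMk (by fun_prop)
    (measurable_pi_lambda _ fun j => ?_))
  by_cases hj : j < t
  · simp only [if_pos hj]
    fun_prop
  · simp only [if_neg hj]
    fun_prop

/-- The matrix `Σ` as an operator on Euclidean space. -/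
theorem tsSigma_toLp_mulVec (lam r : ℝ) (o : Obs d A n) (v : Vec d) :
    (WithLp.toLp 2 ((tsSigma lam r o).mulVec v.ofLp) : Vec d) =
      (r / lam) • v + ∑ j, (inner ℝ (o.action j) v : ℝ) • o.action j := by
  have h : (tsSigma lam r o).mulVec v.ofLp = (r / lam) • v.ofLp +
      ∑ j, (inner ℝ (o.action j) v : ℝ) • fun l => o.action j l := by
    rw [tsSigma, Matrix.add_mulVec, Matrix.smul_mulVec, Matrix.one_mulVec, Matrix.sum_mulVec]
    congr 1
    refine Finset.sum_congr rfl fun j _ => ?_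
    rw [Matrix.vecMulVec_mulVec, EuclideanSpace.inner_eq_star_dotProduct, star_trivial,
      dotProduct_comm]
    simp
  rw [h, WithLp.toLp_add, WithLp.toLp_smul, WithLp.toLp_sum]
  simp only [WithLp.toLp_smul]

theorem isUnit_det_tsSigma {lam r : ℝ} (hlam : 0 < lam) (hr : 0 < r) (o : Obs d A n) :
    IsUnit (tsSigma lam r o).det := by
  refine (spectrumIn_tsSigma (T := n) (Ba := ∑ t, ∑ k, ‖o.1 t k‖) le_rfl hlam hr
    fun t k => ?_).isUnit_det
  calc ‖o.1 t k‖ ≤ ∑ k, ‖o.1 t k‖ :=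
        Finset.single_le_sum (f := fun k => ‖o.1 t k‖) (fun _ _ => norm_nonneg _)
          (Finset.mem_univ k)
    _ ≤ _ := Finset.single_le_sum (f := fun t => ∑ k, ‖o.1 t k‖)
        (fun _ _ => Finset.sum_nonneg fun _ _ => norm_nonneg _) (Finset.mem_univ t)

theorem exists_tsSigma_eq {lam r : ℝ} (hlam : 0 < lam) (hr : 0 < r) (o : Obs d A n) (b : Vec d) :
    ∃ z : Vec d, (r / lam) • z + ∑ j, (inner ℝ (o.action j) z : ℝ) • o.action j = b := by
  refine ⟨WithLp.toLp 2 ((tsSigma lam r o)⁻¹.mulVec b.ofLp), ?_⟩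
  rw [← tsSigma_toLp_mulVec, WithLp.ofLp_toLp, Matrix.mulVec_mulVec,
    Matrix.mul_nonsing_inv _ (isUnit_det_tsSigma hlam hr o), Matrix.one_mulVec]

/-- The normal equations of the posterior mean. -/
theorem tsMean_normal_eq {lam r : ℝ} (hlam : 0 < lam) (hr : 0 < r) (o : Obs d A n) :
    (r / lam) • tsMean lam r o + ∑ j, (inner ℝ (o.action j) (tsMean lam r o) : ℝ) • o.action j =
      ∑ j, o.reward j • o.action j := by
  rw [← tsSigma_toLp_mulVec, tsMean, Matrix.mulVec_mulVec,
    Matrix.mul_nonsing_inv _ (isUnit_det_tsSigma hlam hr o), Matrix.one_mulVec, WithLp.toLp_sum]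
  simp only [WithLp.toLp_smul]

/-- How the reflection at the solution `μ` of the normal equations acts on linear forms. -/
theorem inner_residual {ι : Type*} {s : Finset ι} {c : ℝ} {a : ι → Vec d} {ε η : ι → ℝ}
    {ξ z w μ : Vec d}
    (hz : c • z + ∑ j ∈ s, (inner ℝ (a j) z : ℝ) • a j = ξ - ∑ j ∈ s, η j • a j)
    (hμ : c • μ + ∑ j ∈ s, (inner ℝ (a j) μ : ℝ) • a j =
      ∑ j ∈ s, ((inner ℝ (a j) w : ℝ) + ε j) • a j) :
    inner ℝ (w - μ) ξ - ∑ j ∈ s, η j * inner ℝ (a j) (w - μ) =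
      c * inner ℝ w z - ∑ j ∈ s, ε j * inner ℝ (a j) z := by
  have h1 := congrArg (fun v => (inner ℝ v (w - μ) : ℝ)) hz
  have h2 := congrArg (fun v => (inner ℝ v z : ℝ)) hμ
  simp only [inner_add_left, inner_sub_left, inner_smul_left, sum_inner, RCLike.conj_to_real,
    inner_sub_right, mul_sub, add_mul, Finset.sum_add_distrib, Finset.sum_sub_distrib] at h1 h2 ⊢
  rw [real_inner_comm w z, real_inner_comm μ z, real_inner_comm w ξ, real_inner_comm μ ξ] at h1
  have h3 : ∑ j ∈ s, inner ℝ (a j) z * inner ℝ (a j) w =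
      ∑ j ∈ s, inner ℝ (a j) w * inner ℝ (a j) z := by simp only [mul_comm]
  have h4 : ∑ j ∈ s, inner ℝ (a j) z * inner ℝ (a j) μ =
      ∑ j ∈ s, inner ℝ (a j) μ * inner ℝ (a j) z := by simp only [mul_comm]
  linarith

/-- The reflection preserves the variance of linear forms. -/
theorem reflected_variance {ι : Type*} {s : Finset ι} {lam r : ℝ} (hlam : 0 < lam)
    {a : ι → Vec d} {η : ι → ℝ} {ξ z : Vec d}
    (hz : (r / lam) • z + ∑ j ∈ s, (inner ℝ (a j) z : ℝ) • a j = ξ - ∑ j ∈ s, η j • a j) :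
    lam * ‖ξ - (2 * (r / lam)) • z‖ ^ 2 + r * ∑ j ∈ s, (η j + 2 * inner ℝ (a j) z) ^ 2 =
      lam * ‖ξ‖ ^ 2 + r * ∑ j ∈ s, η j ^ 2 := by
  have h1 := congrArg (fun v => (inner ℝ v z : ℝ)) hz
  simp only [inner_add_left, inner_sub_left, inner_smul_left, sum_inner, RCLike.conj_to_real]
    at h1
  have h2 : ∀ j, (η j + 2 * inner ℝ (a j) z) ^ 2 =
      η j ^ 2 + 4 * (η j * inner ℝ (a j) z) + 4 * (inner ℝ (a j) z * inner ℝ (a j) z) := by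
    intro j; ring
  simp_rw [h2, Finset.sum_add_distrib, ← Finset.mul_sum]
  rw [norm_sub_sq_real, norm_smul, mul_pow, inner_smul_right, ← real_inner_self_eq_norm_sq z,
    Real.norm_eq_abs, sq_abs]
  have h3 : lam * (r / lam) = r := by field_simp
  linear_combination (4 * r) * h1 +
    (4 * (r / lam) * inner ℝ z z - 4 * inner ℝ ξ z) * h3

/-- Given the action sets, the parameter and the noises are jointly Gaussian, so that it suffices to
compare the variances of linear forms. -/
theorem measurePreserving_reflect {ν : Measure (Fin T → ActionSet d A)} [SFinite ν] {lam r : ℝ}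
    (hlam : 0 < lam) (hr : 0 < r) (k : Fin T → Fin A) (t : Fin T) :
    MeasurePreserving (reflect lam r k t) (envLaw ν lam r) (envLaw ν lam r) := by
  have hm := measurable_reflect (d := d) lam r k t
  refine MeasurePreserving.skew_product (μa := ν) (μb := ν) (μc := paramLaw d T lam r)
    (μd := paramLaw d T lam r) (f := id) (MeasurePreserving.id ν)
    (g := fun α x => (reflect lam r k t (α, x)).2) (measurable_snd.comp hm)
    (Filter.Eventually.of_forall fun α => ?_)
  refine map_paramLaw_eq hlam hr (measurable_snd.comp (hm.comp measurable_prodMk_left)) ?_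
  intro ξ η
  set a : Fin T → Vec d := fun j => α j (k j)
  set s : Finset (Fin T) := Finset.univ.filter fun j => j < t
  have hsum : ∀ (x : Vec d × (Fin T → ℝ)) (f : Fin T → Vec d),
      ∑ j : Fin t.1, f ⟨j.1, by omega⟩ = ∑ j ∈ s, f j := by
    intro x f
    rw [sum_castLE f, Finset.sum_filter]
  obtain ⟨z, hz⟩ := exists_tsSigma_eq hlam hr (obsAt (α, ((0 : Vec d), (0 : Fin T → ℝ))) k t)
    (ξ - ∑ j ∈ s, η j • a j)
  have hz' : (r / lam) • z + ∑ j ∈ s, (inner ℝ (a j) z : ℝ) • a j = ξ - ∑ j ∈ s, η j • a j := by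
    rw [← hz, ← hsum (0, 0) fun j => (inner ℝ (a j) z : ℝ) • a j]
    rfl
  have hite : ∀ f g : Fin T → ℝ, ∑ j, (if j < t then f j + g j else f j) =
      ∑ j, f j + ∑ j ∈ s, g j := by
    intro f g
    rw [Finset.sum_filter, ← Finset.sum_add_distrib]
    refine Finset.sum_congr rfl fun j _ => ?_
    split_ifs <;> simp
  refine ⟨ξ - (2 * (r / lam)) • z, fun j => if j < t then η j + 2 * inner ℝ (a j) z else η j,
    ?_, fun x => ?_⟩
  · have h1 := reflected_variance hlam hz'
    have h2 : ∑ j, (if j < t then η j + 2 * inner ℝ (a j) z else η j) ^ 2 =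
        ∑ j, η j ^ 2 + ∑ j ∈ s, ((η j + 2 * inner ℝ (a j) z) ^ 2 - η j ^ 2) := by
      rw [← hite]
      refine Finset.sum_congr rfl fun j _ => ?_
      split_ifs <;> ring
    rw [h2, Finset.sum_sub_distrib]
    linarith
  · have hμ := tsMean_normal_eq hlam hr (obsAt (α, x) k t)
    have hμ' : (r / lam) • tsMean lam r (obsAt (α, x) k t) +
        ∑ j ∈ s, (inner ℝ (a j) (tsMean lam r (obsAt (α, x) k t)) : ℝ) • a j =
        ∑ j ∈ s, ((inner ℝ (a j) x.1 : ℝ) + x.2 j) • a j := by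
      rw [← hsum x fun j => (inner ℝ (a j) (tsMean lam r (obsAt (α, x) k t)) : ℝ) • a j,
        ← hsum x fun j => ((inner ℝ (a j) x.1 : ℝ) + x.2 j) • a j]
      exact hμ
    have h1 := inner_residual hz' hμ'
    have h2 : linForm ξ η (reflect lam r k t (α, x)).2 =
        inner ℝ ((2 : ℝ) • tsMean lam r (obsAt (α, x) k t) - x.1) ξ + (∑ j, x.2 j * η j +
          ∑ j ∈ s, 2 * (η j * inner ℝ (a j) (x.1 - tsMean lam r (obsAt (α, x) k t)))) := by
      rw [← hite]
      simp only [linForm, reflect]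
      congr 1
      refine Finset.sum_congr rfl fun j _ => ?_
      split_ifs
      · ring
      · rfl
    have h3 : linForm (ξ - (2 * (r / lam)) • z)
        (fun j => if j < t then η j + 2 * inner ℝ (a j) z else η j) x =
        inner ℝ x.1 (ξ - (2 * (r / lam)) • z) + (∑ j, x.2 j * η j +
          ∑ j ∈ s, 2 * (x.2 j * inner ℝ (a j) z)) := by
      rw [← hite, linForm]
      congr 1
      refine Finset.sum_congr rfl fun j _ => ?_
      split_ifs
      · ring
      · rfl
    rw [h2, h3, ← Finset.mul_sum, ← Finset.mul_sum]
    simp only [inner_sub_left, inner_sub_right, inner_smul_left, inner_smul_right,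
      RCLike.conj_to_real] at h1 ⊢
    linarith

end

end TSTransformer

namespace TSTransformer

noncomputable section

variable {d A n T : ℕ}

/-! ### A maximal inequality for the posterior means -/

open scoped ENNReal

theorem measurable_tsMean_traj (lam r : ℝ) (t : Fin T) :
    Measurable fun x : Env d A T × (Fin T → Fin A) => tsMean lam r (obsAt x.1 x.2 t) :=
  measurable_from_prod_countable_left fun k => measurable_tsMean_obsAt lam r k t

/-- The event that `t` is the first round whose posterior mean leaves the ball of radius `ρ`. -/
def firstExit (d A : ℕ) (lam r ρ : ℝ) (t : Fin T) : Set (Env d A T × (Fin T → Fin A)) :=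
  {x | ρ < ‖tsMean lam r (obsAt x.1 x.2 t)‖ ∧ ∀ s < t, ‖tsMean lam r (obsAt x.1 x.2 s)‖ ≤ ρ}

theorem measurableSet_firstExit (lam r ρ : ℝ) (t : Fin T) :
    MeasurableSet (firstExit d A lam r ρ t) := by
  have h := fun t : Fin T => measurable_tsMean_traj (d := d) (A := A) lam r t
  refine (measurableSet_lt measurable_const (h t).norm).inter ?_
  change MeasurableSet {x : Env d A T × (Fin T → Fin A) |
    ∀ s < t, ‖tsMean lam r (obsAt x.1 x.2 s)‖ ≤ ρ}
  simp only [Set.ofPred_forall]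
  exact MeasurableSet.iInter fun s => MeasurableSet.iInter fun _ =>
    measurableSet_le (h s).norm measurable_const

theorem mem_firstExit_congr {lam r ρ : ℝ} {t : Fin T} {e e' : Env d A T} {k k' : Fin T → Fin A}
    (h : ∀ s ≤ t, obsAt e k s = obsAt e' k' s) :
    (e, k) ∈ firstExit d A lam r ρ t ↔ (e', k') ∈ firstExit d A lam r ρ t := by
  simp only [firstExit, Set.mem_ofPred_eq, h t le_rfl]
  refine and_congr Iff.rfl (forall₂_congr fun s hs => ?_)
  rw [h s hs.le]

variable {ν : Measure (Fin T → ActionSet d A)} [IsProbabilityMeasure ν] {lam r : ℝ}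

/-- By reflection, conditionally on the first exit at round `t` the parameter is large with
probability at least one half. -/
theorem trajLaw_firstExit_le (hA : 1 ≤ A) (hlam : 0 < lam) (hr : 0 < r) (alg : Algorithm d A T)
    (ρ : ℝ) (t : Fin T) : trajLaw ν lam r alg (firstExit d A lam r ρ t) ≤
      2 * trajLaw ν lam r alg (firstExit d A lam r ρ t ∩ {x | ρ ≤ ‖x.1.2.1‖}) := by
  set S := firstExit d A lam r ρ t with hSdef
  set W : Set (Env d A T × (Fin T → Fin A)) := {x | ρ ≤ ‖x.1.2.1‖} with hWdef
  have hS : MeasurableSet S := measurableSet_firstExit lam r ρ t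
  have hW : MeasurableSet W := measurableSet_le measurable_const (by fun_prop)
  have hdep : DependsOnPast t.1 S := by
    intro e k k' h
    exact mem_firstExit_congr fun s hs =>
      obsAt_congr e fun u hu => h u (Fin.lt_def.1 (lt_of_lt_of_le hu hs))
  have hdep' : DependsOnPast t.1 (S ∩ W) := by
    intro e k k' h
    exact and_congr (hdep e k k' h) Iff.rfl
  have hA0 : (A : ℝ≥0∞) ^ (T - t.1) ≠ 0 := pow_ne_zero _ (by exact_mod_cast (by omega : A ≠ 0))
  have hAt : (A : ℝ≥0∞) ^ (T - t.1) ≠ ⊤ := ENNReal.pow_ne_top (ENNReal.natCast_ne_top A)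
  rw [← ENNReal.mul_le_mul_iff_right hA0 hAt, mul_left_comm, pow_mul_trajLaw alg hS t.2.le hdep,
    pow_mul_trajLaw alg (hS.inter hW) t.2.le hdep', Finset.mul_sum]
  refine Finset.sum_le_sum fun k _ => ?_
  set P : Env d A T → ℝ≥0∞ := fun e => ∏ s : Fin T with s.1 < t.1, stepProb alg e s k with hP
  set f : Env d A T → ℝ≥0∞ := fun e => (S ∩ W).indicator (fun _ => 1) (e, k) * P e with hf
  have hPm : Measurable P := Finset.measurable_prod _ fun s _ => measurable_stepProb alg s k
  have hfm : Measurable f := (measurable_indicator_slice (hS.inter hW) k).mul hPm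
  have hinv : ∀ e, (reflect lam r k t e, k) ∈ S ↔ (e, k) ∈ S := fun e =>
    mem_firstExit_congr fun s hs => obsAt_reflect lam r k t e hs
  have hPinv : ∀ e, P (reflect lam r k t e) = P e := by
    intro e
    refine Finset.prod_congr rfl fun s hs => ?_
    have hst : s ≤ t := (Fin.lt_def.2 (by simpa using hs)).le
    rw [stepProb, stepProb, obsAt_reflect lam r k t e hst]
  have hpt : ∀ e, S.indicator (fun _ => (1 : ℝ≥0∞)) (e, k) * P e ≤
      f e + f (reflect lam r k t e) := by
    intro e
    by_cases heS : (e, k) ∈ S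
    · by_cases heW : (e, k) ∈ W
      · have hmem : (e, k) ∈ S ∩ W := ⟨heS, heW⟩
        refine le_trans ?_ (le_add_right le_rfl)
        rw [hf]
        simp only
        rw [Set.indicator_of_mem heS, Set.indicator_of_mem hmem]
      · refine le_trans ?_ (le_add_left le_rfl)
        have hmem : (reflect lam r k t e, k) ∈ S ∩ W := by
          refine ⟨(hinv e).2 heS, ?_⟩
          -- the reflection of a point of the ball at a point outside lies outside the ball
          have h1 : ρ < ‖tsMean lam r (obsAt e k t)‖ := heS.1
          have h2 : ‖e.2.1‖ < ρ := not_le.1 heW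
          have h3 := norm_sub_norm_le ((2 : ℝ) • tsMean lam r (obsAt e k t)) e.2.1
          rw [norm_smul, Real.norm_ofNat] at h3
          change ρ ≤ ‖(2 : ℝ) • tsMean lam r (obsAt e k t) - e.2.1‖
          linarith
        rw [hf]
        simp only
        rw [Set.indicator_of_mem heS, Set.indicator_of_mem hmem, hPinv]
    · rw [Set.indicator_of_notMem heS, zero_mul]
      exact zero_le
  calc _ ≤ ∫⁻ e, (f e + f (reflect lam r k t e)) ∂(envLaw ν lam r) := lintegral_mono hpt
    _ = ∫⁻ e, f e ∂(envLaw ν lam r) + ∫⁻ e, f (reflect lam r k t e) ∂(envLaw ν lam r) :=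
        lintegral_add_left hfm _
    _ = 2 * ∫⁻ e, f e ∂(envLaw ν lam r) := by
        rw [(measurePreserving_reflect hlam hr k t).lintegral_comp hfm, two_mul]

/-- The probability that one of the posterior means leaves a ball is at most twice the probability
that the parameter lies outside. -/
theorem trajLaw_exists_lt_norm_tsMean_le (hA : 1 ≤ A) (hlam : 0 < lam) (hr : 0 < r)
    (alg : Algorithm d A T) (ρ : ℝ) :
    trajLaw ν lam r alg {x | ∃ t, ρ < ‖tsMean lam r (obsAt x.1 x.2 t)‖} ≤
      2 * envLaw ν lam r {e | ρ ≤ ‖e.2.1‖} := by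
  have hsub : {x : Env d A T × (Fin T → Fin A) | ∃ t, ρ < ‖tsMean lam r (obsAt x.1 x.2 t)‖} ⊆
      ⋃ t, firstExit d A lam r ρ t := by
    intro x hx
    classical
    have hne : (Finset.univ.filter fun t => ρ < ‖tsMean lam r (obsAt x.1 x.2 t)‖).Nonempty := by
      obtain ⟨t, ht⟩ := hx
      exact ⟨t, by simpa using ht⟩
    refine Set.mem_iUnion.2 ⟨Finset.min' _ hne, ?_, fun s hs => ?_⟩
    · simpa using Finset.min'_mem _ hne
    · by_contra hcon
      exact absurd hs (not_lt.2 (Finset.min'_le _ s (by simpa using hcon)))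
  have hdisj : Pairwise (Function.onFun Disjoint fun t : Fin T =>
      firstExit d A lam r ρ t ∩ {x | ρ ≤ ‖x.1.2.1‖}) := by
    intro t t' htt
    refine Set.disjoint_left.2 fun x hx hx' => ?_
    rcases lt_or_gt_of_ne htt with h | h
    · exact absurd (hx'.1.2 t h) (not_le.2 hx.1.1)
    · exact absurd (hx.1.2 t' h) (not_le.2 hx'.1.1)
  have hW : MeasurableSet {x : Env d A T × (Fin T → Fin A) | ρ ≤ ‖x.1.2.1‖} :=
    measurableSet_le measurable_const (by fun_prop)
  calc _ ≤ trajLaw ν lam r alg (⋃ t, firstExit d A lam r ρ t) := measure_mono hsub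
    _ ≤ ∑ t, trajLaw ν lam r alg (firstExit d A lam r ρ t) := measure_iUnion_fintype_le _ _
    _ ≤ ∑ t, 2 * trajLaw ν lam r alg (firstExit d A lam r ρ t ∩ {x | ρ ≤ ‖x.1.2.1‖}) :=
        Finset.sum_le_sum fun t _ => trajLaw_firstExit_le hA hlam hr alg ρ t
    _ = 2 * trajLaw ν lam r alg (⋃ t, firstExit d A lam r ρ t ∩ {x | ρ ≤ ‖x.1.2.1‖}) := by
        rw [← Finset.mul_sum, measure_iUnion hdisj
          (fun t => (measurableSet_firstExit lam r ρ t).inter hW), tsum_fintype]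
    _ ≤ 2 * trajLaw ν lam r alg {x | x.1 ∈ {e : Env d A T | ρ ≤ ‖e.2.1‖}} := by
        gcongr
        exact Set.iUnion_subset fun t => Set.inter_subset_right
    _ = _ := by
        rw [trajLaw_fst hA alg (measurableSet_le measurable_const (by fun_prop))]

/-! ### Gaussian tail bounds -/

theorem integral_exp_sq_gaussian :
    Integrable (fun x : ℝ => Real.exp (x ^ 2 / 4)) (gaussianReal 0 1) ∧
      ∫ x : ℝ, Real.exp (x ^ 2 / 4) ∂(gaussianReal 0 1) = √2 := by
  have h : ∀ x : ℝ, gaussianPDFReal 0 1 x • Real.exp (x ^ 2 / 4) =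
      (√(2 * Real.pi))⁻¹ * Real.exp (-(1 / 4) * x ^ 2) := by
    intro x
    rw [gaussianPDFReal, smul_eq_mul, mul_assoc, ← Real.exp_add]
    simp only [NNReal.coe_one, mul_one]
    congr 2
    ring
  constructor
  · rw [gaussianReal_of_var_ne_zero _ one_ne_zero,
      integrable_withDensity_iff_integrable_smul₀' (by fun_prop) (by simp [gaussianPDF])]
    simp only [gaussianPDF, ENNReal.toReal_ofReal (gaussianPDFReal_nonneg _ _ _), h]
    exact (integrable_exp_neg_mul_sq (by norm_num)).const_mul _
  · rw [integral_gaussianReal_eq_integral_smul one_ne_zero]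
    simp_rw [h]
    rw [integral_const_mul, integral_gaussian, ← Real.sqrt_inv, ← Real.sqrt_mul (by positivity)]
    congr 1
    field_simp
    norm_num

/-- Markov's inequality for `exp (‖u‖² / 4)`, whose expectation is `√2 ^ d`. -/
theorem stdGaussian_norm_ge_le {c : ℝ} (hc : 0 ≤ c) :
    (stdGaussian (Vec d)).real {u | c ≤ ‖u‖} ≤ √2 ^ d * Real.exp (-(c ^ 2 / 4)) := by
  rw [← map_pi_eq_stdGaussian, map_measureReal_apply (by fun_prop)
    (measurableSet_le measurable_const (by fun_prop))]
  have hexp : ∀ x : Fin d → ℝ, Real.exp (‖(WithLp.toLp 2 x : Vec d)‖ ^ 2 / 4) =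
      ∏ i, Real.exp (x i ^ 2 / 4) := by
    intro x
    rw [← Real.exp_sum, EuclideanSpace.norm_sq_eq, Finset.sum_div]
    simp
  have hint := Integrable.fintype_prod (ι := Fin d) (f := fun _ x => Real.exp (x ^ 2 / 4))
    fun _ => integral_exp_sq_gaussian.1
  have h1 := mul_meas_ge_le_integral_of_nonneg
    (Filter.Eventually.of_forall fun x => Finset.prod_nonneg fun i _ => (Real.exp_pos _).le) hint
    (Real.exp (c ^ 2 / 4))
  rw [integral_fintype_prod_eq_prod (fun (_ : Fin d) (x : ℝ) => Real.exp (x ^ 2 / 4)),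
    integral_exp_sq_gaussian.2, Finset.prod_const, Finset.card_univ, Fintype.card_fin] at h1
  have h2 : {x : Fin d → ℝ | Real.exp (c ^ 2 / 4) ≤ ∏ i, Real.exp (x i ^ 2 / 4)} =
      WithLp.toLp 2 ⁻¹' {u : Vec d | c ≤ ‖u‖} := by
    ext x
    simp only [Set.mem_ofPred_eq, Set.mem_preimage]
    rw [← hexp, Real.exp_le_exp, div_le_div_iff_of_pos_right (by norm_num),
      pow_le_pow_iff_left₀ hc (norm_nonneg _) two_ne_zero]
  rw [h2] at h1
  rw [Real.exp_neg, ← div_eq_mul_inv, le_div_iff₀ (Real.exp_pos _), mul_comm]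
  exact h1

open scoped MatrixOrder in
theorem multivariateGaussian_smul_one {lam : ℝ} (hlam : 0 < lam) :
    multivariateGaussian (0 : Vec d) (lam • 1) = (stdGaussian (Vec d)).map fun u => √lam • u := by
  rw [multivariateGaussian]
  congr 1
  funext u
  rw [zero_add]
  refine (WithLp.ofLp_injective 2) ?_
  rw [Matrix.ofLp_toEuclideanCLM]
  refine sqrt_mulVec_of_eigen (Matrix.PosSemidef.one.smul hlam.le) (Real.sqrt_pos.2 hlam) ?_
  rw [Real.sq_sqrt hlam.le, Matrix.smul_mulVec, Matrix.one_mulVec]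

theorem envLaw_norm_ge_le (hlam : 0 < lam) {δ : ℝ} (hδ : 0 < δ) (hδ1 : δ < 1 / 2) :
    envLaw ν lam r {e | 2 * √lam * (1 + 2 * √(Real.log (2 / δ)) + √(d : ℝ)) ≤ ‖e.2.1‖} ≤
      ENNReal.ofReal (δ / 8) := by
  set ρ := 2 * √lam * (1 + 2 * √(Real.log (2 / δ)) + √(d : ℝ)) with hρ
  have h1 : envLaw ν lam r {e | ρ ≤ ‖e.2.1‖} =
      stdGaussian (Vec d) {u | 2 * (1 + 2 * √(Real.log (2 / δ)) + √(d : ℝ)) ≤ ‖u‖} := by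
    have hmp : MeasurePreserving (fun e : Env d A T => e.2.1) (envLaw ν lam r)
        (multivariateGaussian (0 : Vec d) (lam • 1)) :=
      measurePreserving_fst.comp measurePreserving_snd
    have h2 := hmp.measure_preimage (s := {w : Vec d | ρ ≤ ‖w‖})
      (measurableSet_le measurable_const (by fun_prop)).nullMeasurableSet
    change envLaw ν lam r ((fun e : Env d A T => e.2.1) ⁻¹' {w : Vec d | ρ ≤ ‖w‖}) = _
    rw [h2, multivariateGaussian_smul_one hlam, Measure.map_apply (by fun_prop)
      (measurableSet_le measurable_const (by fun_prop))]
    congr 1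
    ext u
    have hs : 0 < √lam := Real.sqrt_pos.2 hlam
    simp only [Set.mem_preimage, Set.mem_ofPred_eq]
    rw [norm_smul, Real.norm_of_nonneg hs.le, hρ, mul_comm 2 √lam, mul_assoc,
      mul_le_mul_iff_right₀ hs]
  rw [h1, ← ofReal_measureReal]
  refine ENNReal.ofReal_le_ofReal ((stdGaussian_norm_ge_le (by positivity)).trans ?_)
  set L := Real.log (2 / δ) with hL
  have hL0 : 0 ≤ L := Real.log_nonneg (by rw [le_div_iff₀ hδ]; linarith)
  have h2 : (1 + 4 * L + d : ℝ) ≤ (2 * (1 + 2 * √L + √(d : ℝ))) ^ 2 / 4 := by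
    have := Real.sq_sqrt hL0
    have := Real.sq_sqrt (Nat.cast_nonneg (α := ℝ) d)
    nlinarith [Real.sqrt_nonneg L, Real.sqrt_nonneg (d : ℝ),
      mul_nonneg (Real.sqrt_nonneg L) (Real.sqrt_nonneg (d : ℝ))]
  have h3 : √2 ≤ Real.exp 1 := by
    have := Real.add_one_le_exp (1 : ℝ)
    refine (Real.sqrt_le_sqrt (by norm_num : (2 : ℝ) ≤ 4)).trans ?_
    rw [show (4 : ℝ) = 2 ^ 2 by norm_num, Real.sqrt_sq (by norm_num)]
    linarith
  have h4 : √2 ^ d ≤ Real.exp d := by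
    refine (pow_le_pow_left₀ (Real.sqrt_nonneg _) h3 d).trans_eq ?_
    rw [← Real.exp_nat_mul, mul_one]
  have h5 : Real.exp (-L) = δ / 2 := by
    rw [Real.exp_neg, hL, Real.exp_log (by positivity), inv_div]
  calc √2 ^ d * Real.exp (-((2 * (1 + 2 * √L + √(d : ℝ))) ^ 2 / 4))
      ≤ Real.exp d * Real.exp (-(1 + 4 * L + d)) := by
        refine mul_le_mul h4 (Real.exp_le_exp.2 (by linarith)) (Real.exp_pos _).le
          (Real.exp_pos _).le
    _ ≤ Real.exp (-L) ^ 4 := by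
        rw [← Real.exp_add, ← Real.exp_nat_mul]
        refine Real.exp_le_exp.2 ?_
        push_cast
        linarith
    _ ≤ δ / 8 := by
        rw [h5]
        have h6 : (δ / 2) ^ 3 ≤ (1 / 4) ^ 3 := pow_le_pow_left₀ (by positivity) (by linarith) 3
        have h7 : (δ / 2) ^ 4 = (δ / 2) * (δ / 2) ^ 3 := by ring
        rw [h7]
        nlinarith

/-- Chebyshev's inequality for the noises, and a union bound. -/
theorem envLaw_exists_noise_le (hr : 0 < r) {δ : ℝ} (hδ : 0 < δ) :
    envLaw ν lam r {e | ∃ j, 2 * √(T * r / δ) ≤ |e.2.2 j|} ≤ ENNReal.ofReal (δ / 4) := by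
  set s := 2 * √(T * r / δ) with hs
  have h1 : ∀ j : Fin T, envLaw ν lam r {e | s ≤ |e.2.2 j|} ≤ ENNReal.ofReal (δ / (4 * T)) := by
    intro j
    have hT : (0 : ℝ) < T := by exact_mod_cast j.pos
    have hspos : 0 < s := by positivity
    have hmp : MeasurePreserving (fun e : Env d A T => e.2.2 j) (envLaw ν lam r)
        (gaussianReal 0 r.toNNReal) :=
      (measurePreserving_eval (fun _ : Fin T => gaussianReal 0 r.toNNReal) j).comp
        (measurePreserving_snd.comp measurePreserving_snd)
    have h2 := hmp.measure_preimage (s := {x : ℝ | s ≤ |x|})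
      (measurableSet_le measurable_const (by fun_prop)).nullMeasurableSet
    change envLaw ν lam r ((fun e : Env d A T => e.2.2 j) ⁻¹' {x : ℝ | s ≤ |x|}) ≤ _
    rw [h2]
    have h3 := meas_ge_le_variance_div_sq (μ := gaussianReal 0 r.toNNReal) (X := id)
      (memLp_id_gaussianReal 2) hspos
    rw [variance_id_gaussianReal, Real.coe_toNNReal _ hr.le] at h3
    simp only [id, integral_id_gaussianReal, sub_zero] at h3
    refine h3.trans (ENNReal.ofReal_le_ofReal (le_of_eq ?_))
    rw [hs, mul_pow, Real.sq_sqrt (by positivity)]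
    field_simp
    norm_num
  have hset : {e : Env d A T | ∃ j, s ≤ |e.2.2 j|} = ⋃ j, {e : Env d A T | s ≤ |e.2.2 j|} := by
    ext e; simp
  rw [hset]
  refine (measure_iUnion_fintype_le _ _).trans ((Finset.sum_le_sum fun j _ => h1 j).trans ?_)
  rw [Finset.sum_const, Finset.card_univ, Fintype.card_fin, nsmul_eq_mul]
  rcases Nat.eq_zero_or_pos T with rfl | hT
  · simp
  · have hT' : (0 : ℝ) < T := by exact_mod_cast hT
    rw [← ENNReal.ofReal_natCast, ← ENNReal.ofReal_mul hT'.le]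
    refine ENNReal.ofReal_le_ofReal (le_of_eq ?_)
    field_simp

/-- With probability at least `1 - δ` the actions are admissible, all posterior means lie in the ball
of radius `2 √λ (1 + 2 √(log (2/δ)) + √d)`, and all rewards are polynomially bounded. -/
theorem trajLaw_bad_le (hA : 1 ≤ A) (hlam : 0 < lam) (hr : 0 < r) {δ : ℝ} (hδ : 0 < δ)
    (hδ1 : δ < 1 / 2) {good : (Fin T → ActionSet d A) → Prop} (hgood : ∀ᵐ α ∂ν, good α)
    (alg : Algorithm d A T) :
    trajLaw ν lam r alg {x | ¬ (good x.1.1 ∧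
      (∀ t, ‖tsMean lam r (obsAt x.1 x.2 t)‖ ≤
        2 * √lam * (1 + 2 * √(Real.log (2 / δ)) + √(d : ℝ))) ∧
      ‖x.1.2.1‖ ≤ 2 * √lam * (1 + 2 * √(Real.log (2 / δ)) + √(d : ℝ)) ∧
      ∀ j, |x.1.2.2 j| ≤ 2 * √(T * r / δ))} ≤ ENNReal.ofReal δ := by
  set ρ := 2 * √lam * (1 + 2 * √(Real.log (2 / δ)) + √(d : ℝ)) with hρ
  set s := 2 * √(T * r / δ) with hs
  set N := toMeasurable ν {α | ¬ good α} with hN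
  have hN0 : ν N = 0 := by rw [hN, measure_toMeasurable]; exact hgood
  have hNm : MeasurableSet N := measurableSet_toMeasurable _ _
  have hE1m : MeasurableSet {e : Env d A T | e.1 ∈ N} := measurable_fst hNm
  have hE1 : envLaw ν lam r {e : Env d A T | e.1 ∈ N} = 0 := by
    have hmp : MeasurePreserving (fun e : Env d A T => e.1) (envLaw ν lam r) ν :=
      measurePreserving_fst
    have := hmp.measure_preimage hNm.nullMeasurableSet
    rw [hN0] at this
    exact this
  have hE3m : MeasurableSet {e : Env d A T | ρ ≤ ‖e.2.1‖} :=
    measurableSet_le measurable_const (by fun_prop)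
  have hE4m : MeasurableSet {e : Env d A T | ∃ j, s ≤ |e.2.2 j|} := by
    rw [Set.ofPred_exists]
    exact MeasurableSet.iUnion fun j => measurableSet_le measurable_const (by fun_prop)
  set μ := trajLaw ν lam r alg with hμ
  have hsub : {x : Env d A T × (Fin T → Fin A) | ¬ (good x.1.1 ∧
      (∀ t, ‖tsMean lam r (obsAt x.1 x.2 t)‖ ≤ ρ) ∧ ‖x.1.2.1‖ ≤ ρ ∧ ∀ j, |x.1.2.2 j| ≤ s)} ⊆
      (({x | x.1 ∈ {e : Env d A T | e.1 ∈ N}} ∪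
        {x | ∃ t, ρ < ‖tsMean lam r (obsAt x.1 x.2 t)‖}) ∪
        {x | x.1 ∈ {e : Env d A T | ρ ≤ ‖e.2.1‖}}) ∪
        {x | x.1 ∈ {e : Env d A T | ∃ j, s ≤ |e.2.2 j|}} := by
    intro x hx
    by_contra hcon
    simp only [Set.mem_union, Set.mem_ofPred_eq, not_or, not_exists, not_le, not_lt] at hcon
    obtain ⟨⟨⟨h1, h2⟩, h3⟩, h4⟩ := hcon
    refine hx ⟨?_, h2, h3.le, fun j => (h4 j).le⟩
    by_contra hg
    exact h1 (subset_toMeasurable ν _ hg)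
  have hmax := trajLaw_exists_lt_norm_tsMean_le (ν := ν) hA hlam hr alg ρ
  have hw := envLaw_norm_ge_le (ν := ν) (lam := lam) (r := r) hlam hδ hδ1
  have hn := envLaw_exists_noise_le (ν := ν) (lam := lam) hr hδ
  refine (measure_mono hsub).trans ((measure_union_le _ _).trans ?_)
  refine (add_le_add ((measure_union_le _ _).trans (add_le_add (measure_union_le _ _) le_rfl))
    le_rfl).trans ?_
  rw [hμ, trajLaw_fst hA alg hE1m, trajLaw_fst hA alg hE3m, trajLaw_fst hA alg hE4m, hE1, zero_add]
  calc _ ≤ 2 * ENNReal.ofReal (δ / 8) + ENNReal.ofReal (δ / 8) + ENNReal.ofReal (δ / 4) := by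
        refine add_le_add (add_le_add (hmax.trans ?_) hw) hn
        gcongr
    _ = ENNReal.ofReal (2 * (δ / 8) + δ / 8 + δ / 4) := by
        rw [ENNReal.ofReal_add (by positivity) (by positivity),
          ENNReal.ofReal_add (by positivity) (by positivity), ENNReal.ofReal_mul (by norm_num)]
        simp
    _ ≤ ENNReal.ofReal δ := ENNReal.ofReal_le_ofReal (by linarith)

end

end TSTransformer

namespace TSTransformer

noncomputable section

variable {d A n T : ℕ}

/-! ### Choice of the parameters -/

theorem mul_pow_le_pow_succ {b c : ℝ} (hc : c ≤ b) (hb : 0 ≤ b) (n : ℕ) :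
    c * b ^ n ≤ b ^ (n + 1) := by
  rw [pow_succ']
  exact mul_le_mul_of_nonneg_right hc (pow_nonneg hb n)

theorem sqrt_le_of_one_le {x : ℝ} (hx : 1 ≤ x) : √x ≤ x :=
  (Real.sqrt_le_left (by linarith)).2 (by nlinarith)

theorem card_tokIdx_le (hd : 1 ≤ d) (hA : 1 ≤ A) :
    (Fintype.card (TokIdx d A) : ℝ) ≤ 14 * (A * d) := by
  have h : Fintype.card (TokIdx d A) = (d + 1) + (A * d + (A + ((6 * (A * d) + A) + 3))) := by
    simp [TokIdx, Coord, numFree, FreeIdx]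
  rw [h]
  have h1 : d ≤ A * d := Nat.le_mul_of_pos_left d hA
  have h2 : A ≤ A * d := Nat.le_mul_of_pos_right A hd
  have h3 : 1 ≤ A * d := Nat.mul_pos hA hd
  have h4 : (d + 1) + (A * d + (A + ((6 * (A * d) + A) + 3))) ≤ 14 * (A * d) := by omega
  exact_mod_cast h4

theorem numHid_le (M₀ : ℕ) :
    (numHid d A M₀ : ℝ) ≤ 14 * (A * (d + M₀)) := by
  have h : numHid d A M₀ = 7 * (A * (d * 2)) + A * M₀ := by
    simp [numHid, HidIdx]
  rw [h]
  have h4 : 7 * (A * (d * 2)) + A * M₀ ≤ 14 * (A * (d + M₀)) := by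
    rw [mul_add]
    have : A * (d * 2) = 2 * (A * d) := by ring
    omega
  exact_mod_cast h4

/-- The radius of a ball that contains the parameter and the posterior means with high
probability. -/
def meanRadius (d : ℕ) (lam δ : ℝ) : ℝ :=
  2 * √lam * (1 + 2 * √(Real.log (2 / δ)) + √(d : ℝ))

/-- A bound for the rewards that holds with high probability. -/
def rewardBound (d T : ℕ) (lam r Ba δ : ℝ) : ℝ :=
  Ba * meanRadius d lam δ + 2 * √(T * r / δ)

theorem meanRadius_nonneg (d : ℕ) (lam δ : ℝ) : 0 ≤ meanRadius d lam δ := by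
  unfold meanRadius; positivity

theorem rewardBound_nonneg (d T : ℕ) (lam r : ℝ) {Ba : ℝ} (δ : ℝ) (hBa : 0 ≤ Ba) :
    0 ≤ rewardBound d T lam r Ba δ := by
  have := meanRadius_nonneg d lam δ
  unfold rewardBound; positivity

theorem rewardBound_le {lam r Ba δ b : ℝ} (hb : 50 ≤ b) (hd : 1 ≤ d) (hδ : 0 < δ) (hδ1 : δ < 1 / 2)
    (hr : 0 < r) (hlam : √lam ≤ b) (hdb : (d : ℝ) ≤ b) (hTb : (T : ℝ) ≤ b)
    (hrb : r ≤ b) (hBab : Ba ≤ b) (hδb : 1 / δ ≤ b) : rewardBound d T lam r Ba δ ≤ b ^ 5 := by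
  have hb0 : 0 ≤ b := by linarith
  have h2δ : 2 / δ = 2 * (1 / δ) := by ring
  have hL : √(Real.log (2 / δ)) ≤ 2 * b := by
    have h1 : Real.log (2 / δ) ≤ 2 / δ := Real.log_le_self (by positivity)
    have h2 : 1 ≤ 2 / δ := by rw [le_div_iff₀ hδ]; linarith
    exact (Real.sqrt_le_sqrt h1).trans ((sqrt_le_of_one_le h2).trans (by linarith))
  have hdd : √(d : ℝ) ≤ b := (sqrt_le_of_one_le (by exact_mod_cast hd)).trans hdb
  have hρ : meanRadius d lam δ ≤ b ^ 3 := by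
    calc meanRadius d lam δ ≤ 2 * b * (1 + 2 * (2 * b) + b) := by
          unfold meanRadius; gcongr
      _ ≤ 2 * b * (6 * b) := by
          refine mul_le_mul_of_nonneg_left (by linarith) (by linarith)
      _ = 12 * b ^ 2 := by ring
      _ ≤ b ^ 3 := mul_pow_le_pow_succ (by linarith) hb0 2
  have hs : 2 * √(T * r / δ) ≤ b ^ 4 := by
    have h1 : T * r / δ ≤ b ^ 3 := by
      calc T * r / δ = T * r * (1 / δ) := by ring
        _ ≤ b * b * b := by gcongr
        _ = b ^ 3 := by ring
    have h2 : 1 ≤ b ^ 3 := one_le_pow₀ (by linarith)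
    calc 2 * √(T * r / δ) ≤ 2 * b ^ 3 := by
          have := (Real.sqrt_le_sqrt h1).trans (sqrt_le_of_one_le h2)
          linarith
      _ ≤ b ^ 4 := mul_pow_le_pow_succ (by linarith) hb0 3
  calc rewardBound d T lam r Ba δ ≤ b * b ^ 3 + b ^ 4 := by
        unfold rewardBound
        have := meanRadius_nonneg d lam δ
        gcongr
    _ = 2 * b ^ 4 := by ring
    _ ≤ b ^ 5 := mul_pow_le_pow_succ (by linarith) hb0 4

/-- With `16 log b` times the square root of the condition number as number of Chebyshev steps, the
error of the features is negligible when all data are bounded by powers of `b`. -/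
theorem feature_error_le {lam r Ba ε C₀ ρm b : ℝ} {N : ℕ} (hb : 50 ≤ b) (hlam : 0 < lam)
    (hr : 0 < r) (hBa : 0 < Ba) (hε : 0 < ε) (hρ0 : 0 ≤ ρm) (hCb : C₀ ≤ b)
    (hlb : √lam ≤ b) (hBab : Ba ≤ b) (hρb : ρm ≤ b ^ 5) (hεb : 1 / ε ≤ b)
    (hκ1 : 1 ≤ (r / lam + T * Ba ^ 2) / (r / lam))
    (hκb : (r / lam + T * Ba ^ 2) / (r / lam) ≤ b ^ 6)
    (hN : 2 * √((r / lam + T * Ba ^ 2) / (r / lam)) * (16 * Real.log b) ≤ N) :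
    C₀ * ((√lam * Ba + ρm) * chebErr (r / lam) (r / lam + T * Ba ^ 2) N) ≤ ε / 8 := by
  have hb0 : 0 ≤ b := by linarith
  have hpow : ∀ {i j : ℕ}, i ≤ j → b ^ i ≤ b ^ j := fun h => pow_le_pow_right₀ (by linarith) h
  set κ := (r / lam + T * Ba ^ 2) / (r / lam) with hκ
  have hsκ1 : 1 ≤ √κ := Real.one_le_sqrt.2 hκ1
  have hm : 0 < r / lam := by positivity
  have hMx : r / lam ≤ r / lam + T * Ba ^ 2 := by
    have : 0 ≤ (T : ℝ) * Ba ^ 2 := by positivity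
    linarith
  have h1 := chebErr_le hm hMx N
  rw [← hκ] at h1
  have h2 : Real.exp (-((N + 1 : ℕ) / (2 * √κ))) ≤ (b ^ 16)⁻¹ := by
    rw [← Real.exp_log (by positivity : 0 < b ^ 16), ← Real.exp_neg, Real.log_pow]
    refine Real.exp_le_exp.2 (neg_le_neg ?_)
    rw [le_div_iff₀ (by positivity)]
    push_cast
    linarith
  have h3 : chebErr (r / lam) (r / lam + T * Ba ^ 2) N ≤ 8 * b ^ 6 * (b ^ 16)⁻¹ := by
    refine h1.trans ?_
    gcongr
  have h4 : √lam * Ba + ρm ≤ 2 * b ^ 5 := by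
    have h5 : √lam * Ba ≤ b * b := by
      gcongr
    have h6 : b * b ≤ b ^ 5 := by rw [← sq]; exact hpow (by omega)
    linarith
  have h7 := chebErr_nonneg hm hMx N
  have hbpos : 0 < b := by linarith
  have h8 : 1 / b ≤ ε := by
    rw [div_le_iff₀ hbpos, mul_comm, ← div_le_iff₀ hε]
    exact hεb
  calc C₀ * ((√lam * Ba + ρm) *
        chebErr (r / lam) (r / lam + T * Ba ^ 2) N)
      ≤ b * ((2 * b ^ 5) * (8 * b ^ 6 * (b ^ 16)⁻¹)) := by
                gcongr
    _ = 16 / b ^ 4 := by field_simp; norm_num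
    _ ≤ 1 / b / 8 := by
        rw [div_div, div_le_div_iff₀ (by positivity) (by positivity)]
        have h9 : (128 : ℝ) ≤ b ^ 3 := by
          calc (128 : ℝ) ≤ 50 ^ 3 := by norm_num
            _ ≤ b ^ 3 := by gcongr
        nlinarith
    _ ≤ ε / 8 := by linarith

set_option maxHeartbeats 2000000 in
/-- The number of Chebyshev steps, the bounds and the clipping radius can be chosen such that the
approximation error is at most `ε / 8` and the size of the transformer is as claimed. All quantities
are bounded by powers of the product `P * Y`, whose logarithm is at most `P * log Y`. -/
theorem exists_parameters_of_le {lam r Ba ε δ₀ C₀ P Y : ℝ} (hd : 1 ≤ d) (hA : 1 ≤ A) (hT : 1 ≤ T)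
    (hlam : 0 < lam) (hr : 0 < r) (hBa : 0 < Ba) (hε : 0 < ε) (hδ : 0 < δ₀) (hδ1 : δ₀ < 1 / 2)
    (hC : 0 < C₀) (hP5 : 5 ≤ P) (hY10 : 10 ≤ Y) (hlamP : lam ≤ P) (hlP : √lam ≤ P) (hBaP : Ba ≤ P)
    (hrP : r ≤ P) (hrP' : 1 / r ≤ P) (hBaP' : 1 / Ba ≤ P) (hTY : (T : ℝ) ≤ Y) (hAY : (A : ℝ) ≤ Y)
    (hdY : (d : ℝ) ≤ Y) (hCY : C₀ ≤ Y) (hδY : 1 / δ₀ ≤ Y) (hεY : 1 / ε ≤ Y) :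
    ∃ (N : ℕ) (B R X : ℝ),
      (1 ≤ B ∧ Ba ≤ B ∧ rewardBound d T lam r Ba δ₀ ≤ B ∧ (2 * (T : ℝ)) ^ 2 ≤ B ∧
        (N + 1) * X * Ba ≤ B ∧ (N + 1) * X * Ba * Ba * rewardBound d T lam r Ba δ₀ ≤ B) ∧
      (0 < R ∧ Fintype.card (TokIdx d A) * B ≤ R ∧
        Fintype.card (TokIdx d A) * ((1 + C₀) * B) ≤ R) ∧
      (√lam + 2 / Ba ^ 2) * (N + 1) ^ 2 ≤ X ∧
      C₀ * ((√lam * Ba + rewardBound d T lam r Ba δ₀) *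
        chebErr (r / lam) (r / lam + T * Ba ^ 2) N) ≤ ε / 8 ∧
      |Real.log R| ≤ 200000 * P ^ 8 * Real.log Y ^ 8 ∧
      2 * N + 5 ≤ 200000 * P ^ 8 * Real.log Y ^ 8 * √(T : ℝ) ∧
      43 + 40 / Ba ^ 2 + 10 * X ≤ 200000 * P ^ 8 * Real.log Y ^ 8 * T ∧
      14 ≤ 200000 * P ^ 8 * Real.log Y ^ 8 := by
  have hT1 : (1 : ℝ) ≤ T := by exact_mod_cast hT
  have hlY : 2 ≤ Real.log Y := by
    rw [Real.le_log_iff_exp_le (by linarith)]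
    have h1 := Real.exp_one_lt_d9
    have h2 : Real.exp 2 = Real.exp 1 * Real.exp 1 := by rw [← Real.exp_add]; norm_num
    have h3 := Real.exp_pos 1
    rw [h2]
    nlinarith
  set b := P * Y with hb
  have hb50 : 50 ≤ b := by rw [hb]; nlinarith
  have hb0 : 0 ≤ b := by linarith
  have hPb : P ≤ b := by rw [hb]; nlinarith
  have hYb : Y ≤ b := by rw [hb]; nlinarith
  set ℓ := Real.log b with hℓ
  have hℓle : ℓ ≤ P * Real.log Y := by
    have h1 : ℓ = Real.log P + Real.log Y := Real.log_mul (by linarith) (by linarith)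
    have h2 : Real.log P ≤ P := Real.log_le_self (by linarith)
    rw [h1]; nlinarith
  have hℓ1 : 1 ≤ ℓ := by
    have : Real.log Y ≤ ℓ := Real.log_le_log (by linarith) hYb
    linarith
  have hℓb : ℓ ≤ b := Real.log_le_self hb0
  have hBa2 : 1 / Ba ^ 2 ≤ P ^ 2 := by
    rw [← one_div_pow]
    exact pow_le_pow_left₀ (by positivity) hBaP' 2
  have hρb : rewardBound d T lam r Ba δ₀ ≤ b ^ 5 :=
    rewardBound_le hb50 hd hδ hδ1 hr (hlP.trans hPb) (hdY.trans hYb) (hTY.trans hYb)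
      (hrP.trans hPb) (hBaP.trans hPb) (hδY.trans hYb)
  have hρ0 := rewardBound_nonneg d T lam r δ₀ hBa.le
  -- the condition number
  set κ := (r / lam + T * Ba ^ 2) / (r / lam) with hκ
  have hκeq : κ = 1 + T * (Ba ^ 2 * lam * (1 / r)) := by rw [hκ]; field_simp
  have hκ1 : 1 ≤ κ := by
    have : 0 ≤ T * (Ba ^ 2 * lam * (1 / r)) := by positivity
    linarith
  have hκT : κ ≤ T * (2 * P ^ 4) := by
    have h1 : Ba ^ 2 * lam * (1 / r) ≤ P ^ 2 * P * P := by gcongr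
    have h2 : (1 : ℝ) ≤ P ^ 4 := one_le_pow₀ (by linarith)
    have h3 : P ^ 2 * P * P = P ^ 4 := by ring
    rw [h3] at h1
    have h4 := mul_le_mul_of_nonneg_left h1 (by linarith : (0 : ℝ) ≤ T)
    have h5 := mul_le_mul_of_nonneg_left h2 (by linarith : (0 : ℝ) ≤ T)
    rw [hκeq]; linarith
  have hsκ : √κ ≤ √(T : ℝ) * (2 * P ^ 2) := by
    have h1 : √(T : ℝ) * (2 * P ^ 2) = √((T : ℝ) * (4 * P ^ 4)) := by
      rw [Real.sqrt_mul (by linarith), show 4 * P ^ 4 = (2 * P ^ 2) ^ 2 by ring,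
        Real.sqrt_sq (by positivity)]
    rw [h1]
    refine Real.sqrt_le_sqrt (hκT.trans ?_)
    have : 0 ≤ (T : ℝ) * P ^ 4 := by positivity
    linarith
  have hsκ1 : 1 ≤ √κ := Real.one_le_sqrt.2 hκ1
  have hκb : κ ≤ b ^ 6 := by
    calc κ ≤ T * (2 * P ^ 4) := hκT
      _ ≤ b * (2 * b ^ 4) := by gcongr; exact hTY.trans hYb
      _ = 2 * b ^ 5 := by ring
      _ ≤ b ^ 6 := mul_pow_le_pow_succ (by linarith) hb0 5
  set N := ⌈2 * √κ * (16 * ℓ)⌉₊ with hN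
  have hNge : 2 * √κ * (16 * ℓ) ≤ N := Nat.le_ceil _
  have hNlt : (N : ℝ) < 2 * √κ * (16 * ℓ) + 1 := Nat.ceil_lt_add_one (by positivity)
  have hN1 : (N : ℝ) + 1 ≤ 34 * (√κ * ℓ) := by nlinarith
  have hNb : (N : ℝ) + 1 ≤ b ^ 8 := by
    calc (N : ℝ) + 1 ≤ 34 * (b ^ 6 * b) := by
          refine hN1.trans ?_
          have : √κ ≤ b ^ 6 := (sqrt_le_of_one_le hκ1).trans hκb
          gcongr
      _ = 34 * b ^ 7 := by ring
      _ ≤ b ^ 8 := mul_pow_le_pow_succ (by linarith) hb0 7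
  have hNT : (N : ℝ) + 1 ≤ 68 * (√(T : ℝ) * (P ^ 3 * Real.log Y)) := by
    calc (N : ℝ) + 1 ≤ 34 * ((√(T : ℝ) * (2 * P ^ 2)) * (P * Real.log Y)) := by
          refine hN1.trans ?_
          gcongr
      _ = _ := by ring
  set X := (√lam + 2 / Ba ^ 2) * ((N : ℝ) + 1) ^ 2 with hX
  have hcoef : √lam + 2 / Ba ^ 2 ≤ 3 * P ^ 2 := by
    have h1 : 2 / Ba ^ 2 = 2 * (1 / Ba ^ 2) := by ring
    have h2 : P ≤ P ^ 2 := by nlinarith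
    rw [h1]; linarith
  have hcoef0 : 0 ≤ √lam + 2 / Ba ^ 2 := by positivity
  have hXb : X ≤ b ^ 19 := by
    calc X ≤ (3 * b ^ 2) * (b ^ 8) ^ 2 := by
          rw [hX]
          have : √lam + 2 / Ba ^ 2 ≤ 3 * b ^ 2 := hcoef.trans (by gcongr)
          gcongr
      _ = 3 * b ^ 18 := by ring
      _ ≤ b ^ 19 := mul_pow_le_pow_succ (by linarith) hb0 18
  have hX0 : 0 ≤ X := by positivity
  have hcard : (Fintype.card (TokIdx d A) : ℝ) ≤ b ^ 3 := by
    calc (Fintype.card (TokIdx d A) : ℝ) ≤ 14 * (b * b) := by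
          refine (card_tokIdx_le hd hA).trans ?_
          gcongr
          · exact hAY.trans hYb
          · exact hdY.trans hYb
      _ = 14 * b ^ 2 := by ring
      _ ≤ b ^ 3 := mul_pow_le_pow_succ (by linarith) hb0 2
  have hC1 : 1 + C₀ ≤ b ^ 2 := by
    have : C₀ ≤ b := hCY.trans hYb
    nlinarith
  have hpow : ∀ {i j : ℕ}, i ≤ j → b ^ i ≤ b ^ j := fun h => pow_le_pow_right₀ (by linarith) h
  have hBab : Ba ≤ b := hBaP.trans hPb
  have hlog0 : 0 ≤ Real.log Y := by linarith
  have hPl : ∀ {i j : ℕ}, i ≤ 8 → j ≤ 8 → P ^ i * Real.log Y ^ j ≤ P ^ 8 * Real.log Y ^ 8 := by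
    intro i j hi hj
    exact mul_le_mul (pow_le_pow_right₀ (by linarith) hi) (pow_le_pow_right₀ (by linarith) hj)
      (by positivity) (by positivity)
  have hsT : 1 ≤ √(T : ℝ) := Real.one_le_sqrt.2 hT1
  have hQ1 : 1 ≤ P ^ 8 * Real.log Y ^ 8 := by simpa using hPl (i := 0) (j := 0) (by omega) (by omega)
  refine ⟨N, b ^ 34, b ^ 39, X, ⟨one_le_pow₀ (by linarith), ?_, hρb.trans (hpow (by omega)), ?_, ?_,
    ?_⟩, ⟨by positivity, ?_, ?_⟩, le_rfl, ?_, ?_, ?_, ?_, ?_⟩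
  · exact hBab.trans (by simpa using hpow (i := 1) (j := 34) (by omega))
  · calc (2 * (T : ℝ)) ^ 2 ≤ (2 * b) ^ 2 := by gcongr; exact hTY.trans hYb
      _ = 4 * b ^ 2 := by ring
      _ ≤ b ^ 3 := mul_pow_le_pow_succ (by linarith) hb0 2
      _ ≤ b ^ 34 := hpow (by omega)
  · calc ((N : ℝ) + 1) * X * Ba ≤ b ^ 8 * b ^ 19 * b := by gcongr
      _ = b ^ 28 := by ring
      _ ≤ b ^ 34 := hpow (by omega)
  · calc ((N : ℝ) + 1) * X * Ba * Ba * rewardBound d T lam r Ba δ₀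
        ≤ b ^ 8 * b ^ 19 * b * b * b ^ 5 := by gcongr
      _ = b ^ 34 := by ring
  · calc (Fintype.card (TokIdx d A) : ℝ) * b ^ 34 ≤ b ^ 3 * b ^ 34 := by gcongr
      _ = b ^ 37 := by ring
      _ ≤ b ^ 39 := hpow (by omega)
  · calc (Fintype.card (TokIdx d A) : ℝ) * ((1 + C₀) * b ^ 34) ≤ b ^ 3 * (b ^ 2 * b ^ 34) := by
          gcongr
      _ = b ^ 39 := by ring
  · exact feature_error_le hb50 hlam hr hBa hε hρ0 (hCY.trans hYb) (hlP.trans hPb) hBab hρb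
      (hεY.trans hYb) hκ1 hκb hNge
  · rw [Real.log_pow, abs_of_nonneg (by positivity)]
    push_cast
    have h1 := hPl (i := 1) (j := 1) (by omega) (by omega)
    rw [pow_one, pow_one] at h1
    linarith
  · have h1 := hPl (i := 3) (j := 1) (by omega) (by omega)
    rw [pow_one] at h1
    calc 2 * (N : ℝ) + 5 ≤ 2 * ((N : ℝ) + 1) + 3 := by linarith
      _ ≤ 2 * (68 * (√(T : ℝ) * (P ^ 8 * Real.log Y ^ 8))) +
          3 * (√(T : ℝ) * (P ^ 8 * Real.log Y ^ 8)) := by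
          have h2 : 1 ≤ √(T : ℝ) * (P ^ 8 * Real.log Y ^ 8) := by nlinarith
          have h3 : √(T : ℝ) * (P ^ 3 * Real.log Y) ≤ √(T : ℝ) * (P ^ 8 * Real.log Y ^ 8) := by
            gcongr
          linarith
      _ = 139 * (P ^ 8 * Real.log Y ^ 8) * √(T : ℝ) := by ring
      _ ≤ 200000 * P ^ 8 * Real.log Y ^ 8 * √(T : ℝ) := by
          refine mul_le_mul_of_nonneg_right (by linarith) (by linarith)
  · have h1 := hPl (i := 2) (j := 0) (by omega) (by omega)
    rw [pow_zero, mul_one] at h1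
    have h2 := hPl (i := 8) (j := 2) (by omega) (by omega)
    have h3 : X ≤ 13872 * (P ^ 8 * Real.log Y ^ 2) * T := by
      calc X ≤ (3 * P ^ 2) * (68 * (√(T : ℝ) * (P ^ 3 * Real.log Y))) ^ 2 := by
            rw [hX]; gcongr
        _ = 13872 * (P ^ 8 * Real.log Y ^ 2) * √(T : ℝ) ^ 2 := by ring
        _ = _ := by rw [Real.sq_sqrt (by linarith)]
    have h4 : 43 + 40 / Ba ^ 2 ≤ 83 * (P ^ 8 * Real.log Y ^ 8) := by
      have : 40 / Ba ^ 2 = 40 * (1 / Ba ^ 2) := by ring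
      rw [this]; linarith
    calc 43 + 40 / Ba ^ 2 + 10 * X
        ≤ 83 * (P ^ 8 * Real.log Y ^ 8) * T + 138720 * (P ^ 8 * Real.log Y ^ 8) * T := by
          have h5 : 13872 * (P ^ 8 * Real.log Y ^ 2) * T ≤ 13872 * (P ^ 8 * Real.log Y ^ 8) * T := by
            gcongr ?_ * T
            linarith
          have h6 : 83 * (P ^ 8 * Real.log Y ^ 8) ≤ 83 * (P ^ 8 * Real.log Y ^ 8) * T :=
            le_mul_of_one_le_right (by linarith) hT1
          linarith
      _ = 138803 * (P ^ 8 * Real.log Y ^ 8) * T := by ring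
      _ ≤ 200000 * P ^ 8 * Real.log Y ^ 8 * T := by
          refine mul_le_mul_of_nonneg_right (by linarith) (by linarith)
  · linarith

/-- The number of Chebyshev steps, the bounds and the clipping radius can be chosen such that the
approximation error is at most `ε / 8` and the size of the transformer is as claimed. All quantities
are bounded by powers of the product `P * Y` of the two sums in the hidden factor, and
`log (P * Y) ≤ P * log Y`. -/
theorem exists_parameters {lam lam₀ r ba Ba ε δ₀ C₀ : ℝ} {M₀ : ℕ} (hd : 1 ≤ d) (hA : 1 ≤ A)
    (hT : 1 ≤ T) (hlam₀ : 0 < lam₀) (hlam : 0 < lam) (hle : lam ≤ lam₀) (hr : 0 < r) (hba : 0 < ba)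
    (hab : ba ≤ Ba) (hε : 0 < ε) (hε1 : ε < 1 / 4) (hδ : 0 < δ₀) (hδ1 : δ₀ < 1 / 2) (hM : 0 < M₀)
    (hC : 0 < C₀) : ∃ (N : ℕ) (B R X : ℝ),
      (1 ≤ B ∧ Ba ≤ B ∧ rewardBound d T lam r Ba δ₀ ≤ B ∧ (2 * (T : ℝ)) ^ 2 ≤ B ∧
        (N + 1) * X * Ba ≤ B ∧ (N + 1) * X * Ba * Ba * rewardBound d T lam r Ba δ₀ ≤ B) ∧
      (0 < R ∧ Fintype.card (TokIdx d A) * B ≤ R ∧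
        Fintype.card (TokIdx d A) * ((1 + C₀) * B) ≤ R) ∧
      (√lam + 2 / Ba ^ 2) * (N + 1) ^ 2 ≤ X ∧
      C₀ * ((√lam * Ba + rewardBound d T lam r Ba δ₀) *
        chebErr (r / lam) (r / lam + T * Ba ^ 2) N) ≤ ε / 8 ∧
      |Real.log R| ≤ hiddenFactor 200000 8 lam₀ r ba Ba M₀ C₀ T A d δ₀ ε ∧
      2 * N + 5 ≤ hiddenFactor 200000 8 lam₀ r ba Ba M₀ C₀ T A d δ₀ ε * √(T : ℝ) ∧
      43 + 40 / Ba ^ 2 + 10 * X ≤ hiddenFactor 200000 8 lam₀ r ba Ba M₀ C₀ T A d δ₀ ε * T ∧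
      14 ≤ hiddenFactor 200000 8 lam₀ r ba Ba M₀ C₀ T A d δ₀ ε := by
  have hBa : 0 < Ba := lt_of_lt_of_le hba hab
  set P := 1 + lam₀ + 1 / lam₀ + r + 1 / r + 1 / ba + Ba with hP
  set Y := (M₀ : ℝ) + C₀ + T + A + d + 1 / δ₀ + 1 / ε with hY
  have hT1 : (1 : ℝ) ≤ T := by exact_mod_cast hT
  have hA1 : (1 : ℝ) ≤ A := by exact_mod_cast hA
  have hd1 : (1 : ℝ) ≤ d := by exact_mod_cast hd
  have hM1 : (1 : ℝ) ≤ M₀ := by exact_mod_cast hM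
  have hi1 : 0 < 1 / lam₀ := by positivity
  have hi2 : 0 < 1 / r := by positivity
  have hi3 : 0 < 1 / ba := by positivity
  have hi4 : 2 ≤ 1 / δ₀ := by rw [le_div_iff₀ hδ]; linarith
  have hi5 : 4 ≤ 1 / ε := by rw [le_div_iff₀ hε]; linarith
  have hP5 : 5 ≤ P := by
    have h1 : 2 ≤ lam₀ + 1 / lam₀ := by
      rw [← sub_nonneg]
      have : lam₀ + 1 / lam₀ - 2 = (lam₀ - 1) ^ 2 / lam₀ := by field_simp; ring
      rw [this]; positivity
    have h2 : 2 ≤ r + 1 / r := by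
      rw [← sub_nonneg]
      have : r + 1 / r - 2 = (r - 1) ^ 2 / r := by field_simp; ring
      rw [this]; positivity
    rw [hP]; linarith
  have hY10 : 10 ≤ Y := by rw [hY]; linarith
  have hlP : √lam ≤ P := by
    have h1 : √lam ≤ 1 + lam := by
      rw [Real.sqrt_le_left (by linarith)]; nlinarith
    rw [hP]; linarith
  have hBaP : Ba ≤ P := by rw [hP]; linarith
  have hrP : r ≤ P := by rw [hP]; linarith
  have hrP' : 1 / r ≤ P := by rw [hP]; linarith
  have hlamP : lam ≤ P := by rw [hP]; linarith
  have hBaP' : 1 / Ba ≤ P := by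
    have : 1 / Ba ≤ 1 / ba := one_div_le_one_div_of_le hba hab
    rw [hP]; linarith
  have hTY : (T : ℝ) ≤ Y := by rw [hY]; linarith
  have hAY : (A : ℝ) ≤ Y := by rw [hY]; linarith
  have hdY : (d : ℝ) ≤ Y := by rw [hY]; linarith
  have hCY : C₀ ≤ Y := by rw [hY]; linarith
  have hδY : 1 / δ₀ ≤ Y := by rw [hY]; linarith
  have hεY : 1 / ε ≤ Y := by rw [hY]; linarith
  exact exists_parameters_of_le hd hA hT hlam hr hBa hε hδ hδ1 hC hP5 hY10 hlamP hlP hBaP hrP hrP'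
    hBaP' hTY hAY hdY hCY hδY hεY

end

end TSTransformer

namespace TSTransformer

noncomputable section

variable {d A n T : ℕ}

/-! ### The transformer policy on typical observations -/

section Policy

variable {M₀ N : ℕ} {lam r Ba : ℝ} {cf : Fin A → Fin M₀ → ℝ} {w : Fin A → Fin M₀ → Feat d A → ℝ}
  {β : Fin A → Fin M₀ → ℝ}

theorem abs_chebCoeff_rate_le {β : ℕ → ℝ} (hβ0 : ∀ j, 0 ≤ β j) (hβ1 : ∀ j, β j ≤ 1) {m Mx : ℝ}
    (hm : 0 < m) (hM : m ≤ Mx) (N j : ℕ) : |chebCoeff β (rate m Mx) N j| ≤ ((N : ℝ) + 1) ^ 2 := by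
  have h := rate_bounds hm hM
  exact abs_chebCoeff_le hβ0 hβ1 (by linarith) h.2.1.le N j

theorem le_add_mul_sq (hlam : 0 < lam) (hr : 0 < r) :
    0 < r / lam ∧ r / lam ≤ r / lam + T * Ba ^ 2 := by
  have : 0 ≤ (T : ℝ) * Ba ^ 2 := by positivity
  exact ⟨by positivity, by linarith⟩

theorem abs_tsData_ξ_le (hlam : 0 < lam) (hr : 0 < r) (j : ℕ) :
    |(tsData T lam r Ba N cf w β).ξ j| ≤ (√lam + 2 / Ba ^ 2) * ((N : ℝ) + 1) ^ 2 := by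
  obtain ⟨hm, hM⟩ := le_add_mul_sq (T := T) (Ba := Ba) hlam hr
  have hM0 : 0 < r / lam + T * Ba ^ 2 := hm.trans_le hM
  have h1 := abs_chebCoeff_rate_le invSqrtCoeff_nonneg invSqrtCoeff_le_one hm hM N j
  have h2 : √(r * (r / lam + T * Ba ^ 2)⁻¹) ≤ √lam := by
    refine Real.sqrt_le_sqrt ?_
    rw [← div_eq_mul_inv, div_le_iff₀ hM0]
    have : lam * (r / lam) = r := by field_simp
    nlinarith
  have h3 : 0 ≤ 2 / Ba ^ 2 := by positivity
  rw [tsData, abs_mul, abs_of_nonneg (Real.sqrt_nonneg _)]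
  exact mul_le_mul (by linarith) h1 (abs_nonneg _) (by positivity)

theorem abs_tsData_ω_le (hlam : 0 < lam) (hr : 0 < r) (hBa : 0 < Ba) (j : ℕ) :
    |(tsData T lam r Ba N cf w β).ω j| ≤ (√lam + 2 / Ba ^ 2) * ((N : ℝ) + 1) ^ 2 := by
  obtain ⟨hm, hM⟩ := le_add_mul_sq (T := T) (Ba := Ba) hlam hr
  have hM0 : 0 < r / lam + T * Ba ^ 2 := hm.trans_le hM
  have h1 := abs_chebCoeff_rate_le (β := fun _ => 1) (fun _ => zero_le_one) (fun _ => le_rfl)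
    hm hM N j
  have h2 : 2 * (T : ℝ) * (r / lam + T * Ba ^ 2)⁻¹ ≤ 2 / Ba ^ 2 := by
    rw [← div_eq_mul_inv, div_le_div_iff₀ hM0 (by positivity)]
    linarith
  have h3 : 0 ≤ √lam := Real.sqrt_nonneg _
  rw [tsData]
  simp only
  rw [← mul_assoc, abs_mul, abs_of_nonneg (by positivity)]
  exact mul_le_mul (by linarith) h1 (abs_nonneg _) (by positivity)

theorem tfPolicy_tsData {C₀ B R X ρm : ℝ} (hn : n < T) (hlam : 0 < lam) (hr : 0 < r) (hBa : 0 < Ba)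
    (hcf : ∀ k, ∑ m, |cf k m| ≤ C₀) (hw : ∀ k m, ∑ i, |w k m i| + |β k m| ≤ 1)
    (hB : 1 ≤ B ∧ Ba ≤ B ∧ ρm ≤ B ∧ (2 * (T : ℝ)) ^ 2 ≤ B ∧ (N + 1) * X * Ba ≤ B ∧
      (N + 1) * X * Ba * Ba * ρm ≤ B)
    (hR : Fintype.card (TokIdx d A) * B ≤ R)
    (hR' : Fintype.card (TokIdx d A) * ((1 + C₀) * B) ≤ R)
    (hX : (√lam + 2 / Ba ^ 2) * ((N : ℝ) + 1) ^ 2 ≤ X) (hρ : 0 ≤ ρm) {o : Obs d A n}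
    (ho : ∀ t k, ‖o.1 t k‖ ≤ Ba) (hoρ : ∀ t, |o.reward t| ≤ ρm) (k : Fin A) :
    tfPolicy (tsData T lam r Ba N cf w β).params R o k = softmax (fun j => ∑ m, cf j m *
      relu (∑ i, w j m i * featAt (tsData T lam r Ba N cf w β) (obsA o) (obsR o) (obsB o)
        (Fin.last (2 * n)) i + β j m)) k := by
  obtain ⟨hm, hM⟩ := le_add_mul_sq (T := T) (Ba := Ba) hlam hr
  have hBd : Bounded (tsData T lam r Ba N cf w β) (obsA o) (obsR o) (obsB o) Ba ρm X C₀ B :=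
    { one_le_T := (by omega : 1 ≤ T)
      length_le := (by omega : 2 * n + 1 ≤ 2 * T)
      m_pos := hm
      m_le := hM
      spectrum := fun i => spectrumIn_gramAt hn.le hm ho i
      norm_a := norm_obsA_le hBa.le ho
      abs_ρ := abs_obsR_le hρ hoρ
      norm_b := norm_obsB_le hBa.le ho
      Ba_nonneg := hBa.le
      X_nonneg := le_trans (by positivity) hX
      abs_ξ := fun j _ => (abs_tsData_ξ_le hlam hr j).trans hX
      abs_ω := fun j _ => (abs_tsData_ω_le hlam hr hBa j).trans hX
      cf_le := hcf
      w_le := hw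
      one_le := hB.1
      Ba_le := hB.2.1
      ρm_le := hB.2.2.1
      pos_le := hB.2.2.2.1
      acc_le := hB.2.2.2.2.1
      y_le := hB.2.2.2.2.2 }
  rw [tfPolicy, tokens_eq]
  congr 1
  funext j
  exact params_apply hBd hR hR' (Fin.last (2 * n)) j

theorem nrm_tsData_le {C₀ X O : ℝ} (hT : 1 ≤ T) (hlam : 0 < lam) (hr : 0 < r)
    (hBa : 0 < Ba) (hC : 0 ≤ C₀) (hcf : ∀ k, ∑ m, |cf k m| ≤ C₀)
    (hw : ∀ k m, ∑ i, |w k m i| + |β k m| ≤ 1)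
    (hX : (√lam + 2 / Ba ^ 2) * ((N : ℝ) + 1) ^ 2 ≤ X) (hO : 2 ≤ O)
    (hnrm : 43 + 40 / Ba ^ 2 + 10 * X ≤ O * T) :
    (tsData T lam r Ba N cf w β).params.nrm ≤
      O * (T + A * (T : ℝ) ^ (1 / 4 : ℝ) + √(M₀ * A) + C₀) := by
  have hT1 : (1 : ℝ) ≤ T := by exact_mod_cast hT
  have hT4 : 1 ≤ (T : ℝ) ^ (1 / 4 : ℝ) := Real.one_le_rpow hT1 (by norm_num)
  have hO0 : 0 ≤ O := by linarith
  obtain ⟨hm, hMx⟩ := le_add_mul_sq (T := T) (Ba := Ba) hlam hr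
  have h1 := nrm_params_le (tsData T lam r Ba N cf w β) hT hm hMx
    (le_trans (by positivity) hX) (fun j _ => (abs_tsData_ξ_le hlam hr j).trans hX)
    (fun j _ => (abs_tsData_ω_le hlam hr hBa j).trans hX) hC hcf hw
  have h2 : 40 * (T : ℝ) / (r / lam + T * Ba ^ 2) ≤ 40 / Ba ^ 2 := by
    rw [div_le_div_iff₀ (hm.trans_le hMx) (by positivity)]
    linarith
  have h3 : (A : ℝ) ≤ A * (T : ℝ) ^ (1 / 4 : ℝ) := le_mul_of_one_le_right (by positivity) hT4
  have h4 : 2 * (A : ℝ) ≤ O * (A * (T : ℝ) ^ (1 / 4 : ℝ)) :=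
    mul_le_mul (by linarith) h3 (by positivity) hO0
  have h5 : √((M₀ : ℝ) * A) ≤ O * √((M₀ : ℝ) * A) :=
    le_mul_of_one_le_left (Real.sqrt_nonneg _) (by linarith)
  have h6 : C₀ ≤ O * C₀ := le_mul_of_one_le_left hC (by linarith)
  refine h1.trans ?_
  change 43 + 2 * (A : ℝ) + √((M₀ : ℝ) * A) + 40 * (T : ℝ) / (r / lam + T * Ba ^ 2) + 10 * X +
    C₀ ≤ _
  have h7 : O * (T + A * (T : ℝ) ^ (1 / 4 : ℝ) + √(M₀ * A) + C₀) = O * T +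
    O * (A * (T : ℝ) ^ (1 / 4 : ℝ)) + O * √((M₀ : ℝ) * A) + O * C₀ := by ring
  rw [h7]
  linarith

/-- On observations with bounded actions and rewards, separated current actions, and a posterior mean
in the ball of radius `meanRadius`, the transformer policy is close to Thompson sampling. -/
theorem log_tsPolicy_sub_log_tfPolicy_le {C₀ B R X ρm η ε δ : ℝ} (hn : n < T) (hlam : 0 < lam)
    (hr : 0 < r) (hBa : 0 < Ba) (hη : 0 < η) (hε : 0 < ε)
    (hcf : ∀ k, ∑ m, |cf k m| ≤ C₀) (hw : ∀ k m, ∑ i, |w k m i| + |β k m| ≤ 1)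
    (hfit : ∀ k, ∀ z ∈ separated d A (η * √(r / (r / lam + T * Ba ^ 2))),
      (∀ i, z i ∈ Set.Icc (-featRadius d Ba lam δ) (featRadius d Ba lam δ)) →
      |truncLogProb (ε / (4 * A)) k z - ∑ m, cf k m * relu (∑ i, w k m i * z i + β k m)| ≤ ε / 4)
    (hB : 1 ≤ B ∧ Ba ≤ B ∧ ρm ≤ B ∧ (2 * (T : ℝ)) ^ 2 ≤ B ∧ (N + 1) * X * Ba ≤ B ∧
      (N + 1) * X * Ba * Ba * ρm ≤ B)
    (hR : Fintype.card (TokIdx d A) * B ≤ R)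
    (hR' : Fintype.card (TokIdx d A) * ((1 + C₀) * B) ≤ R)
    (hX : (√lam + 2 / Ba ^ 2) * ((N : ℝ) + 1) ^ 2 ≤ X) (hρ : 0 ≤ ρm)
    (herr : C₀ * ((√lam * Ba + ρm) * chebErr (r / lam) (r / lam + T * Ba ^ 2) N) ≤ ε / 8)
    {o : Obs d A n} (ho : ∀ t k, ‖o.1 t k‖ ≤ Ba) (hoρ : ∀ t, |o.reward t| ≤ ρm)
    (hsep : ∀ i j, i ≠ j → η ≤ ‖o.current i - o.current j‖)
    (hμ : ‖tsMean lam r o‖ ≤ meanRadius d lam δ) {k : Fin A} (hk : 0 < tsPolicy lam r o k) :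
    Real.log (tsPolicy lam r o k) -
      Real.log (tfPolicy (tsData T lam r Ba N cf w β).params R o k) ≤ ε := by
  obtain ⟨hm, hM⟩ := le_add_mul_sq (T := T) (Ba := Ba) hlam hr
  have hγ : 0 < η * √(r / (r / lam + T * Ba ^ 2)) :=
    mul_pos hη (Real.sqrt_pos.2 (div_pos hr (hm.trans_le hM)))
  rw [tfPolicy_tsData hn hlam hr hBa hcf hw hB hR hR' hX hρ ho hoρ]
  exact log_tsPolicy_sub_le hε hγ hcf hw hfit (tsFeat_mem_separated hn.le hlam hr ho hsep)
    (abs_tsFeat_le hn.le hlam hr hBa.le ho hμ)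
    (mul_nonneg (by positivity) (chebErr_nonneg hm hM N)) herr
    (abs_featAt_sub_tsFeat_le hn hlam hr hBa hρ ho hoρ N cf w β) hk

end Policy

/-- On the event of `trajLaw_bad_le` the rewards are bounded. -/
theorem abs_reward_obsAt_le {lam r Ba δ : ℝ} {e : Env d A T} (k : Fin T → Fin A) (t : Fin T)
    (hBa : 0 ≤ Ba) (ho : ∀ t k, ‖e.1 t k‖ ≤ Ba) (hw : ‖e.2.1‖ ≤ meanRadius d lam δ)
    (hε : ∀ j, |e.2.2 j| ≤ 2 * √(T * r / δ)) (j : Fin t.1) :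
    |(obsAt e k t).reward j| ≤ rewardBound d T lam r Ba δ := by
  unfold rewardBound
  refine (abs_add_le _ _).trans (add_le_add ?_ (hε _))
  exact (abs_real_inner_le_norm _ _).trans (mul_le_mul (ho _ _) hw (norm_nonneg _) hBa)

/-! ### Size of the transformer -/

theorem const_le_hiddenFactor {lam₀ r ba Ba ε δ₀ C₀ : ℝ} {M₀ : ℕ} (hlam₀ : 0 < lam₀) (hr : 0 < r)
    (hba : 0 < ba) (hBa : 0 < Ba) (hε : 0 < ε) (hε1 : ε < 1 / 4) (hδ : 0 < δ₀) (hC : 0 < C₀) :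
    200000 ≤ hiddenFactor 200000 8 lam₀ r ba Ba M₀ C₀ T A d δ₀ ε := by
  have h1 : 0 < 1 / lam₀ := by positivity
  have h2 : 0 < 1 / r := by positivity
  have h3 : 0 < 1 / ba := by positivity
  have h4 : 0 < 1 / δ₀ := by positivity
  have h5 : 4 ≤ 1 / ε := by rw [le_div_iff₀ hε]; linarith
  have h6 : (1 : ℝ) ≤ (1 + lam₀ + 1 / lam₀ + r + 1 / r + 1 / ba + Ba) ^ 8 :=
    one_le_pow₀ (by linarith)
  have h7 : (1 : ℝ) ≤ Real.log (M₀ + C₀ + T + A + d + 1 / δ₀ + 1 / ε) ^ 8 := by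
    refine one_le_pow₀ ?_
    have h8 : (4 : ℝ) ≤ M₀ + C₀ + T + A + d + 1 / δ₀ + 1 / ε := by
      have : (0 : ℝ) ≤ M₀ := by positivity
      have : (0 : ℝ) ≤ T := by positivity
      have : (0 : ℝ) ≤ A := by positivity
      have : (0 : ℝ) ≤ d := by positivity
      linarith
    rw [Real.le_log_iff_exp_le (by linarith)]
    linarith [Real.exp_one_lt_d9]
  unfold hiddenFactor
  rw [mul_assoc]
  exact le_mul_of_one_le_right (by norm_num) (one_le_mul_of_one_le_of_one_le h6 h7)

end

end TSTransformer

open TSTransformer in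
theorem theorem4 :
    ∃ (C : ℝ) (q : ℕ), ∀ (d A T : ℕ) (lam lam₀ r ba Ba η ε δ₀ : ℝ) (M₀ : ℕ) (C₀ : ℝ),
      1 ≤ d → 1 ≤ A → 1 ≤ T → 0 < lam₀ → (lam = lam₀ ∨ lam = lam₀ / d) → 0 < r → 0 < ba → 0 < Ba →
      0 < η → 0 < ε → ε < min η 1 / 4 → 0 < δ₀ → δ₀ < 1 / 2 → 0 < M₀ → 0 < C₀ →
      (∀ k : Fin A, TSTransformer.ReluApproximable
        (TSTransformer.truncLogProb (d := d) (A := A) (ε / (4 * A)) k)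
        (TSTransformer.separated d A (η * √(r / (r / lam + T * Ba ^ 2))))
        (ε / 4) (TSTransformer.featRadius d Ba lam δ₀) M₀ C₀) →
      ∃ (p L M D' : ℕ) (θ : TSTransformer.TFParams (TSTransformer.Coord d A p) L M D') (R : ℝ),
        let O : ℝ := TSTransformer.hiddenFactor C q lam₀ r ba Ba M₀ C₀ T A d δ₀ ε
        0 < R ∧ |Real.log R| ≤ O ∧
        (Fintype.card (TSTransformer.Coord d A p) : ℝ) ≤ O * ((T : ℝ) ^ (1 / 4 : ℝ) * A * d) ∧
        (L : ℝ) ≤ O * √(T : ℝ) ∧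
        (M : ℝ) ≤ O * (A * (T : ℝ) ^ (1 / 4 : ℝ)) ∧
        (D' : ℝ) ≤ O * (A * ((T : ℝ) ^ (1 / 4 : ℝ) * d + M₀)) ∧
        θ.nrm ≤ O * (T + A * (T : ℝ) ^ (1 / 4 : ℝ) + √(M₀ * A) + C₀) ∧
        ∀ (ν : MeasureTheory.Measure (Fin T → TSTransformer.ActionSet d A))
          [MeasureTheory.IsProbabilityMeasure ν],
          (∀ᵐ α ∂ν, TSTransformer.AdmissibleActions ba Ba η α) →
          ∀ alg : TSTransformer.Algorithm d A T,
            TSTransformer.trajLaw ν lam r alg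
              {x | ¬ ∀ (t : Fin T) (k : Fin A),
                0 < TSTransformer.tsPolicy lam r (TSTransformer.obsAt x.1 x.2 t) k →
                Real.log (TSTransformer.tsPolicy lam r (TSTransformer.obsAt x.1 x.2 t) k)
                  - Real.log (TSTransformer.tfPolicy θ R (TSTransformer.obsAt x.1 x.2 t) k) ≤ ε}
              ≤ ENNReal.ofReal δ₀ := by
  refine ⟨200000, 8, ?_⟩
  intro d A T lam lam₀ r ba Ba η ε δ₀ M₀ C₀ hd hA hT hlam₀ hlameq hr hba hBa hη hε hε1 hδ hδ1 hM hC
    happ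
  have hd1 : (1 : ℝ) ≤ d := by exact_mod_cast hd
  have hA1 : (1 : ℝ) ≤ A := by exact_mod_cast hA
  have hT1 : (1 : ℝ) ≤ T := by exact_mod_cast hT
  have hT4 : 1 ≤ (T : ℝ) ^ (1 / 4 : ℝ) := Real.one_le_rpow hT1 (by norm_num)
  have hlam : 0 < lam := by
    rcases hlameq with rfl | rfl
    · exact hlam₀
    · positivity
  have hle : lam ≤ lam₀ := by
    rcases hlameq with rfl | rfl
    · exact le_rfl
    · exact div_le_self hlam₀.le hd1
  have hε4 : ε < 1 / 4 := by
    have := min_le_right η 1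
    linarith
  have hO := const_le_hiddenFactor (M₀ := M₀) (T := T) (A := A) (d := d) hlam₀ hr hba hBa hε hε4
    hδ hC
  by_cases hab : ba ≤ Ba
  · choose cf w β hcf hw hfit using happ
    obtain ⟨N, B, R, X, hB, ⟨hR0, hR, hR'⟩, hX, herr, hlog, hL, hnrm, -⟩ :=
      exists_parameters hd hA hT hlam₀ hlam hle hr hba hab hε hε4 hδ hδ1 hM hC
    refine ⟨numFree d A, 2 * N + 5, A * 2, numHid d A M₀, (tsData T lam r Ba N cf w β).params, R, ?_⟩
    intro O
    replace hO : 200000 ≤ O := hO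
    replace hlog : |Real.log R| ≤ O := hlog
    replace hL : 2 * (N : ℝ) + 5 ≤ O * √(T : ℝ) := hL
    replace hnrm : 43 + 40 / Ba ^ 2 + 10 * X ≤ O * T := hnrm
    clear_value O
    have hO0 : 0 ≤ O := by linarith
    obtain ⟨hm, hMx⟩ := le_add_mul_sq (T := T) (Ba := Ba) hlam hr
    refine ⟨hR0, hlog, ?_, ?_, ?_, ?_, ?_, ?_⟩
    · refine (card_tokIdx_le hd hA).trans ?_
      have h1 : (A : ℝ) * d ≤ (T : ℝ) ^ (1 / 4 : ℝ) * A * d := by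
        rw [mul_assoc]
        exact le_mul_of_one_le_left (by positivity) hT4
      exact mul_le_mul (by linarith) h1 (by positivity) hO0
    · push_cast
      exact hL
    · push_cast
      have h1 : (A : ℝ) ≤ A * (T : ℝ) ^ (1 / 4 : ℝ) := le_mul_of_one_le_right (by positivity) hT4
      rw [mul_comm]
      exact mul_le_mul (by linarith) h1 (by positivity) hO0
    · refine (numHid_le M₀).trans ?_
      have h1 : (d : ℝ) ≤ (T : ℝ) ^ (1 / 4 : ℝ) * d := le_mul_of_one_le_left (by positivity) hT4
      have h2 : (A : ℝ) * (d + M₀) ≤ A * ((T : ℝ) ^ (1 / 4 : ℝ) * d + M₀) := by gcongr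
      exact mul_le_mul (by linarith) h2 (by positivity) hO0
    · exact nrm_tsData_le hT hlam hr hBa hC.le hcf hw hX (by linarith) hnrm
    · intro ν _ hadm alg
      refine (MeasureTheory.measure_mono fun x hx => ?_).trans
        (trajLaw_bad_le (ν := ν) hA hlam hr hδ hδ1 hadm alg)
      refine fun hgood => hx fun t k hk => ?_
      obtain ⟨hα, hμ, hwn, hnoise⟩ := hgood
      have ho : ∀ t k, ‖x.1.1 t k‖ ≤ Ba := fun t k => ((hα t).1 k).2
      have hρ0 := rewardBound_nonneg d T lam r δ₀ hBa.le
      have hrew := fun j => abs_reward_obsAt_le (r := r) x.2 t hBa.le ho hwn hnoise j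
      have hobs : ∀ (s : Fin (t.1 + 1)) (k : Fin A), ‖(obsAt x.1 x.2 t).1 s k‖ ≤ Ba :=
        fun s k => ho ⟨s.1, by omega⟩ k
      have hsep : ∀ i j, i ≠ j →
          η ≤ ‖(obsAt x.1 x.2 t).current i - (obsAt x.1 x.2 t).current j‖ := (hα t).2
      exact log_tsPolicy_sub_log_tfPolicy_le t.2 hlam hr hBa hη hε hcf hw hfit hB hR hR' hX hρ0 herr
        hobs hrew hsep (hμ t) hk
  · -- no action set is admissible
    refine ⟨0, 0, 0, 0, ⟨fun l => l.elim0, fun l => l.elim0⟩, 1, ?_⟩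
    intro O
    replace hO : 200000 ≤ O := hO
    clear_value O
    have hO0 : 0 ≤ O := by linarith
    refine ⟨one_pos, by simpa using hO0, ?_, by simpa using by positivity, by simpa using by positivity,
      by simpa using by positivity, ?_, ?_⟩
    · have h1 : Fintype.card (Coord d A 0) ≤ Fintype.card (TokIdx d A) := by
        simp [TokIdx, Coord]
      have h2 : (A : ℝ) * d ≤ (T : ℝ) ^ (1 / 4 : ℝ) * A * d := by
        rw [mul_assoc]
        exact le_mul_of_one_le_left (by positivity) hT4
      refine (Nat.cast_le.2 h1).trans ((card_tokIdx_le hd hA).trans ?_)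
      exact mul_le_mul (by linarith) h2 (by positivity) hO0
    · rw [TFParams.nrm, Real.iSup_of_isEmpty]
      positivity
    · intro ν _ hadm
      obtain ⟨α, hα⟩ := hadm.exists
      have h1 := (hα ⟨0, hT⟩).1 ⟨0, hA⟩
      exact absurd (h1.1.trans h1.2) hab
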